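/- **Setting.** Let $\mathcal U,\mathcal H$ be separable real Hilbert spaces (of finite or infinite dimension) and $\Theta$ a separable real Banach space. Let $\mathcal C_0$ be a bounded operator on $\mathcal U$ with an orthonormal basis of eigenvectors and eigenvalues $\lambda_k>0$, let $\tilde s\in(0,1]$ with $\mathrm{Tr}(\mathcal C_0^{\tilde s})=\sum_k\lambda_k^{\tilde s}<\infty$, and let $\|u\|_{\mathcal U^{t}}=\|\mathcal C_0^{-t/2}u\|_{\mathcal U}$. Let $\mathcal C_1$ be a bounded operator on $\mathcal H$ with an orthonormal basis of eigenvectors $\varphi_k$ and eigenvalues $\zeta_k>0$, and let $\|y\|_{\mathcal H^{t}}=\|\mathcal C_1^{-t/2}y\|_{\mathcal H}$; for $t<0$, $\mathcal H^t$ is the space of formal series $y=\sum_k y_k\varphi_k$ with finite norm. Let $\Gamma$ be a bounded, positive, injective operator on $\mathcal H$ with positive square root $\Gamma^{1/2}$, and let $\alpha\in\mathbb R$, $s\ge 0$ be such that $\|\mathcal C_1^{s/2}\Gamma^{-1/2}y\|_{\mathcal H}\le K\|y\|_{\mathcal H^{\alpha-s}}$ for all $y\in \mathcal H^{\alpha-s}\cap\mathrm{ran}\,\Gamma^{1/2}$;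 $\mathcal C_1^{s/2}\Gamma^{-1/2}$ also denotes a bounded extension to $\mathcal H^{\alpha-s}$. Let $\mathcal G$ be the forward map on $\mathcal U$ and $\mathcal L_x$ ($x\in\mathcal X$) the measurement operators with values in $\mathcal H$. Assume that for all $x$ and all $u,u_1,u_2\in\mathcal U^{1-\tilde s}$, $\mathcal L_x\mathcal G(u)\in \mathrm{ran}\,\Gamma^{1/2}$, $\Gamma^{-1/2}\mathcal L_x\mathcal G(u)\in\mathcal H^{s}$ and $$\|\mathcal C_1^{-s/2}\Gamma^{-1/2}\mathcal L_x\mathcal G(u)\|_{\mathcal H}\le M_1(\|u\|_{\mathcal U^{1-\tilde s}}),$$ $$\|\mathcal C_1^{-s/2}\Gamma^{-1/2}(\mathcal L_x\mathcal G(u_1)-\mathcal L_x\mathcal G(u_2))\|_{\mathcal H}\le M_2(\|u_1\|_{\mathcal U^{1-\tilde s}},\|u_2\|_{\mathcal U^{1-\tilde s}})\|u_1-u_2\|_{\mathcal U^{1-\tilde s}},$$ where $M_1$ and $M_2$ are non-decreasing in each argument and, unless $\dim\mathcal H<\infty$, $M_1$ grows at most linearly. For $y\in\mathcal H^{\alpha-s}$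 put $$\Phi(u;(x,y))=\tfrac12\|\Gamma^{-1/2}\mathcal L_x\mathcal G(u)\|_{\mathcal H}^2-\langle\Gamma^{-1/2}y,\Gamma^{-1/2}\mathcal L_x\mathcal G(u)\rangle_{\mathcal H},$$ the last term being read as $\langle\mathcal C_1^{s/2}\Gamma^{-1/2}y,\mathcal C_1^{-s/2}\Gamma^{-1/2}\mathcal L_x\mathcal G(u)\rangle_{\mathcal H}$. Let $S_1,\dots,S_n$ be data sets, $S_i=(z_{i1},\dots,z_{im})$ with $z_{ij}=(x_{ij},y_{ij})\in\mathcal X\times\mathcal H^{\alpha-s}$. Let $f(S_i;\theta)\in\mathcal U^{1+\tilde s}$ satisfy $\|f(S_i;\theta)\|_{\mathcal U^{1+\tilde s}}\le R_u$ for all $i$ and all $\theta\in\Theta$, let $\mathbb P^\theta_{S_i}=\mathcal N(f(S_i;\theta),\mathcal C_0)$, and put $$Z_m(S_i,\mathbb P^\theta_{S_i})=\int_{\mathcal U}\exp\Big(-\sum_{j=1}^m\Phi(u;z_{ij})\Big)\,\mathbb P^\theta_{S_i}(du),\qquad \Phi^h(\theta)=-\frac1{m+1}\sum_{i=1}^n\ln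 Z_m(S_i,\mathbb P^\theta_{S_i}).$$ Let $$\tilde\Phi(u;S_i,\theta)=\tfrac12\|\mathcal C_0^{-1/2}f(S_i;\theta)\|_{\mathcal U}^2-\langle\mathcal C_0^{-1/2}f(S_i;\theta),\mathcal C_0^{-1/2}u\rangle_{\mathcal U}=-\ln\frac{d\mathbb P^\theta_{S_i}}{d\mathcal N(0,\mathcal C_0)}(u)$$ and assume that for every $i$ and every $u\in\mathcal U^{1-\tilde s}$ this is Fréchet differentiable in $\theta$, with $$\|D_\theta\tilde\Phi(u;S_i,\theta)\|_{\Theta^*}\le M_5(r)\,(1+\|u\|_{\mathcal U^{1-\tilde s}})\qquad\text{whenever }\|\theta\|_\Theta<r .$$ Let the hyper-prior $\mathscr P$ be a Gaussian measure on $\Theta$ with mean $\theta_0$ and Cameron–Martin space $(E,\|\cdot\|_E)$, and let the hyper-posterior $\mathscr Q$ have density $\exp(-\Phi^h)/Z_p$ with respect to $\mathscr P$, where $Z_p=\int_\Theta \exp(-\Phi^h)\,d\mathscr P$. A point $\theta\in\Theta$ is a MAP estimate of $\mathscr Q$ if $$\lim_{r\downarrow0}\ \mathscr Q(B_\Theta(\theta,r))\Big/\sup_{\vartheta\in\Theta}\mathscr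 Q(B_\Theta(\vartheta,r))=1 .$$ **Theorem 4.2.** Under these assumptions: 1. $0<Z_m(S_i,\mathbb P^\theta_{S_i})<\infty$ for all $i$ and $\theta$, and $\Phi^h$ is locally bounded and locally Lipschitz: for every $r$ it is bounded and Lipschitz on $\{\theta\in\Theta:\|\theta\|_\Theta<r\}$. 2. $\mathscr Q$ is a probability measure, and it has a MAP estimate. 3. $\theta\in\Theta$ is a MAP estimate of $\mathscr Q$ if and only if $\theta\in\theta_0+E$ and $\theta$ solves $$\min_{\vartheta\in\theta_0+E}\ \Phi^h(\vartheta)+\tfrac12\|\vartheta-\theta_0\|_E^2 .$$ -/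

import Mathlib

open MeasureTheory ProbabilityTheory Filter Topology
open scoped ENNReal

namespace HyperPosterior

noncomputable section

/-! ### Hilbert scales of a positive definite operator given by its eigen-system -/

/-- The space `C^{t/2} V` of the Hilbert scale of an operator `C` on `V` with eigenvalues `lam k`,
described by coordinates in the eigenbasis: `∑ₖ (lam k)^{-t} (v k)² < ∞`. For `t > 0` this is a
subspace of `V`, for `t < 0` a space of (formal) sequences larger than `V`. -/
def scaleSpace {ι : Type*} (lam : ι → ℝ) (t : ℝ) : Submodule ℝ (ι → ℝ) where
  carrier := {v | Summable fun k => (lam k ^ (-t / 2) * v k) ^ 2}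
  zero_mem' := by simp [summable_zero]
  add_mem' := by
    intro a b ha hb
    have h2 : Summable fun k =>
        2 * (lam k ^ (-t / 2) * a k) ^ 2 + 2 * (lam k ^ (-t / 2) * b k) ^ 2 :=
      (ha.mul_left 2).add (hb.mul_left 2)
    refine Summable.of_nonneg_of_le (fun k => sq_nonneg _) (fun k => ?_) h2
    simp only [Pi.add_apply]
    nlinarith [sq_nonneg (lam k ^ (-t / 2) * a k - lam k ^ (-t / 2) * b k)]
  smul_mem' := by
    intro c a ha
    have h2 : Summable fun k => c ^ 2 * (lam k ^ (-t / 2) * a k) ^ 2 := ha.mul_left (c ^ 2)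
    refine h2.congr (fun k => ?_)
    simp only [Pi.smul_apply, smul_eq_mul]
    ring

/-- The norm `‖v‖_{V^t} = ‖C^{-t/2} v‖_V` on the scale. -/
def scaleNorm {ι : Type*} (lam : ι → ℝ) (t : ℝ) (v : ι → ℝ) : ℝ :=
  √(∑' k, (lam k ^ (-t / 2) * v k) ^ 2)

/-- Coordinates of a vector in a Hilbert basis. -/
def coord {ι V : Type*} [NormedAddCommGroup V] [InnerProductSpace ℝ V]
    (e : HilbertBasis ι ℝ V) (v : V) : ι → ℝ := fun k => inner ℝ (e k) v

/-! ### Gaussian measures -/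

/-- `μ = 𝒩(a, C)` on a Hilbert space. -/
def IsGaussianWith {V : Type*} [NormedAddCommGroup V] [InnerProductSpace ℝ V] [CompleteSpace V]
    [MeasurableSpace V] [BorelSpace V] (μ : Measure V) (a : V) (C : V →L[ℝ] V) : Prop :=
  IsGaussian μ ∧ ∫ u, u ∂μ = a ∧
    ∀ x y : V, cov[fun u => inner ℝ x u, fun u => inner ℝ y u; μ] = inner ℝ (C x) y

/-- Cameron–Martin norm of `h` for a Gaussian measure `μ` on a Banach space:
`|h|_{E} = sup {ℓ(h) : ℓ ∈ Θ*, Var_μ(ℓ) ≤ 1} ∈ [0, ∞]`. -/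
def cmNorm {Θ : Type*} [NormedAddCommGroup Θ] [NormedSpace ℝ Θ] [MeasurableSpace Θ]
    (μ : Measure Θ) (h : Θ) : ℝ≥0∞ :=
  ⨆ (ℓ : StrongDual ℝ Θ) (_ : Var[fun θ => ℓ θ; μ] ≤ 1), ENNReal.ofReal (ℓ h)

/-- The affine space `m + E`, where `m` is the mean and `E` the Cameron–Martin space of `μ`. -/
def cmAffine {Θ : Type*} [NormedAddCommGroup Θ] [NormedSpace ℝ Θ] [MeasurableSpace Θ]
    (μ : Measure Θ) : Set Θ :=
  {θ | cmNorm μ (θ - ∫ ϑ, ϑ ∂μ) < ∞}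

/-! ### Maximum a posteriori estimators -/

/-- `θ` is a MAP estimator of `μ`: asymptotically, as the radius tends to `0`, no ball of the same
radius has larger `μ`-mass than the one centred at `θ`. -/
def IsMAPEstimator {Θ : Type*} [NormedAddCommGroup Θ] [MeasurableSpace Θ]
    (μ : Measure Θ) (θ : Θ) : Prop :=
  Tendsto (fun r : ℝ => μ (Metric.ball θ r) / ⨆ ϑ : Θ, μ (Metric.ball ϑ r)) (𝓝[>] 0) (𝓝 1)

/-! ### The potentials -/

section Potentials

variable {κ H : Type*} [NormedAddCommGroup H] [InnerProductSpace ℝ H]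

/-- `Γ^{-1/2} v`, where `R = Γ^{1/2}` (meaningful for `v` in the range of the injective `R`). -/
def negHalf (R : H →L[ℝ] H) (v : H) : H := Function.invFun R v

/-- `B : H^{α-s} → H` is a bounded extension of the operator `C₁^{s/2} Γ^{-1/2}`, which is given on
`range Γ^{1/2} ∩ H^{α-s}`; here `R = Γ^{1/2}`, and `φ`, `ζ` is the eigen-system of `C₁`. -/
def IsWhitening (φ : HilbertBasis κ ℝ H) (ζ : κ → ℝ) (R : H →L[ℝ] H) (α s : ℝ)
    (B : scaleSpace ζ (α - s) →ₗ[ℝ] H) : Prop :=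
  (∃ K : ℝ, ∀ y, ‖B y‖ ≤ K * scaleNorm ζ (α - s) y) ∧
    ∀ (w : H) (hw : coord φ (R w) ∈ scaleSpace ζ (α - s)) (k : κ),
      coord φ (B ⟨coord φ (R w), hw⟩) k = ζ k ^ (s / 2) * coord φ w k

open Classical in
/-- `C₁^{s/2} Γ^{-1/2} y` for `y ∈ H^{α-s}`, through the bounded extension of `C₁^{s/2} Γ^{-1/2}`. -/
def whiten (φ : HilbertBasis κ ℝ H) (ζ : κ → ℝ) (R : H →L[ℝ] H) (α s : ℝ)
    (y : scaleSpace ζ (α - s)) : H :=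
  if h : ∃ B, IsWhitening φ ζ R α s B then h.choose y else 0

/-- The misfit `½‖Γ^{-1/2} g‖² - ⟨Γ^{-1/2} y, Γ^{-1/2} g⟩` of an observation `g` and a datum
`y ∈ H^{α-s}`. The second term is read as `⟨C₁^{s/2} Γ^{-1/2} y, C₁^{-s/2} Γ^{-1/2} g⟩`. -/
def misfit (φ : HilbertBasis κ ℝ H) (ζ : κ → ℝ) (R : H →L[ℝ] H) (α s : ℝ)
    (g : H) (y : scaleSpace ζ (α - s)) : ℝ :=
  1 / 2 * ‖negHalf R g‖ ^ 2 -
    ∑' k, coord φ (whiten φ ζ R α s y) k * (ζ k ^ (-s / 2) * coord φ (negHalf R g) k)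

/-- The potential `Φ(u; (x, y))` of the observation `L_x G(u)` and the datum `y`. -/
def potential {U W X : Type*} (φ : HilbertBasis κ ℝ H) (ζ : κ → ℝ) (R : H →L[ℝ] H) (α s : ℝ)
    (G : U → W) (L : X → W → H) (u : U) (z : X × scaleSpace ζ (α - s)) : ℝ :=
  misfit φ ζ R α s (L z.1 (G u)) z.2

/-- `Φ̃ = ½‖C₀^{-1/2} v‖² - ⟨C₀^{-1/2} v, C₀^{-1/2} u⟩`, i.e. the negative logarithm of the density
of `𝒩(v, C₀)` with respect to `𝒩(0, C₀)` at `u`, for `v ∈ U^{1+τ}` and `u ∈ U^{1-τ}`. -/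
def shiftPotential {ι U : Type*} [NormedAddCommGroup U] [InnerProductSpace ℝ U]
    (e : HilbertBasis ι ℝ U) (lam : ι → ℝ) (v u : U) : ℝ :=
  1 / 2 * scaleNorm lam 1 (coord e v) ^ 2 - ∑' k, (lam k)⁻¹ * coord e v k * coord e u k

/-- Unnormalised likelihood of a data set `S = ((x₁,y₁),…,(x_m,y_m))`: `exp (-∑ⱼ Φ(u; xⱼ, yⱼ))`,
for the potential `pot u z = Φ(u; z)`. -/
def likelihood {U Z : Type*} {m : ℕ} (pot : U → Z → ℝ) (S : Fin m → Z) (u : U) : ℝ :=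
  Real.exp (-∑ j, pot u (S j))

/-- `Z_m(S, ℙ) = ∫ exp (-∑ⱼ Φ(u; zⱼ)) ℙ(du)`. -/
def Zm {U Z : Type*} [MeasurableSpace U] {m : ℕ} (pot : U → Z → ℝ) (S : Fin m → Z)
    (P : Measure U) : ℝ :=
  ∫ u, likelihood pot S u ∂P

/-- `Φ^h(θ) = -(1/(m+1)) ∑ᵢ ln Z_m(Sᵢ, ℙ_{Sᵢ}^θ)`. -/
def hyperPotential {U Z Θ : Type*} [MeasurableSpace U] {n m : ℕ} (pot : U → Z → ℝ)
    (P : (Fin m → Z) → Θ → Measure U) (S : Fin n → Fin m → Z) (θ : Θ) : ℝ :=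
  -(1 / ((m : ℝ) + 1)) * ∑ i, Real.log (Zm pot (S i) (P (S i) θ))

/-- The hyper-posterior, with density `exp (-Φ^h) / Z_p` with respect to the hyper-prior, where
`Z_p = ∫ exp (-Φ^h) d𝒫`. -/
def hyperPosterior {U Z Θ : Type*} [MeasurableSpace U] [MeasurableSpace Θ] {n m : ℕ}
    (pot : U → Z → ℝ) (P : (Fin m → Z) → Θ → Measure U) (S : Fin n → Fin m → Z)
    (hyperPrior : Measure Θ) : Measure Θ :=
  hyperPrior.tilted fun θ => -hyperPotential pot P S θ

end Potentials

end

end HyperPosterior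

namespace HyperPosterior

/-! ### The Prékopa–Leindler inequality for Gaussian measures -/

/-! The theorem separates into an analytic statement about `Φ^h` and a general statement about
Gaussian measures. The analytic one: `Φ^h` is bounded on all of `Θ` and Lipschitz on balls. The
general one: if `Φ` has these two properties and `μ` is Gaussian, the MAP estimates of `exp(-Φ) μ`
exist and are exactly the minimizers of `Φ + ½|·|²`, with the Cameron–Martin norm relative to the
mean.

For the general statement take `μ` centred. A ball around `h` of Cameron–Martin norm at most `R` has
mass at least `exp(-R²/2) μ(B(0,r))` (`le_measure_ball_of_mem_cmBall`). A ball missing the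
Cameron–Martin ball of radius `R` has mass at most the same quantity
(`measure_ball_le_of_disjoint_cmBall`). The upper bound rests on Anderson's inequality, obtained
here from Prékopa–Leindler on the line, tensorization, linear images and a limit of cylinder sets.
Cameron–Martin balls are compact, so a minimal value `J` of the functional is attained. Then `sup_ϑ
Q(B(ϑ,r))` equals `exp(-J) μ(B(0,r)) / Z` up to a factor `exp(O(r))`. The upper half,
`tilted_ball_le_of_min`, is uniform in the centre, so no compactness of almost maximal centres is
needed. Comparing one fixed centre with this supremum gives both directions of the characterization.

For the analytic statement, `Z_m` integrates `F = exp(-∑ Φ)` against `𝒩(a, C₀)` with `a` in a fixed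
ball of `U^{1+σ}`. The trace condition gives `‖u - a‖` in `U^{1-σ}` exponential moments that do not
depend on `a`. Since `F` grows at most exponentially and is locally bounded below, `Z_m` stays
between two positive constants. The Cameron–Martin formula, with the duality of `U^{1+σ}` and
`U^{1-σ}`, makes `Z_m` Lipschitz in `a` (`IsScaleRegular.exists_abs_integral_sub_le`). By the same
duality the bound on `D_θ Φ̃` says that `θ ↦ f(S;θ)` is locally Lipschitz into `U^{1+σ}`, because
`Φ̃` is affine in `u`. -/

theorem volume_add_volume_le_of_midpoint {A B C : Set ℝ} (hA : MeasurableSet A)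
    (hB : MeasurableSet B) (hA0 : A.Nonempty) (hB0 : B.Nonempty)
    (h : ∀ x ∈ A, ∀ y ∈ B, (x + y) / 2 ∈ C) :
    volume A + volume B ≤ 2 * volume C := by
  have key : ∀ K ⊆ A, IsCompact K → ∀ L ⊆ B, IsCompact L → K.Nonempty → L.Nonempty →
      volume K + volume L ≤ 2 * volume C := by
    intro K hKA hK L hLB hL hK0 hL0
    -- One-dimensional Brunn–Minkowski: with `a = max K` and `b = min L`, the sets `K + b` and `a +
    -- L` both lie in `2C` and meet at most in `a + b`.
    obtain ⟨a, haK, ha⟩ := hK.exists_isGreatest hK0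
    obtain ⟨b, hbL, hb⟩ := hL.exists_isLeast hL0
    have h2 : volume ((fun z => z * 2⁻¹) ⁻¹' C) = 2 * volume C := by
      rw [Real.volume_preimage_mul_right (by norm_num)]
      norm_num
    rw [← h2]
    have e1 : volume ((fun x => x + (-b)) ⁻¹' K) = volume K := measure_preimage_add_right _ _ _
    have e2 : volume ((fun x => x + (-a)) ⁻¹' L) = volume L := measure_preimage_add_right _ _ _
    rw [← e1, ← e2, ← measure_union₀]
    · refine measure_mono ?_
      rintro z (hz | hz)
      · have := h _ (hKA hz) _ (hLB hbL)
        simpa [div_eq_mul_inv] using this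
      · have := h _ (hKA haK) _ (hLB hz)
        simpa [div_eq_mul_inv] using this
    · exact (hL.measurableSet.preimage (by fun_prop)).nullMeasurableSet
    · refine measure_mono_null (t := {a + b}) ?_ (by simp)
      rintro z ⟨hz1, hz2⟩
      have := ha hz1
      have := hb hz2
      simp only [Set.mem_singleton_iff]
      linarith
  obtain ⟨a0, ha0⟩ := hA0
  obtain ⟨b0, hb0⟩ := hB0
  rw [hA.measure_eq_iSup_isCompact, hB.measure_eq_iSup_isCompact]
  have e : ∀ S : Set ℝ, ⨆ K ⊆ S, ⨆ (_ : IsCompact K), volume K =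
      ⨆ K, ⨆ (_ : K ⊆ S ∧ IsCompact K), volume K := fun S => by simp only [iSup_and]
  rw [e, e]
  refine ENNReal.biSup_add_biSup_le' ⟨∅, by simp, isCompact_empty⟩ ⟨∅, by simp, isCompact_empty⟩ ?_
  rintro K ⟨hKA, hK⟩ L ⟨hLB, hL⟩
  -- The inner compact sets may be empty; adding one point of `A` and of `B` makes them nonempty
  -- without leaving `A` and `B`.
  refine le_trans (add_le_add (measure_mono (Set.subset_insert a0 K))
    (measure_mono (Set.subset_insert b0 L))) ?_
  exact key _ (Set.insert_subset ha0 hKA) (hK.insert a0) _ (Set.insert_subset hb0 hLB)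
    (hL.insert b0) (Set.insert_nonempty _ _) (Set.insert_nonempty _ _)

theorem ENNReal.four_mul_mul_le_add_sq (x y : ℝ≥0∞) : 4 * (x * y) ≤ (x + y) ^ 2 := by
  induction x using ENNReal.recTopCoe with
  | top => simp
  | coe x =>
    induction y using ENNReal.recTopCoe with
    | top => simp
    | coe y =>
      norm_cast
      rw [← NNReal.coe_le_coe]
      push_cast
      nlinarith [sq_nonneg ((x : ℝ) - y)]

/-- Layer-cake formula: for `t < 1` the superlevel sets of `f` and `g` are nonempty and their
midpoints lie in that of `h`, so Brunn–Minkowski applies level by level. For `t ≥ 1` the sets of `f`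
and `g` are empty. -/
theorem lintegral_add_lintegral_le_of_midpoint {f g h : ℝ → ℝ} (hf : Measurable f)
    (hg : Measurable g) (hh : Measurable h) (hf0 : ∀ x, 0 ≤ f x) (hg0 : ∀ x, 0 ≤ g x)
    (hh0 : ∀ x, 0 ≤ h x) (hf1 : ∀ x, f x ≤ 1) (hg1 : ∀ x, g x ≤ 1)
    (hfs : ∀ t < 1, ∃ x, t < f x) (hgs : ∀ t < 1, ∃ x, t < g x)
    (H : ∀ x y, f x * g y ≤ h ((x + y) / 2) ^ 2) :
    (∫⁻ x, ENNReal.ofReal (f x)) + ∫⁻ x, ENNReal.ofReal (g x) ≤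
      2 * ∫⁻ x, ENNReal.ofReal (h x) := by
  rw [lintegral_eq_lintegral_meas_lt _ (ae_of_all _ hf0) hf.aemeasurable,
    lintegral_eq_lintegral_meas_lt _ (ae_of_all _ hg0) hg.aemeasurable,
    lintegral_eq_lintegral_meas_lt _ (ae_of_all _ hh0) hh.aemeasurable]
  have hanti : ∀ f : ℝ → ℝ, Measurable fun t : ℝ => volume {a | t < f a} := fun f =>
    Antitone.measurable fun s t hst => measure_mono fun a (ha : t < f a) => lt_of_le_of_lt hst ha
  rw [← lintegral_add_left (hanti f), ← lintegral_const_mul _ (hanti h)]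
  refine lintegral_mono_ae ?_
  filter_upwards [ae_restrict_mem measurableSet_Ioi] with t (ht : 0 < t)
  rcases lt_or_ge t 1 with ht1 | ht1
  · refine volume_add_volume_le_of_midpoint (measurableSet_lt measurable_const hf)
      (measurableSet_lt measurable_const hg) (hfs t ht1) (hgs t ht1) ?_
    intro x (hx : t < f x) y (hy : t < g y)
    have h1 := H x y
    have h2 : t * t < f x * g y := mul_lt_mul'' hx hy ht.le ht.le
    exact lt_of_pow_lt_pow_left₀ 2 (hh0 _) (by nlinarith)
  · have e1 : {a | t < f a} = ∅ := by
      ext x; simpa using (hf1 x).trans ht1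
    have e2 : {a | t < g a} = ∅ := by
      ext x; simpa using (hg1 x).trans ht1
    simp [e1, e2]

/-- Dividing `f` and `g` by their suprema `a`, `b` and `h` by `√(ab)` reaches the normalized case;
the arithmetic–geometric mean inequality then turns the sum into a product. -/
theorem lintegral_mul_lintegral_le_sq_of_midpoint {f g h : ℝ → ℝ} (hf : Measurable f)
    (hg : Measurable g) (hh : Measurable h) (hf0 : ∀ x, 0 ≤ f x) (hg0 : ∀ x, 0 ≤ g x)
    (hh0 : ∀ x, 0 ≤ h x) (hfb : BddAbove (Set.range f)) (hgb : BddAbove (Set.range g))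
    (H : ∀ x y, f x * g y ≤ h ((x + y) / 2) ^ 2) :
    (∫⁻ x, ENNReal.ofReal (f x)) * ∫⁻ x, ENNReal.ofReal (g x) ≤
      (∫⁻ x, ENNReal.ofReal (h x)) ^ 2 := by
  have hfle : ∀ x, f x ≤ ⨆ x, f x := fun x => le_ciSup hfb x
  have hgle : ∀ x, g x ≤ ⨆ x, g x := fun x => le_ciSup hgb x
  rcases ((hf0 0).trans (hfle 0)).eq_or_lt with ha | ha
  · have : ∀ x, f x = 0 := fun x => le_antisymm (ha ▸ hfle x) (hf0 x)
    simp [this]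
  rcases ((hg0 0).trans (hgle 0)).eq_or_lt with hb | hb
  · have : ∀ x, g x = 0 := fun x => le_antisymm (hb ▸ hgle x) (hg0 x)
    simp [this]
  set a := ⨆ x, f x with ha'
  set b := ⨆ x, g x with hb'
  have hc : 0 < √(a * b) := by positivity
  have key := lintegral_add_lintegral_le_of_midpoint (f := fun x => a⁻¹ * f x)
    (g := fun x => b⁻¹ * g x) (h := fun x => (√(a * b))⁻¹ * h x) (by fun_prop) (by fun_prop)
    (by fun_prop) (fun x => mul_nonneg (by positivity) (hf0 x))
    (fun x => mul_nonneg (by positivity) (hg0 x)) (fun x => mul_nonneg (by positivity) (hh0 x))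
    (fun x => by rw [inv_mul_le_one₀ ha]; exact hfle x)
    (fun x => by rw [inv_mul_le_one₀ hb]; exact hgle x)
    (fun t ht => by
      obtain ⟨x, hx⟩ := exists_lt_of_lt_ciSup (show a * t < ⨆ x, f x by
        rw [← ha']; exact mul_lt_of_lt_one_right ha ht)
      exact ⟨x, by rwa [lt_inv_mul_iff₀ ha]⟩)
    (fun t ht => by
      obtain ⟨x, hx⟩ := exists_lt_of_lt_ciSup (show b * t < ⨆ x, g x by
        rw [← hb']; exact mul_lt_of_lt_one_right hb ht)
      exact ⟨x, by rwa [lt_inv_mul_iff₀ hb]⟩)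
    (fun x y => by
      rw [mul_pow, inv_pow, Real.sq_sqrt (by positivity), mul_inv]
      have := mul_le_mul_of_nonneg_left (H x y) (show 0 ≤ a⁻¹ * b⁻¹ by positivity)
      linarith)
  have e : ∀ (c : ℝ) (k : ℝ → ℝ), 0 < c → Measurable k →
      ∫⁻ x, ENNReal.ofReal (c⁻¹ * k x) = ENNReal.ofReal c⁻¹ * ∫⁻ x, ENNReal.ofReal (k x) := by
    intro c k hc hk
    rw [← lintegral_const_mul _ (by fun_prop)]
    congr 1; ext x; rw [ENNReal.ofReal_mul (by positivity)]
  rw [e a f ha hf, e b g hb hg, e _ h hc hh] at key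
  set F := ∫⁻ x, ENNReal.ofReal (f x)
  set G := ∫⁻ x, ENNReal.ofReal (g x)
  set K := ∫⁻ x, ENNReal.ofReal (h x)
  have h3 := (ENNReal.four_mul_mul_le_add_sq _ _).trans (pow_le_pow_left' key 2)
  have h4 : ENNReal.ofReal a⁻¹ * ENNReal.ofReal b⁻¹ = ENNReal.ofReal (√(a * b))⁻¹ ^ 2 := by
    rw [← ENNReal.ofReal_mul (by positivity), ← ENNReal.ofReal_pow (by positivity), inv_pow,
      Real.sq_sqrt (by positivity), mul_inv]
  have h5 : (4 * ENNReal.ofReal (√(a * b))⁻¹ ^ 2) * (F * G) ≤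
      (4 * ENNReal.ofReal (√(a * b))⁻¹ ^ 2) * K ^ 2 := by
    calc _ = 4 * (ENNReal.ofReal a⁻¹ * F * (ENNReal.ofReal b⁻¹ * G)) := by rw [← h4]; ring
      _ ≤ _ := h3
      _ = _ := by ring
  refine (ENNReal.mul_le_mul_iff_right ?_ ?_).1 h5
  · have : ENNReal.ofReal (√(a * b))⁻¹ ≠ 0 := by simpa using hc
    simp [this]
  · exact ENNReal.mul_ne_top (by simp) (ENNReal.pow_ne_top ENNReal.ofReal_ne_top)

/-- The midpoint form of the Prékopa–Leindler inequality for a measure, restricted to test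
functions bounded by one. -/
def IsMidpointLogConcave {E : Type*} [AddCommGroup E] [Module ℝ E] [MeasurableSpace E]
    (μ : Measure E) : Prop :=
  ∀ f g h : E → ℝ≥0∞, Measurable f → Measurable g → Measurable h →
    (∀ x, f x ≤ 1) → (∀ x, g x ≤ 1) →
    (∀ x y, f x * g y ≤ h ((2⁻¹ : ℝ) • (x + y)) ^ 2) →
    (∫⁻ x, f x ∂μ) * ∫⁻ x, g x ∂μ ≤ (∫⁻ x, h x ∂μ) ^ 2

theorem isMidpointLogConcave_gaussianReal : IsMidpointLogConcave (gaussianReal 0 1) := by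
  intro f g h hf hg hh hf1 hg1 H
  set p : ℝ → ℝ := gaussianPDFReal 0 1 with hp
  have hpm : Measurable p := by fun_prop
  have hp0 : ∀ x, 0 ≤ p x := gaussianPDFReal_nonneg 0 1
  have hpb : ∃ C, ∀ x, p x ≤ C := by
    refine ⟨(√(2 * Real.pi * (1 : NNReal)))⁻¹, fun x => ?_⟩
    simp only [hp, gaussianPDFReal]
    refine mul_le_of_le_one_right (by positivity) ?_
    rw [Real.exp_le_one_iff, neg_div, Left.neg_nonpos_iff]
    positivity
  obtain ⟨C, hC⟩ := hpb
  have hpp : ∀ x y, p x * p y ≤ p ((x + y) / 2) ^ 2 := by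
    intro x y
    simp only [hp, gaussianPDFReal, mul_pow, ← Real.exp_nat_mul]
    rw [mul_mul_mul_comm, ← Real.exp_add, ← sq]
    gcongr
    push_cast
    nlinarith [sq_nonneg (x - y)]
  -- Truncation makes the third function real-valued and keeps the midpoint hypothesis, since `f`
  -- and `g` are at most one. The Gaussian density `p` satisfies that hypothesis too, so the
  -- products with `p` are admissible for Lebesgue measure.
  set h' : ℝ → ℝ≥0∞ := fun x => min (h x) 1 with hh'
  have hreal : ∀ {k : ℝ → ℝ≥0∞}, Measurable k → (∀ x, k x ≤ 1) →
      ∫⁻ x, k x ∂gaussianReal 0 1 = ∫⁻ x, ENNReal.ofReal ((k x).toReal * p x) := by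
    intro k hk hk1
    rw [gaussianReal_of_var_ne_zero _ (by simp),
      lintegral_withDensity_eq_lintegral_mul _ (by fun_prop) hk]
    refine lintegral_congr fun x => ?_
    rw [ENNReal.ofReal_mul (by simp),
      ENNReal.ofReal_toReal (ne_top_of_le_ne_top ENNReal.one_ne_top (hk1 x)), mul_comm]
    rfl
  have hh'm : Measurable h' := hh.min measurable_const
  have hle : ∫⁻ x, h' x ∂gaussianReal 0 1 ≤ ∫⁻ x, h x ∂gaussianReal 0 1 :=
    lintegral_mono fun x => min_le_left _ _
  refine le_trans ?_ (pow_le_pow_left' hle 2)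
  rw [hreal hf hf1, hreal hg hg1, hreal hh'm fun x => min_le_right _ _]
  have t1 : ∀ {k : ℝ → ℝ≥0∞}, (∀ x, k x ≤ 1) → ∀ x, (k x).toReal ≤ 1 := fun hk x => by
    simpa using ENNReal.toReal_mono ENNReal.one_ne_top (hk x)
  have tb : ∀ {k : ℝ → ℝ≥0∞}, (∀ x, k x ≤ 1) →
      BddAbove (Set.range fun x => (k x).toReal * p x) := by
    intro k hk
    refine ⟨C, ?_⟩
    rintro _ ⟨x, rfl⟩
    exact (mul_le_of_le_one_left (hp0 x) (t1 hk x)).trans (hC x)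
  refine lintegral_mul_lintegral_le_sq_of_midpoint (by fun_prop) (by fun_prop) (by fun_prop)
    (fun x => mul_nonneg (by simp) (hp0 x)) (fun x => mul_nonneg (by simp) (hp0 x))
    (fun x => mul_nonneg (by simp) (hp0 x)) (tb hf1) (tb hg1) fun x y => ?_
  have hfg : f x * g y ≤ h' ((x + y) / 2) ^ 2 := by
    have := H x y
    rw [smul_eq_mul, inv_mul_eq_div] at this
    rcases le_total (h ((x + y) / 2)) 1 with hc | hc
    · simpa [hh', min_eq_left hc] using this
    · simpa [hh', min_eq_right hc] using mul_le_one' (hf1 x) (hg1 y)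
  have hfg' := ENNReal.toReal_mono (ENNReal.pow_ne_top
    (ne_top_of_le_ne_top ENNReal.one_ne_top (min_le_right _ _))) hfg
  rw [ENNReal.toReal_mul, ENNReal.toReal_pow] at hfg'
  calc _ = ((f x).toReal * (g y).toReal) * (p x * p y) := by ring
    _ ≤ (h' ((x + y) / 2)).toReal ^ 2 * p ((x + y) / 2) ^ 2 :=
        mul_le_mul hfg' (hpp x y) (mul_nonneg (hp0 x) (hp0 y)) (by positivity)
    _ = _ := by ring

theorem IsMidpointLogConcave.map {E F : Type*} [AddCommGroup E] [Module ℝ E] [MeasurableSpace E]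
    [AddCommGroup F] [Module ℝ F] [MeasurableSpace F] {μ : Measure E}
    (hμ : IsMidpointLogConcave μ) {T : E → F} (hT : Measurable T)
    (hmid : ∀ x y, T ((2⁻¹ : ℝ) • (x + y)) = (2⁻¹ : ℝ) • (T x + T y)) :
    IsMidpointLogConcave (μ.map T) := by
  intro f g h hf hg hh hf1 hg1 H
  rw [lintegral_map hf hT, lintegral_map hg hT, lintegral_map hh hT]
  refine hμ _ _ _ (hf.comp hT) (hg.comp hT) (hh.comp hT) (fun x => hf1 _) (fun x => hg1 _) ?_
  intro x y
  rw [hmid]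
  exact H _ _

/-- Tensorization: the inequality on the fibres is the midpoint hypothesis for the partial
integrals, which stay bounded by one because `ν` is a probability measure. -/
theorem IsMidpointLogConcave.prod {E F : Type*} [AddCommGroup E] [Module ℝ E] [MeasurableSpace E]
    [AddCommGroup F] [Module ℝ F] [MeasurableSpace F] {μ : Measure E} {ν : Measure F}
    [IsProbabilityMeasure ν] (hμ : IsMidpointLogConcave μ) (hν : IsMidpointLogConcave ν) :
    IsMidpointLogConcave (μ.prod ν) := by
  intro f g h hf hg hh hf1 hg1 H
  rw [lintegral_prod _ hf.aemeasurable, lintegral_prod _ hg.aemeasurable,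
    lintegral_prod _ hh.aemeasurable]
  have hle : ∀ k : E × F → ℝ≥0∞, (∀ x, k x ≤ 1) → ∀ x, ∫⁻ y, k (x, y) ∂ν ≤ 1 := by
    intro k hk x
    calc _ ≤ ∫⁻ _, 1 ∂ν := lintegral_mono fun y => hk _
      _ = 1 := by simp
  refine hμ _ _ _ hf.lintegral_prod_right' hg.lintegral_prod_right' hh.lintegral_prod_right'
    (hle f hf1) (hle g hg1) fun x x' => ?_
  refine hν _ _ _ (hf.comp measurable_prodMk_left) (hg.comp measurable_prodMk_left)
    (hh.comp measurable_prodMk_left) (fun _ => hf1 _) (fun _ => hg1 _) fun y y' => ?_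
  exact H (x, y) (x', y')

theorem isMidpointLogConcave_pi_gaussianReal (n : ℕ) :
    IsMidpointLogConcave (Measure.pi fun _ : Fin n => gaussianReal 0 1) := by
  induction n with
  | zero =>
    rw [Measure.pi_of_empty (x := isEmptyElim)]
    intro f g h hf hg hh _ _ H
    rw [lintegral_dirac' _ hf, lintegral_dirac' _ hg, lintegral_dirac' _ hh]
    convert H _ _
  | succ n ih =>
    have h := (measurePreserving_piFinSuccAbove (fun _ : Fin (n + 1) => gaussianReal 0 1) 0).symm
    rw [← h.map_eq]
    refine (isMidpointLogConcave_gaussianReal.prod ih).map h.measurable fun x y => ?_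
    ext i
    refine Fin.cases ?_ (fun j => ?_) i
    · simp [MeasurableEquiv.piFinSuccAbove, mul_add]
    · simp [MeasurableEquiv.piFinSuccAbove, mul_add]

/-- Mean and covariance determine a Gaussian measure, so `μ` is an affine image of the standard
product measure; a degenerate covariance causes no trouble. -/
theorem isMidpointLogConcave_of_isGaussian {ι : Type*} [Fintype ι]
    (μ : Measure (EuclideanSpace ℝ ι)) [IsGaussian μ] : IsMidpointLogConcave μ := by
  classical
  set S : Matrix ι ι ℝ := Matrix.of fun i j =>
    covarianceBilin μ (EuclideanSpace.basisFun ι ℝ i) (EuclideanSpace.basisFun ι ℝ j) with hS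
  have hS' : ∀ x y : EuclideanSpace ℝ ι, covarianceBilin μ x y = x ⬝ᵥ S.mulVec y := by
    intro x y
    have e : ∀ z : EuclideanSpace ℝ ι, z = ∑ i, z i • EuclideanSpace.basisFun ι ℝ i := fun z => by
      simpa using ((EuclideanSpace.basisFun ι ℝ).sum_repr z).symm
    conv_lhs => rw [e x, e y]
    simp only [map_sum, map_smul, _root_.sum_apply, _root_.smul_apply,
      smul_eq_mul, dotProduct, Matrix.mulVec, Finset.mul_sum, hS, Matrix.of_apply]
    rw [Finset.sum_comm]
    refine Finset.sum_congr rfl fun i _ => Finset.sum_congr rfl fun j _ => ?_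
    ring
  have hpos : S.PosSemidef := by
    refine Matrix.PosSemidef.of_dotProduct_mulVec_nonneg ?_ fun x => ?_
    · ext i j
      simp [hS, covarianceBilin_comm]
    · have := hS' (WithLp.toLp 2 x) (WithLp.toLp 2 x)
      simp only at this
      simp only [star_trivial]
      rw [← this]
      exact covarianceBilin_self_nonneg _
  have hμ : μ = multivariateGaussian (∫ x, x ∂μ) S := by
    refine IsGaussian.ext (by simp) ?_
    ext x y
    rw [covarianceBilin_multivariateGaussian hpos, hS']
  rw [hμ, multivariateGaussian, stdGaussian, Measure.map_map (by fun_prop) (by fun_prop)]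
  refine (isMidpointLogConcave_pi_gaussianReal _).map (by fun_prop) fun x y => ?_
  simp only [Function.comp, Pi.smul_apply, Pi.add_apply, smul_eq_mul, mul_smul, add_smul,
    ← Finset.smul_sum, Finset.sum_add_distrib, map_smul, map_add]
  module

/-! ### Anderson's inequality for balls -/

/-- A symmetric Gaussian measure gives at most as much mass to a translate of a symmetric
convex set as to the set itself. -/
theorem measure_preimage_sub_le_of_isGaussian {ι : Type*} [Fintype ι]
    (μ : Measure (EuclideanSpace ℝ ι)) [IsGaussian μ] (hμ : ∫ x, x ∂μ = 0)
    {A : Set (EuclideanSpace ℝ ι)} (hA : MeasurableSet A) (hsymm : ∀ x ∈ A, -x ∈ A)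
    (hconv : Convex ℝ A) (a : EuclideanSpace ℝ ι) :
    μ ((fun x => x - a) ⁻¹' A) ≤ μ A := by
  have hneg : μ.map (fun x => -x) = μ := by
    refine IsGaussian.ext ?_ ?_
    · simp only [id]
      rw [integral_map (by fun_prop) (by fun_prop), integral_neg, hμ, neg_zero]
    · ext x y
      have := covarianceBilin_map (μ := μ) IsGaussian.memLp_two_id
        (-ContinuousLinearMap.id ℝ (EuclideanSpace ℝ ι)) x y
      have hadj : ContinuousLinearMap.adjoint (-ContinuousLinearMap.id ℝ (EuclideanSpace ℝ ι)) =
          -ContinuousLinearMap.id ℝ (EuclideanSpace ℝ ι) := by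
        refine ((ContinuousLinearMap.eq_adjoint_iff _ _).2 fun x y => ?_).symm
        simp
      rw [hadj] at this
      simpa using! this
  have h1 : MeasurableSet ((fun x => x - a) ⁻¹' A) := hA.preimage (by fun_prop)
  have h2 : MeasurableSet ((fun x => x + a) ⁻¹' A) := hA.preimage (by fun_prop)
  have e : μ ((fun x => x + a) ⁻¹' A) = μ ((fun x => x - a) ⁻¹' A) := by
    conv_lhs => rw [← hneg, Measure.map_apply (by fun_prop) h2]
    congr 1
    ext x
    simp only [Set.mem_preimage]
    constructor <;> intro h <;> simpa [sub_eq_add_neg, add_comm] using hsymm _ h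
  -- Test functions are the indicators of `A + a`, `A - a` and `A`: midpoints of the first two sets
  -- lie in `A` by convexity. The two translates have equal mass by symmetry, so the product is a
  -- square.
  have key := isMidpointLogConcave_of_isGaussian μ
    (((fun x => x - a) ⁻¹' A).indicator 1) (((fun x => x + a) ⁻¹' A).indicator 1)
    (A.indicator 1) (measurable_one.indicator h1) (measurable_one.indicator h2)
    (measurable_one.indicator hA) (fun x => Set.indicator_le_self' (by simp) x)
    (fun x => Set.indicator_le_self' (by simp) x) (fun x y => by
      by_cases hx : x - a ∈ A
      · by_cases hy : y + a ∈ A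
        · have hm : (2⁻¹ : ℝ) • (x + y) ∈ A := by
            have := hconv hx hy (a := 2⁻¹) (b := 2⁻¹) (by norm_num) (by norm_num) (by norm_num)
            convert this using 1
            module
          simp only [Set.indicator_of_mem hm]
          simp [hx, hy]
        · simp [hy]
      · simp [hx])
  rw [lintegral_indicator_one h1, lintegral_indicator_one h2, lintegral_indicator_one hA, e,
    ← sq] at key
  exact (ENNReal.pow_le_pow_left_iff two_ne_zero).1 key

variable {Θ : Type*} [NormedAddCommGroup Θ] [NormedSpace ℝ Θ] [MeasurableSpace Θ] [BorelSpace Θ]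
  [SecondCountableTopology Θ] [CompleteSpace Θ]

/-- Norming functionals at a dense sequence suffice. Closed balls become countable intersections of
slabs, which opens the way to finite dimensions. -/
theorem exists_norming_sequence (Θ : Type*) [NormedAddCommGroup Θ] [NormedSpace ℝ Θ]
    [SecondCountableTopology Θ] :
    ∃ ℓ : ℕ → StrongDual ℝ Θ, ∀ (x : Θ) (r : ℝ), ‖x‖ ≤ r ↔ ∀ n, |ℓ n x| ≤ r := by
  choose ℓ hℓ1 hℓ2 using fun n => exists_dual_vector'' ℝ (TopologicalSpace.denseSeq Θ n)
  have hle : ∀ n x, |ℓ n x| ≤ ‖x‖ := fun n x => by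
    simpa using (ℓ n).le_of_opNorm_le (hℓ1 n) x
  refine ⟨ℓ, fun x r => ⟨fun h n => (hle n x).trans h, fun h => ?_⟩⟩
  refine le_of_forall_pos_le_add fun ε hε => ?_
  obtain ⟨n, hn⟩ := (TopologicalSpace.denseRange_denseSeq Θ).exists_dist_lt x
    (half_pos hε)
  set y := TopologicalSpace.denseSeq Θ n
  have h1 : ‖y‖ = ℓ n y := by simpa using (hℓ2 n).symm
  have h2 : ℓ n y = ℓ n x + ℓ n (y - x) := by simp
  have h3 := (abs_le.1 (hle n (y - x))).2
  have h4 := (abs_le.1 (h n)).2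
  rw [dist_eq_norm] at hn
  have h5 : ‖x‖ ≤ ‖y‖ + ‖x - y‖ := by
    simpa using norm_add_le y (x - y)
  rw [norm_sub_rev] at h3
  linarith

/-- A closed ball is the decreasing limit of the sets cut out by the first `N` slabs. Each of these
is the preimage of a translated symmetric box in `ℝ^N`, where the finite-dimensional inequality
applies to the image Gaussian measure. -/
theorem measure_closedBall_le_of_isGaussian (μ : Measure Θ) [IsGaussian μ] (hμ : ∫ x, x ∂μ = 0)
    (h : Θ) (r : ℝ) : μ (Metric.closedBall h r) ≤ μ (Metric.closedBall 0 r) := by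
  obtain ⟨ℓ, hℓ⟩ := exists_norming_sequence Θ
  set A : ℕ → Θ → Set Θ := fun N a => {x | ∀ n < N, |ℓ n (x - a)| ≤ r} with hA
  have hAm : ∀ N a, MeasurableSet (A N a) := fun N a => by
    have : A N a = ⋂ n < N, {x | |ℓ n (x - a)| ≤ r} := by ext; simp [hA]
    rw [this]
    refine MeasurableSet.biInter (Set.to_countable _) fun n _ => ?_
    exact measurableSet_le (by fun_prop) measurable_const
  have hanti : ∀ a, Antitone fun N => A N a := fun a N M hNM x hx n hn => hx n (hn.trans_le hNM)
  have hInter : ∀ a, ⋂ N, A N a = Metric.closedBall a r := fun a => by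
    ext x
    simp only [hA, Set.mem_iInter, Set.mem_ofPred_eq, mem_closedBall_iff_norm, hℓ]
    exact ⟨fun h n => h (n + 1) n (by simp), fun h N n _ => h n⟩
  have hlim : ∀ a, Tendsto (fun N => μ (A N a)) atTop (𝓝 (μ (Metric.closedBall a r))) := fun a => by
    rw [← hInter a]
    exact tendsto_measure_iInter_atTop (fun N => (hAm N a).nullMeasurableSet) (hanti a)
      ⟨0, measure_ne_top _ _⟩
  refine le_of_tendsto_of_tendsto' (hlim h) (hlim 0) fun N => ?_
  set T : Θ →L[ℝ] EuclideanSpace ℝ (Fin N) :=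
    (EuclideanSpace.equiv (Fin N) ℝ).symm.toContinuousLinearMap ∘L
      ContinuousLinearMap.pi fun n : Fin N => ℓ n with hT
  have hTn : ∀ x (n : Fin N), T x n = ℓ n x := fun x n => by simp [hT]
  set B : Set (EuclideanSpace ℝ (Fin N)) := {z | ∀ n, |z n| ≤ r} with hB
  have hBm : MeasurableSet B := by
    have : B = ⋂ n, {z | |z n| ≤ r} := by ext; simp [hB]
    rw [this]
    exact MeasurableSet.iInter fun n => measurableSet_le (by fun_prop) measurable_const
  have hAB : ∀ a, A N a = T ⁻¹' ((fun z => z - T a) ⁻¹' B) := fun a => by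
    ext x
    simp only [hA, hB, Set.mem_ofPred_eq, Set.mem_preimage, PiLp.sub_apply, hTn, map_sub]
    exact ⟨fun h n => h n n.2, fun h n hn => h ⟨n, hn⟩⟩
  have hconv : Convex ℝ B := by
    intro x hx y hy a b ha hb hab n
    simp only [PiLp.add_apply, PiLp.smul_apply, smul_eq_mul]
    have h1 := abs_le.1 (hx n)
    have h2 := abs_le.1 (hy n)
    rw [abs_le]
    obtain rfl : b = 1 - a := by linarith
    constructor <;> nlinarith [h1.1, h1.2, h2.1, h2.2]
  have hmean : ∫ z, z ∂μ.map T = 0 := by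
    rw [integral_map (by fun_prop) (by fun_prop),
      T.integral_comp_comm IsGaussian.integrable_fun_id, hμ, map_zero]
  have key := measure_preimage_sub_le_of_isGaussian (μ.map T) hmean hBm
    (fun x hx n => by simpa using hx n) hconv (T h)
  rw [Measure.map_apply (by fun_prop) (hBm.preimage (by fun_prop)),
    Measure.map_apply (by fun_prop) hBm, ← hAB] at key
  simpa [hAB] using key

theorem measure_ball_eq_iSup_closedBall {X : Type*} [PseudoMetricSpace X] [MeasurableSpace X]
    (μ : Measure X) (x : X) (r : ℝ) :
    μ (Metric.ball x r) = ⨆ n : ℕ, μ (Metric.closedBall x (r - 1 / (n + 1))) := by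
  rw [← Monotone.measure_iUnion]
  · congr 1
    ext y
    simp only [Metric.mem_ball, Set.mem_iUnion, Metric.mem_closedBall]
    constructor
    · intro h
      obtain ⟨n, hn⟩ := exists_nat_one_div_lt (sub_pos.2 h)
      exact ⟨n, by linarith⟩
    · rintro ⟨n, hn⟩
      have : (0 : ℝ) < 1 / (n + 1) := by positivity
      linarith
  · intro n m hnm
    refine Metric.closedBall_subset_closedBall ?_
    have := Nat.one_div_le_one_div (α := ℝ) hnm
    linarith

/-- **Anderson's inequality** for balls: among balls of a fixed radius, the one centred at the
mean has the largest mass. -/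
theorem measure_ball_le_of_isGaussian (μ : Measure Θ) [IsGaussian μ] (hμ : ∫ x, x ∂μ = 0)
    (h : Θ) (r : ℝ) : μ (Metric.ball h r) ≤ μ (Metric.ball 0 r) := by
  rw [measure_ball_eq_iSup_closedBall μ h, measure_ball_eq_iSup_closedBall μ 0]
  exact iSup_mono fun n => measure_closedBall_le_of_isGaussian μ hμ h _

/-! ### Cameron–Martin shifts along the covariance operator -/

section CameronMartin

variable {Θ : Type*} [NormedAddCommGroup Θ] [NormedSpace ℝ Θ] [MeasurableSpace Θ] [BorelSpace Θ]
  [SecondCountableTopology Θ] [CompleteSpace Θ]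

/-- The image of a functional `ℓ` under the covariance operator of `μ`. -/
noncomputable def covVec (μ : Measure Θ) (ℓ : StrongDual ℝ Θ) : Θ :=
  ∫ u, (ℓ u - ∫ v, ℓ v ∂μ) • (u - ∫ v, v ∂μ) ∂μ

variable (μ : Measure Θ) [IsGaussian μ]

theorem integrable_covVec (ℓ : StrongDual ℝ Θ) :
    Integrable (fun u => (ℓ u - ∫ v, ℓ v ∂μ) • (u - ∫ v, v ∂μ)) μ := by
  have h1 : MemLp (fun u => ℓ u - ∫ v, ℓ v ∂μ) 2 μ :=
    (IsGaussian.memLp_dual μ ℓ 2 (by simp)).sub (memLp_const _)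
  have h2 : MemLp (fun u => u - ∫ v, v ∂μ) 2 μ :=
    (IsGaussian.memLp_two_id (μ := μ)).sub (memLp_const _)
  exact memLp_one_iff_integrable.1 (h2.smul h1)

theorem apply_covVec (ℓ m : StrongDual ℝ Θ) : m (covVec μ ℓ) = covarianceBilinDual μ ℓ m := by
  rw [covVec, ← ContinuousLinearMap.integral_comp_comm _ (integrable_covVec μ ℓ),
    covarianceBilinDual_apply IsGaussian.memLp_two_id]
  refine integral_congr_ae (ae_of_all _ fun u => ?_)
  simp only [map_smul, map_sub, smul_eq_mul, IsGaussian.integral_dual]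

theorem covVec_smul (c : ℝ) (ℓ : StrongDual ℝ Θ) : covVec μ (c • ℓ) = c • covVec μ ℓ := by
  refine SeparatingDual.eq_iff_forall_dual_eq (R := ℝ) |>.2 fun m => ?_
  simp [apply_covVec]

theorem covVec_add (ℓ ℓ' : StrongDual ℝ Θ) : covVec μ (ℓ + ℓ') = covVec μ ℓ + covVec μ ℓ' := by
  refine SeparatingDual.eq_iff_forall_dual_eq (R := ℝ) |>.2 fun m => ?_
  simp [apply_covVec]

theorem covarianceBilinDual_sq_le {Θ : Type*} [NormedAddCommGroup Θ] [NormedSpace ℝ Θ]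
    [MeasurableSpace Θ] [BorelSpace Θ] (μ : Measure Θ) (ℓ m : StrongDual ℝ Θ) :
    covarianceBilinDual μ ℓ m ^ 2 ≤ covarianceBilinDual μ ℓ ℓ * covarianceBilinDual μ m m := by
  have hc : covarianceBilinDual μ m ℓ = covarianceBilinDual μ ℓ m := covarianceBilinDual_comm _ _
  have h : ∀ t : ℝ, 0 ≤ (covarianceBilinDual μ m m) * (t * t) + (2 * covarianceBilinDual μ ℓ m) * t
      + covarianceBilinDual μ ℓ ℓ := fun t => by
    have := covarianceBilinDual_self_nonneg (μ := μ) (ℓ + t • m)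
    simp only [map_add, map_smul, _root_.add_apply, _root_.smul_apply, smul_eq_mul, hc] at this
    linarith
  have := discrim_le_zero h
  rw [discrim] at this
  nlinarith

theorem integral_exp_dual (ℓ : StrongDual ℝ Θ) :
    ∫ u, Real.exp (ℓ u) ∂μ = Real.exp ((∫ v, ℓ v ∂μ) + covarianceBilinDual μ ℓ ℓ / 2) := by
  have := mgf_gaussianReal (IsGaussian.map_eq_gaussianReal (μ := μ) ℓ) 1
  rw [covarianceBilinDual_self_eq_variance IsGaussian.memLp_two_id]
  simpa [mgf, Real.coe_toNNReal _ (variance_nonneg _ _)] using this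

theorem integrable_exp_dual (ℓ : StrongDual ℝ Θ) : Integrable (fun u => Real.exp (ℓ u)) μ := by
  -- A non-integrable function has Bochner integral `0`, whereas the moment generating function is
  -- positive.
  by_contra h
  have := integral_undef h
  rw [integral_exp_dual] at this
  exact (Real.exp_pos _).ne' this

/-- Regression: `L = L' + c ℓ` with `L'` uncorrelated with `ℓ`, hence independent of it by joint
Gaussianity. The integral factors into the characteristic function of `L'` and the complex moment
generating function of `ℓ` at `1 + c i`. -/
theorem integral_cexp_dual (ℓ L : StrongDual ℝ Θ) :
    ∫ u, Complex.exp (L u * Complex.I) * Complex.exp (ℓ u) ∂μ =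
      Complex.exp ((∫ v, L v ∂μ) * Complex.I + ∫ v, ℓ v ∂μ +
        (covarianceBilinDual μ ℓ ℓ - covarianceBilinDual μ L L) / 2 +
        covarianceBilinDual μ ℓ L * Complex.I) := by
  set b := covarianceBilinDual μ with hb
  -- If `ℓ` has variance zero, Cauchy–Schwarz makes the covariance vanish and `c = 0` serves.
  obtain ⟨c, hc⟩ : ∃ c : ℝ, b ℓ L = c * b ℓ ℓ := by
    by_cases h0 : b ℓ ℓ = 0
    · refine ⟨0, ?_⟩
      have := covarianceBilinDual_sq_le μ ℓ L
      rw [← hb, h0, zero_mul] at this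
      rw [zero_mul]
      exact pow_eq_zero_iff two_ne_zero |>.1 (le_antisymm this (sq_nonneg _))
    · exact ⟨b ℓ L / b ℓ ℓ, by field_simp⟩
  set L' : StrongDual ℝ Θ := L - c • ℓ with hL'
  have hbc : b L ℓ = b ℓ L := covarianceBilinDual_comm _ _
  have hcov : b L' ℓ = 0 := by
    simp [hL', hbc, hc]
  have hLL : b L L = b L' L' + c ^ 2 * b ℓ ℓ := by
    have e : L = L' + c • ℓ := by simp [hL']
    have hcov' : b ℓ L' = 0 := by rw [← hcov]; exact covarianceBilinDual_comm _ _
    rw [e]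
    simp [hcov, hcov']
    ring
  have hind : IndepFun L' ℓ μ := by
    refine HasGaussianLaw.indepFun_of_covariance_eq_zero ?_ ?_
    · have := (IsGaussian.hasGaussianLaw_id (μ := μ)).map_fun (L'.prod ℓ)
      simpa using this
    · rw [← covarianceBilinDual_eq_covariance IsGaussian.memLp_two_id]
      exact hcov
  have h1 : ∀ u, Complex.exp (L u * Complex.I) * Complex.exp (ℓ u) =
      Complex.exp (L' u * Complex.I) * Complex.exp ((1 + c * Complex.I) * ℓ u) := fun u => by
    rw [← Complex.exp_add, ← Complex.exp_add]
    congr 1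
    simp [hL']
    ring
  simp_rw [h1]
  rw [hind.integral_fun_comp_mul_comp (f := fun x : ℝ => Complex.exp (x * Complex.I))
    (g := fun x : ℝ => Complex.exp ((1 + c * Complex.I) * x)) (by fun_prop) (by fun_prop)
    (by fun_prop) (by fun_prop)]
  have h2 : ∫ u, Complex.exp (L' u * Complex.I) ∂μ =
      Complex.exp ((∫ v, L' v ∂μ) * Complex.I - b L' L' / 2) := by
    have := IsGaussian.charFunDual_eq (μ := μ) L'
    rw [charFunDual_apply] at this
    rw [this, hb, covarianceBilinDual_self_eq_variance IsGaussian.memLp_two_id,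
      integral_complex_ofReal]
  have h3 : ∫ u, Complex.exp ((1 + c * Complex.I) * ℓ u) ∂μ =
      Complex.exp ((1 + c * Complex.I) * (∫ v, ℓ v ∂μ) +
        b ℓ ℓ * (1 + c * Complex.I) ^ 2 / 2) := by
    have := complexMGF_gaussianReal (IsGaussian.map_eq_gaussianReal (μ := μ) ℓ) (1 + c * Complex.I)
    rw [complexMGF] at this
    rw [this, hb, covarianceBilinDual_self_eq_variance IsGaussian.memLp_two_id]
    simp [Real.coe_toNNReal _ (variance_nonneg _ _)]
  rw [h2, h3, ← Complex.exp_add]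
  have hint : ∫ v, L' v ∂μ = (∫ v, L v ∂μ) - c * ∫ v, ℓ v ∂μ := by
    simp only [hL', IsGaussian.integral_dual]
    simp
  congr 1
  rw [hint, hLL, hc]
  push_cast
  ring_nf
  rw [Complex.I_sq]
  ring

/-- Tilting a Gaussian measure by a continuous linear functional shifts it by the image of the
functional under the covariance operator. -/
theorem tilted_dual_eq_map_add (ℓ : StrongDual ℝ Θ) :
    μ.tilted ℓ = μ.map (fun u => u + covVec μ ℓ) := by
  have := isProbabilityMeasure_tilted (integrable_exp_dual μ ℓ)
  refine Measure.ext_of_charFunDual ?_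
  ext L
  rw [charFunDual_map_add_const, charFunDual_apply, integral_tilted, IsGaussian.charFunDual_eq,
    apply_covVec, ← covarianceBilinDual_self_eq_variance IsGaussian.memLp_two_id,
    integral_complex_ofReal, integral_exp_dual]
  have e : ∀ u, (Real.exp (ℓ u) /
      Real.exp ((∫ v, ℓ v ∂μ) + covarianceBilinDual μ ℓ ℓ / 2)) • Complex.exp (L u * Complex.I) =
      Complex.exp (-((∫ v, ℓ v ∂μ) + covarianceBilinDual μ ℓ ℓ / 2 : ℝ)) *
        (Complex.exp (L u * Complex.I) * Complex.exp (ℓ u)) := fun u => by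
    rw [← Real.exp_sub, Complex.real_smul, Complex.ofReal_exp, ← Complex.exp_add,
      ← Complex.exp_add, ← Complex.exp_add]
    congr 1
    push_cast
    ring
  simp_rw [e]
  rw [integral_const_mul, integral_cexp_dual, ← Complex.exp_add, ← Complex.exp_add]
  congr 1
  push_cast
  ring

theorem lintegral_add_covVec (ℓ : StrongDual ℝ Θ) (g : Θ → ℝ≥0∞) (hg : Measurable g) :
    ∫⁻ u, g (u + covVec μ ℓ) ∂μ = ∫⁻ u, ENNReal.ofReal (Real.exp
      (ℓ u - (∫ v, ℓ v ∂μ) - covarianceBilinDual μ ℓ ℓ / 2)) * g u ∂μ := by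
  rw [← lintegral_map hg (by fun_prop), ← tilted_dual_eq_map_add, lintegral_tilted]
  simp_rw [integral_exp_dual, ← Real.exp_sub, sub_sub]

theorem integral_add_covVec (ℓ : StrongDual ℝ Θ) (g : Θ → ℝ)
    (hg : AEStronglyMeasurable g (μ.map (fun u => u + covVec μ ℓ))) :
    ∫ u, g (u + covVec μ ℓ) ∂μ = ∫ u, Real.exp
      (ℓ u - (∫ v, ℓ v ∂μ) - covarianceBilinDual μ ℓ ℓ / 2) * g u ∂μ := by
  rw [← integral_map (by fun_prop) hg, ← tilted_dual_eq_map_add, integral_tilted]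
  simp_rw [integral_exp_dual, ← Real.exp_sub, sub_sub, smul_eq_mul]

end CameronMartin

/-! ### Small balls and the Cameron–Martin norm -/

section SmallBalls

variable {Θ : Type*} [NormedAddCommGroup Θ] [NormedSpace ℝ Θ] [MeasurableSpace Θ]

/-- The ball of radius `R` of the Cameron–Martin space. -/
def cmBall [BorelSpace Θ] (μ : Measure Θ) (R : ℝ) : Set Θ :=
  {h | ∀ ℓ : StrongDual ℝ Θ, ℓ h ≤ R * √(covarianceBilinDual μ ℓ ℓ)}

variable [BorelSpace Θ]

theorem isClosed_cmBall (μ : Measure Θ) (R : ℝ) : IsClosed (cmBall μ R) := by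
  simp only [cmBall, Set.ofPred_forall]
  exact isClosed_iInter fun ℓ => isClosed_le (by fun_prop) (by fun_prop)

theorem convex_cmBall (μ : Measure Θ) (R : ℝ) : Convex ℝ (cmBall μ R) := by
  intro x hx y hy a b ha hb hab ℓ
  have h1 := mul_le_mul_of_nonneg_left (hx ℓ) ha
  have h2 := mul_le_mul_of_nonneg_left (hy ℓ) hb
  obtain rfl : b = 1 - a := by linarith
  simp only [map_add, map_smul, smul_eq_mul]
  linarith

theorem zero_mem_cmBall (μ : Measure Θ) {R : ℝ} (hR : 0 ≤ R) : (0 : Θ) ∈ cmBall μ R := fun ℓ => by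
  rw [map_zero]; positivity

variable [SecondCountableTopology Θ] [CompleteSpace Θ] (μ : Measure Θ) [IsGaussian μ]

theorem mem_cmBall_iff {R : ℝ} (hR : 0 ≤ R) (h : Θ) :
    h ∈ cmBall μ R ↔ cmNorm μ h ≤ ENNReal.ofReal R := by
  have hv : ∀ ℓ : StrongDual ℝ Θ, Var[fun θ => ℓ θ; μ] = covarianceBilinDual μ ℓ ℓ := fun ℓ =>
    (covarianceBilinDual_self_eq_variance IsGaussian.memLp_two_id ℓ).symm
  simp only [cmNorm, iSup_le_iff, hv, cmBall, Set.mem_ofPred_eq]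
  constructor
  · intro H ℓ hℓ
    refine ENNReal.ofReal_le_ofReal ((H ℓ).trans ?_)
    exact mul_le_of_le_one_right hR (Real.sqrt_le_one.2 hℓ)
  · intro H ℓ
    have H' : ∀ ℓ : StrongDual ℝ Θ, covarianceBilinDual μ ℓ ℓ ≤ 1 → ℓ h ≤ R := fun ℓ hℓ =>
      (ENNReal.ofReal_le_ofReal_iff hR).1 (H ℓ hℓ)
    rcases (covarianceBilinDual_self_nonneg (μ := μ) ℓ).eq_or_lt with h0 | h0
    · rw [← h0, Real.sqrt_zero, mul_zero]
      by_contra! hpos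
      -- A functional of variance zero remains admissible under any scaling, so a positive value at
      -- `h` could be scaled to `R + 1`.
      have h1 := H' (((R + 1) / ℓ h) • ℓ) (by simp [← h0])
      simp only [_root_.smul_apply, smul_eq_mul] at h1
      rw [div_mul_cancel₀ _ hpos.ne'] at h1
      linarith
    · set v := covarianceBilinDual μ ℓ ℓ
      have hs : 0 < √v := Real.sqrt_pos.2 h0
      have h1 := H' ((√v)⁻¹ • ℓ) (by
        simp only [map_smul, _root_.smul_apply, smul_eq_mul]
        rw [← mul_assoc, ← mul_inv, Real.mul_self_sqrt h0.le, inv_mul_cancel₀ h0.ne'])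
      simp only [_root_.smul_apply, smul_eq_mul] at h1
      rwa [inv_mul_le_iff₀ hs, mul_comm] at h1

theorem covVec_mem_cmBall (ℓ : StrongDual ℝ Θ) {R : ℝ} (hR : 0 ≤ R)
    (hℓ : covarianceBilinDual μ ℓ ℓ ≤ R ^ 2) : covVec μ ℓ ∈ cmBall μ R := by
  intro m
  rw [apply_covVec]
  refine (Real.le_sqrt_of_sq_le (covarianceBilinDual_sq_le μ ℓ m)).trans ?_
  rw [Real.sqrt_mul (covarianceBilinDual_self_nonneg _)]
  gcongr
  exact (Real.sqrt_le_left hR).2 hℓ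

/-- Hahn–Banach: the right-hand set is convex, and on it a functional `f` reaches `R √Var(f)` at the
covariance image of `(R/√Var f) f`, so `f` cannot separate off a point of the Cameron–Martin ball.
Estimates for shifts by covariance images thereby extend to all Cameron–Martin shifts. -/
theorem cmBall_subset_closure (R : ℝ) :
    cmBall μ R ⊆ closure (covVec μ '' {ℓ | covarianceBilinDual μ ℓ ℓ ≤ R ^ 2}) := by
  intro h hh
  by_contra hcl
  have hconv : Convex ℝ (covVec μ '' {ℓ | covarianceBilinDual μ ℓ ℓ ≤ R ^ 2}) := by
    rintro _ ⟨ℓ, hℓ, rfl⟩ _ ⟨m, hm, rfl⟩ a b ha hb hab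
    refine ⟨a • ℓ + b • m, ?_, by rw [covVec_add, covVec_smul, covVec_smul]⟩
    simp only [Set.mem_ofPred_eq] at hℓ hm ⊢
    have h1 : covarianceBilinDual μ ℓ m ≤ R ^ 2 := by
      refine (le_abs_self _).trans (abs_le_of_sq_le_sq ?_ (by positivity))
      calc _ ≤ _ := covarianceBilinDual_sq_le μ ℓ m
        _ ≤ R ^ 2 * R ^ 2 := mul_le_mul hℓ hm (covarianceBilinDual_self_nonneg _) (by positivity)
        _ = _ := by ring
    have hc : covarianceBilinDual μ m ℓ = covarianceBilinDual μ ℓ m :=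
      covarianceBilinDual_comm _ _
    simp only [map_add, map_smul, _root_.add_apply, _root_.smul_apply, smul_eq_mul, hc]
    obtain rfl : b = 1 - a := by linarith
    nlinarith [mul_nonneg ha hb, mul_le_mul_of_nonneg_left hℓ (mul_nonneg ha ha),
      mul_le_mul_of_nonneg_left hm (mul_nonneg hb hb), mul_le_mul_of_nonneg_left h1
      (mul_nonneg ha hb)]
  obtain ⟨f, u, hf1, hf2⟩ := geometric_hahn_banach_closed_point hconv.closure isClosed_closure hcl
  have hf3 := hh f
  rcases (covarianceBilinDual_self_nonneg (μ := μ) f).eq_or_lt with h0 | h0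
  · have := hf1 _ (subset_closure ⟨0, by simp [sq_nonneg], rfl⟩)
    rw [apply_covVec] at this
    simp only [map_zero, _root_.zero_apply, ← h0, Real.sqrt_zero, mul_zero] at this hf3
    linarith
  · set v := covarianceBilinDual μ f f with hv
    have hs : 0 < √v := Real.sqrt_pos.2 h0
    have hvv : √v * √v = v := Real.mul_self_sqrt h0.le
    have hmem : covarianceBilinDual μ ((R / √v) • f) ((R / √v) • f) ≤ R ^ 2 := by
      simp only [map_smul, _root_.smul_apply, smul_eq_mul, ← hv]
      nth_rewrite 3 [← hvv]
      field_simp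
      exact le_rfl
    have := hf1 _ (subset_closure ⟨_, hmem, rfl⟩)
    rw [apply_covVec] at this
    simp only [map_smul, _root_.smul_apply, smul_eq_mul, ← hv] at this
    have e : R / √v * v = R * √v := by nth_rewrite 2 [← hvv]; field_simp
    linarith

variable {μ}

theorem map_neg_eq_self_of_isGaussian (hμ : ∫ x, x ∂μ = 0) : μ.map (fun x => -x) = μ := by
  refine Measure.ext_of_charFunDual ?_
  ext L
  have h0 : ∫ x, x ∂μ.map (fun x => -x) = 0 := by
    rw [integral_map (by fun_prop) (by fun_prop), integral_neg, hμ, neg_zero]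
  rw [IsGaussian.charFunDual_eq_of_integral_eq_zero (by simpa using h0),
    IsGaussian.charFunDual_eq_of_integral_eq_zero (by simpa using hμ),
    variance_map (by fun_prop) (by fun_prop)]
  have : (L ∘ fun x => -x) = -L := by ext; simp
  rw [this]
  congr 3
  exact_mod_cast variance_neg

/-- The balls around `±covVec μ ℓ` have equal mass by symmetry. Averaging the two shift formulas
puts `exp(-v/2) cosh ℓ` under the integral over the centred ball, and `cosh ≥ 1`. -/
theorem le_measure_closedBall_covVec (hμ : ∫ x, x ∂μ = 0) (ℓ : StrongDual ℝ Θ) (r : ℝ) :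
    ENNReal.ofReal (Real.exp (-(covarianceBilinDual μ ℓ ℓ / 2))) * μ (Metric.closedBall 0 r) ≤
      μ (Metric.closedBall (covVec μ ℓ) r) := by
  set v := covarianceBilinDual μ ℓ ℓ with hv
  have hmean : ∀ m : StrongDual ℝ Θ, ∫ x, m x ∂μ = 0 := fun m => by
    rw [IsGaussian.integral_dual, hμ, map_zero]
  have hball : MeasurableSet (Metric.closedBall (0 : Θ) r) := Metric.isClosed_closedBall.measurableSet
  have key : ∀ m : StrongDual ℝ Θ, μ (Metric.closedBall (-covVec μ m) r) =
      ∫⁻ u, ENNReal.ofReal (Real.exp (m u - covarianceBilinDual μ m m / 2)) *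
        (Metric.closedBall (0 : Θ) r).indicator 1 u ∂μ := fun m => by
    have := lintegral_add_covVec μ m ((Metric.closedBall (0 : Θ) r).indicator 1)
      (measurable_one.indicator hball)
    simp only [hmean, sub_zero] at this
    rw [← this, ← lintegral_indicator_one Metric.isClosed_closedBall.measurableSet]
    refine lintegral_congr fun u => ?_
    have e : u + covVec μ m ∈ Metric.closedBall 0 r ↔ u ∈ Metric.closedBall (-covVec μ m) r := by
      simp only [mem_closedBall_iff_norm, sub_zero, sub_neg_eq_add]
    classical simp only [Set.indicator_apply, e, Pi.one_apply]
  have hneg : μ (Metric.closedBall (-covVec μ ℓ) r) = μ (Metric.closedBall (covVec μ ℓ) r) := by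
    have : μ.map (fun x => -x) (Metric.closedBall (-covVec μ ℓ) r) =
        μ (Metric.closedBall (covVec μ ℓ) r) := by
      rw [Measure.map_apply (by fun_prop) Metric.isClosed_closedBall.measurableSet]
      congr 1
      ext x
      simp only [Set.mem_preimage, mem_closedBall_iff_norm]
      rw [← norm_neg, show -(-x - -covVec μ ℓ) = x - covVec μ ℓ by abel]
    rwa [map_neg_eq_self_of_isGaussian hμ] at this
  have k1 := key ℓ
  have k2 := key (-ℓ)
  have e : covVec μ (-ℓ) = -covVec μ ℓ := by
    rw [← neg_one_smul ℝ ℓ, covVec_smul, neg_one_smul]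
  rw [hneg] at k1
  rw [e, neg_neg] at k2
  have h2 : 2 * (ENNReal.ofReal (Real.exp (-(v / 2))) * μ (Metric.closedBall 0 r)) ≤
      2 * μ (Metric.closedBall (covVec μ ℓ) r) := by
    conv_rhs => rw [two_mul]
    nth_rewrite 1 [k1]
    rw [k2, ← lintegral_add_left' (by
      refine AEMeasurable.mul (by fun_prop) (measurable_one.indicator hball).aemeasurable),
      ← lintegral_indicator_one hball, ← lintegral_const_mul' _ _ (by simp),
      ← lintegral_const_mul' _ _ (by simp)]
    refine lintegral_mono fun u => ?_
    simp only [← add_mul, ← mul_assoc]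
    gcongr
    rw [← ENNReal.ofReal_add (by positivity) (by positivity), ← ENNReal.ofReal_ofNat 2,
      ← ENNReal.ofReal_mul (by norm_num)]
    refine ENNReal.ofReal_le_ofReal ?_
    simp only [_root_.neg_apply, map_neg, neg_neg, ← hv]
    rw [sub_eq_add_neg, sub_eq_add_neg, Real.exp_add, Real.exp_add, ← add_mul]
    gcongr
    have := Real.one_le_cosh (ℓ u)
    rw [Real.cosh_eq] at this
    linarith
  exact (ENNReal.mul_le_mul_iff_right (by simp) (by simp)).1 h2

/-- Lower bound for the mass of a ball centred in the Cameron–Martin space. -/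
theorem le_measure_ball_of_mem_cmBall (hμ : ∫ x, x ∂μ = 0) {R : ℝ} {h : Θ}
    (hh : h ∈ cmBall μ R) (r : ℝ) :
    ENNReal.ofReal (Real.exp (-(R ^ 2 / 2))) * μ (Metric.ball 0 r) ≤ μ (Metric.ball h r) := by
  rw [measure_ball_eq_iSup_closedBall μ 0, ENNReal.mul_iSup]
  refine iSup_le fun n => ?_
  -- The approximation error `1/(n+1)` is exactly the amount by which the closed ball was shrunk.
  obtain ⟨_, ⟨ℓ, hℓ, rfl⟩, hd⟩ := Metric.mem_closure_iff.1 (cmBall_subset_closure μ R hh)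
    (1 / (n + 1)) (by positivity)
  calc _ ≤ ENNReal.ofReal (Real.exp (-(covarianceBilinDual μ ℓ ℓ / 2))) *
        μ (Metric.closedBall 0 (r - 1 / (n + 1))) := by
        gcongr
        exact hℓ
    _ ≤ _ := le_measure_closedBall_covVec hμ ℓ _
    _ ≤ _ := by
        refine measure_mono fun x hx => ?_
        rw [Metric.mem_closedBall] at hx
        rw [Metric.mem_ball]
        have := dist_triangle x (covVec μ ℓ) h
        rw [dist_comm] at hd
        linarith

/-- Upper bound for the mass of a ball which does not meet a ball of the Cameron–Martin space. -/
theorem measure_ball_le_of_disjoint_cmBall (hμ : ∫ x, x ∂μ = 0) {R : ℝ} (hR : 0 ≤ R) {h : Θ}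
    {r : ℝ} (hd : Disjoint (Metric.ball h r) (cmBall μ R)) :
    μ (Metric.ball h r) ≤ ENNReal.ofReal (Real.exp (-(R ^ 2 / 2))) * μ (Metric.ball 0 r) := by
  have hmean : ∀ m : StrongDual ℝ Θ, ∫ x, m x ∂μ = 0 := fun m => by
    rw [IsGaussian.integral_dual, hμ, map_zero]
  obtain ⟨f, u, hf1, hf2⟩ := geometric_hahn_banach_open (convex_ball h r) Metric.isOpen_ball
    (convex_cmBall μ R) hd
  rcases (covarianceBilinDual_self_nonneg (μ := μ) f).eq_or_lt with h0 | h0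
  -- Degenerate separation: `f` vanishes almost surely but is negative on the ball, which is
  -- therefore null.
  · have hu : u ≤ 0 := by simpa using hf2 0 (zero_mem_cmBall μ hR)
    have hae : ∀ᵐ x ∂μ, f x = 0 := by
      have := ae_eq_integral_of_variance_eq_zero (IsGaussian.memLp_dual μ f 2 (by simp)) (by
        rw [← covarianceBilinDual_self_eq_variance IsGaussian.memLp_two_id, h0])
      filter_upwards [this] with x hx
      rw [hx, hmean]
    have : μ (Metric.ball h r) = 0 := by
      refine measure_mono_null (fun x hx => ?_) hae
      exact ((hf1 x hx).trans_le hu).ne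
    simp [this]
  · set v := covarianceBilinDual μ f f with hv
    have hs : 0 < √v := Real.sqrt_pos.2 h0
    have hvv : √v * √v = v := Real.mul_self_sqrt h0.le
    -- Normalized to variance `R²`, and at least `R²` on the ball. There the shift density `exp(ℓ -
    -- R²/2)` is at least `exp(R²/2)`, which gives the factor; Anderson's inequality bounds the
    -- shifted ball.
    set ℓ : StrongDual ℝ Θ := (-(R / √v)) • f with hℓ
    have hℓv : covarianceBilinDual μ ℓ ℓ = R ^ 2 := by
      simp only [hℓ, map_smul, _root_.smul_apply, smul_eq_mul, ← hv]
      nth_rewrite 3 [← hvv]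
      field_simp
    have hu : u ≤ -(R * √v) := by
      have := hf2 _ (covVec_mem_cmBall μ ℓ hR hℓv.le)
      rw [apply_covVec] at this
      simp only [hℓ, map_smul, _root_.smul_apply, smul_eq_mul, ← hv] at this
      have e : R / √v * v = R * √v := by nth_rewrite 2 [← hvv]; field_simp
      linarith
    have hball : ∀ x ∈ Metric.ball h r, R ^ 2 ≤ ℓ x := by
      intro x hx
      have h1 : f x ≤ -(R * √v) := (hf1 x hx).le.trans hu
      have h2 : 0 ≤ R / √v := by positivity
      have h3 := mul_le_mul_of_nonneg_left h1 h2
      have e : R / √v * (R * √v) = R ^ 2 := by field_simp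
      simp only [hℓ, _root_.smul_apply, smul_eq_mul]
      linarith
    have hmeas : MeasurableSet (Metric.ball h r) := Metric.isOpen_ball.measurableSet
    have key := lintegral_add_covVec μ ℓ ((Metric.ball h r).indicator 1)
      (measurable_one.indicator hmeas)
    have e1 : ∫⁻ u, (Metric.ball h r).indicator 1 (u + covVec μ ℓ) ∂μ =
        μ (Metric.ball (h - covVec μ ℓ) r) := by
      rw [← lintegral_indicator_one Metric.isOpen_ball.measurableSet]
      refine lintegral_congr fun u => ?_
      have e : u + covVec μ ℓ ∈ Metric.ball h r ↔ u ∈ Metric.ball (h - covVec μ ℓ) r := by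
        simp only [mem_ball_iff_norm]
        rw [show u + covVec μ ℓ - h = u - (h - covVec μ ℓ) by abel]
      classical simp only [Set.indicator_apply, e, Pi.one_apply]
    rw [e1] at key
    calc μ (Metric.ball h r) = ∫⁻ u, (Metric.ball h r).indicator 1 u ∂μ :=
          (lintegral_indicator_one hmeas).symm
      _ ≤ ∫⁻ u, ENNReal.ofReal (Real.exp (-(R ^ 2 / 2))) * (ENNReal.ofReal (Real.exp
            (ℓ u - (∫ v, ℓ v ∂μ) - covarianceBilinDual μ ℓ ℓ / 2)) *
              (Metric.ball h r).indicator 1 u) ∂μ := by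
          refine lintegral_mono fun x => ?_
          by_cases hx : x ∈ Metric.ball h r
          · simp only [hx, Set.indicator_of_mem, Pi.one_apply, mul_one]
            rw [← ENNReal.ofReal_mul (by positivity), ← Real.exp_add, ← ENNReal.ofReal_one]
            refine ENNReal.ofReal_le_ofReal (Real.one_le_exp ?_)
            rw [hmean, hℓv]
            linarith [hball x hx]
          · simp [hx]
      _ = ENNReal.ofReal (Real.exp (-(R ^ 2 / 2))) * μ (Metric.ball (h - covVec μ ℓ) r) := by
          rw [lintegral_const_mul' _ _ (by simp), key]
      _ ≤ _ := by
          exact mul_le_mul' le_rfl (measure_ball_le_of_isGaussian μ hμ _ _)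

/-- If the centred ball were null, by Anderson's inequality all balls of that radius would be, and
countably many of them cover the space. -/
theorem measure_ball_pos_of_isGaussian (hμ : ∫ x, x ∂μ = 0) {r : ℝ} (hr : 0 < r) :
    0 < μ (Metric.ball 0 r) := by
  by_contra! h0
  have h1 : ∀ x, μ (Metric.ball x r) = 0 := fun x =>
    le_antisymm ((measure_ball_le_of_isGaussian μ hμ x r).trans h0) zero_le
  have h2 : μ Set.univ = 0 := by
    have : (⋃ n, Metric.ball (TopologicalSpace.denseSeq Θ n) r) = Set.univ := by
      refine Set.eq_univ_of_forall fun x => ?_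
      obtain ⟨n, hn⟩ := (TopologicalSpace.denseRange_denseSeq Θ).exists_dist_lt x hr
      exact Set.mem_iUnion.2 ⟨n, hn⟩
    rw [← this]
    exact measure_iUnion_null fun n => h1 _
  simp at h2

/-- Otherwise there is an `ε`-separated sequence; the balls of radius `ε/2` around it are disjoint
and, by the lower mass bound, share a positive lower bound on their mass. This contradicts
finiteness of `μ`. -/
theorem isCompact_cmBall (hμ : ∫ x, x ∂μ = 0) (R : ℝ) : IsCompact (cmBall μ R) := by
  refine TotallyBounded.isCompact_of_isClosed ?_ (isClosed_cmBall μ R)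
  rw [Metric.totallyBounded_iff]
  by_contra! H
  obtain ⟨ε, hε, H⟩ := H
  obtain ⟨x, hx, hsep⟩ := exists_seq_of_forall_finset_exists (fun x => x ∈ cmBall μ R)
    (fun x y => ε ≤ dist x y) fun s hs => by
      have := H s s.finite_toSet
      rw [Set.not_subset] at this
      obtain ⟨y, hy, hy2⟩ := this
      refine ⟨y, hy, fun z hz => ?_⟩
      by_contra! hlt
      exact hy2 (Set.mem_biUnion (Finset.mem_coe.2 hz) (by rwa [Metric.mem_ball, dist_comm]))
  set c := ENNReal.ofReal (Real.exp (-(R ^ 2 / 2))) * μ (Metric.ball 0 (ε / 2)) with hc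
  have hcpos : 0 < c := ENNReal.mul_pos (by simp [Real.exp_pos])
    (measure_ball_pos_of_isGaussian hμ (half_pos hε)).ne'
  have hdisj : Pairwise (Function.onFun Disjoint fun n => Metric.ball (x n) (ε / 2)) := by
    have : ∀ m n, m < n → Disjoint (Metric.ball (x m) (ε / 2)) (Metric.ball (x n) (ε / 2)) :=
      fun m n hmn => Metric.ball_disjoint_ball (by linarith [hsep m n hmn])
    intro m n hmn
    rcases lt_or_gt_of_ne hmn with h | h
    · exact this m n h
    · exact (this n m h).symm
  have hfin := Measure.finite_const_le_meas_of_disjoint_iUnion μ hcpos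
    (fun n => Metric.isOpen_ball.measurableSet) hdisj (measure_ne_top _ _)
  refine Set.infinite_univ (hfin.subset fun n _ => ?_)
  exact le_measure_ball_of_mem_cmBall hμ (hx n) _

end SmallBalls

/-! ### Maximum a posteriori estimators for a centred Gaussian prior -/

section CenteredMAP

variable {Θ : Type*} [NormedAddCommGroup Θ] [NormedSpace ℝ Θ] [MeasurableSpace Θ] [BorelSpace Θ]
  [SecondCountableTopology Θ] [CompleteSpace Θ] {μ : Measure Θ} [IsGaussian μ]

theorem mem_cmBall_toReal {h : Θ} (hh : cmNorm μ h < ∞) : h ∈ cmBall μ (cmNorm μ h).toReal := by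
  rw [mem_cmBall_iff μ ENNReal.toReal_nonneg, ENNReal.ofReal_toReal hh.ne]

theorem cmNorm_lt_top_of_mem_cmBall {R : ℝ} (hR : 0 ≤ R) {h : Θ} (hh : h ∈ cmBall μ R) :
    cmNorm μ h < ∞ :=
  ((mem_cmBall_iff μ hR h).1 hh).trans_lt ENNReal.ofReal_lt_top

theorem toReal_cmNorm_le_of_mem_cmBall {R : ℝ} (hR : 0 ≤ R) {h : Θ} (hh : h ∈ cmBall μ R) :
    (cmNorm μ h).toReal ≤ R :=
  ENNReal.toReal_le_of_le_ofReal hR ((mem_cmBall_iff μ hR h).1 hh)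

/-- The sublevel sets are closed Cameron–Martin balls. The restriction to `cmBall μ R` matters
because `toReal` sends `∞` to `0`. -/
theorem lowerSemicontinuousOn_toReal_cmNorm (R : ℝ) (hR : 0 ≤ R) :
    LowerSemicontinuousOn (fun h => (cmNorm μ h).toReal) (cmBall μ R) := by
  rw [lowerSemicontinuousOn_iff_preimage_Iic]
  intro b
  rcases lt_or_ge b 0 with hb | hb
  · refine ⟨∅, isClosed_empty, ?_⟩
    ext x
    simp only [Set.mem_inter_iff, Set.mem_preimage, Set.mem_Iic, Set.mem_empty_iff_false,
      and_false, iff_false, not_and, not_le]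
    exact fun _ => hb.trans_le ENNReal.toReal_nonneg
  · refine ⟨cmBall μ b, isClosed_cmBall μ b, ?_⟩
    ext x
    simp only [Set.mem_inter_iff, Set.mem_preimage, Set.mem_Iic, and_congr_right_iff]
    intro hx
    rw [mem_cmBall_iff μ hb, ← ENNReal.le_ofReal_iff_toReal_le
      (cmNorm_lt_top_of_mem_cmBall hR hx).ne hb]

variable {Φ : Θ → ℝ} {B : ℝ}

theorem continuous_of_lipschitz_on_balls {Θ : Type*} [NormedAddCommGroup Θ] {Φ : Θ → ℝ}
    (hL : ∀ r : ℝ, ∃ K : ℝ, ∀ x y : Θ, ‖x‖ < r → ‖y‖ < r → |Φ x - Φ y| ≤ K * ‖x - y‖) :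
    Continuous Φ := by
  rw [continuous_iff_continuousAt]
  intro x
  obtain ⟨K, hK⟩ := hL (‖x‖ + 1)
  rw [ContinuousAt, tendsto_iff_dist_tendsto_zero]
  have h1 : Tendsto (fun y => K * ‖y - x‖) (𝓝 x) (𝓝 0) := by
    have : Continuous fun y => K * ‖y - x‖ := by fun_prop
    simpa using this.tendsto x
  refine squeeze_zero' (Eventually.of_forall fun _ => dist_nonneg) ?_ h1
  have h2 : ∀ᶠ y in 𝓝 x, ‖y‖ < ‖x‖ + 1 :=
    (continuous_norm.tendsto x).eventually (gt_mem_nhds (by linarith))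
  filter_upwards [h2] with y hy
  exact hK y x hy (by linarith)

/-- Existence of minimizers of the Onsager–Machlup functional. -/
theorem exists_min_onsagerMachlup (hμ : ∫ x, x ∂μ = 0) (hB : ∀ x, |Φ x| ≤ B) (hΦ : Continuous Φ) :
    ∃ θ, cmNorm μ θ < ∞ ∧ ∀ h, cmNorm μ h < ∞ →
      Φ θ + 1 / 2 * (cmNorm μ θ).toReal ^ 2 ≤ Φ h + 1 / 2 * (cmNorm μ h).toReal ^ 2 := by
  have hB0 : 0 ≤ B := (abs_nonneg _).trans (hB 0)
  -- Outside this ball the functional exceeds `-B + R²/2 = B ≥ Φ 0`, so only the compact ball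
  -- competes.
  set R := √(4 * B) with hR
  have hR0 : 0 ≤ R := Real.sqrt_nonneg _
  have hR2 : R ^ 2 = 4 * B := Real.sq_sqrt (by positivity)
  -- The positive part makes squaring monotone on all of `ℝ`, so that composition keeps lower
  -- semicontinuity.
  have hmono : Monotone fun x : ℝ => 1 / 2 * (max x 0) ^ 2 := by
    intro x y hxy
    dsimp only
    gcongr
  have hlsc : LowerSemicontinuousOn
      (fun h => Φ h + 1 / 2 * (max (cmNorm μ h).toReal 0) ^ 2) (cmBall μ R) :=
    hΦ.lowerSemicontinuous.lowerSemicontinuousOn _ |>.add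
      (Continuous.comp_lowerSemicontinuousOn (g := fun x : ℝ => 1 / 2 * (max x 0) ^ 2)
        (by fun_prop) (lowerSemicontinuousOn_toReal_cmNorm R hR0) hmono)
  have h0 : (0 : Θ) ∈ cmBall μ R := zero_mem_cmBall μ hR0
  obtain ⟨θ, hθ, hmin⟩ := hlsc.exists_isMinOn ⟨0, h0⟩ (isCompact_cmBall hμ R)
  have hmax : ∀ h, max (cmNorm μ h).toReal 0 = (cmNorm μ h).toReal := fun h =>
    max_eq_left ENNReal.toReal_nonneg
  simp only [hmax] at hmin
  refine ⟨θ, cmNorm_lt_top_of_mem_cmBall hR0 hθ, fun h hh => ?_⟩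
  by_cases hhR : h ∈ cmBall μ R
  · exact hmin hhR
  · have h1 : R < (cmNorm μ h).toReal := by
      by_contra! hle
      refine hhR ((mem_cmBall_iff μ hR0 h).2 ?_)
      rwa [ENNReal.le_ofReal_iff_toReal_le hh.ne hR0]
    have h2 : Φ θ + 1 / 2 * (cmNorm μ θ).toReal ^ 2 ≤ Φ 0 + 1 / 2 * (cmNorm μ (0 : Θ)).toReal ^ 2 :=
      hmin h0
    have h3 : (cmNorm μ (0 : Θ)).toReal = 0 :=
      le_antisymm (toReal_cmNorm_le_of_mem_cmBall le_rfl (zero_mem_cmBall μ le_rfl))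
        ENNReal.toReal_nonneg
    rw [h3] at h2
    have h4 := (abs_le.1 (hB 0)).2
    have h5 := (abs_le.1 (hB h)).1
    nlinarith

theorem integrable_exp_neg_of_bounded {Θ : Type*} [TopologicalSpace Θ] [MeasurableSpace Θ]
    [BorelSpace Θ] {μ : Measure Θ} [IsFiniteMeasure μ] {Φ : Θ → ℝ} {B : ℝ} (hB : ∀ x, |Φ x| ≤ B)
    (hΦ : Continuous Φ) : Integrable (fun x => Real.exp (-Φ x)) μ := by
  refine Integrable.of_bound (by fun_prop) (Real.exp B) (ae_of_all _ fun x => ?_)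
  rw [Real.norm_of_nonneg (Real.exp_pos _).le]
  exact Real.exp_le_exp.2 (by linarith [(abs_le.1 (hB x)).1])

theorem tilted_ball_le {Θ : Type*} [PseudoMetricSpace Θ] [MeasurableSpace Θ] [BorelSpace Θ]
    {μ : Measure Θ} [SFinite μ] {Φ : Θ → ℝ} {θ : Θ} {r c : ℝ} (hc : ∀ x ∈ Metric.ball θ r, c ≤ Φ x) :
    μ.tilted (fun x => -Φ x) (Metric.ball θ r) ≤
      ENNReal.ofReal (Real.exp (-c) / ∫ x, Real.exp (-Φ x) ∂μ) * μ (Metric.ball θ r) := by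
  rw [tilted_apply]
  refine (setLIntegral_mono' Metric.isOpen_ball.measurableSet fun x hx => ?_).trans_eq
    (setLIntegral_const _ _)
  gcongr
  exact hc x hx

theorem le_tilted_ball {Θ : Type*} [PseudoMetricSpace Θ] [MeasurableSpace Θ] [BorelSpace Θ]
    {μ : Measure Θ} [SFinite μ] {Φ : Θ → ℝ} {θ : Θ} {r c : ℝ} (hc : ∀ x ∈ Metric.ball θ r, Φ x ≤ c) :
    ENNReal.ofReal (Real.exp (-c) / ∫ x, Real.exp (-Φ x) ∂μ) * μ (Metric.ball θ r) ≤
      μ.tilted (fun x => -Φ x) (Metric.ball θ r) := by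
  rw [tilted_apply]
  refine (setLIntegral_const _ _).symm.trans_le
    (setLIntegral_mono' Metric.isOpen_ball.measurableSet fun x hx => ?_)
  gcongr
  exact hc x hx

theorem ofReal_exp_div_mul_ofReal_exp {Z : ℝ} (hZ : 0 ≤ Z) (a b : ℝ) (c : ℝ≥0∞) :
    ENNReal.ofReal (Real.exp a / Z) * (ENNReal.ofReal (Real.exp b) * c) =
      ENNReal.ofReal (Real.exp (a + b) / Z) * c := by
  rw [← mul_assoc, ← ENNReal.ofReal_mul (by positivity), div_mul_eq_mul_div, ← Real.exp_add]

theorem ofReal_exp_div_mul_ofReal_exp_mul_le {Z a b d : ℝ} (hZ : 0 ≤ Z) {c : ℝ≥0∞}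
    (h : a + b ≤ d) : ENNReal.ofReal (Real.exp a / Z) * (ENNReal.ofReal (Real.exp b) * c) ≤
      ENNReal.ofReal (Real.exp d / Z) * c := by
  rw [ofReal_exp_div_mul_ofReal_exp hZ]
  gcongr

theorem ofReal_exp_div_mul_le_mul_ofReal_exp {Z a b d : ℝ} (hZ : 0 ≤ Z) {c : ℝ≥0∞}
    (h : d ≤ a + b) : ENNReal.ofReal (Real.exp d / Z) * c ≤
      ENNReal.ofReal (Real.exp a / Z) * (ENNReal.ofReal (Real.exp b) * c) := by
  rw [ofReal_exp_div_mul_ofReal_exp hZ]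
  gcongr

theorem exists_nonneg_lipschitz {Θ : Type*} [NormedAddCommGroup Θ] {Φ : Θ → ℝ} (r : ℝ)
    (hL : ∀ r : ℝ, ∃ K : ℝ, ∀ x y : Θ, ‖x‖ < r → ‖y‖ < r → |Φ x - Φ y| ≤ K * ‖x - y‖) :
    ∃ K : ℝ, 0 ≤ K ∧ ∀ x y : Θ, ‖x‖ < r → ‖y‖ < r → |Φ x - Φ y| ≤ K * ‖x - y‖ := by
  obtain ⟨K, hK⟩ := hL r
  refine ⟨max K 0, le_max_right _ _, fun x y hx hy => (hK x y hx hy).trans ?_⟩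
  gcongr
  exact le_max_left _ _

/-- The mass of an arbitrary small ball in terms of the minimum of the Onsager–Machlup
functional. -/
theorem tilted_ball_le_of_min (hμ : ∫ x, x ∂μ = 0) (hB : ∀ x, |Φ x| ≤ B)
    (hL : ∀ r : ℝ, ∃ K : ℝ, ∀ x y : Θ, ‖x‖ < r → ‖y‖ < r → |Φ x - Φ y| ≤ K * ‖x - y‖)
    {J : ℝ}
    (hJ : ∀ h, cmNorm μ h < ∞ → J ≤ Φ h + 1 / 2 * (cmNorm μ h).toReal ^ 2) :
    ∃ K : ℝ, ∀ r : ℝ, 0 < r → r ≤ 1 → ∀ θ : Θ,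
      μ.tilted (fun x => -Φ x) (Metric.ball θ r) ≤
        ENNReal.ofReal (Real.exp (-J + K * r) / ∫ x, Real.exp (-Φ x) ∂μ) *
          μ (Metric.ball 0 r) := by
  have hB0 : 0 ≤ B := (abs_nonneg _).trans (hB 0)
  have hZ : 0 ≤ ∫ x, Real.exp (-Φ x) ∂μ := integral_nonneg fun _ => (Real.exp_pos _).le
  set Z := ∫ x, Real.exp (-Φ x) ∂μ
  -- A ball missing `cmBall μ R₀` has relative mass at most `exp(B - R₀²/2) = exp(-B) ≤ exp(-J)`, as
  -- `J ≤ Φ 0 ≤ B`. Every other ball stays in a bounded region, where one Lipschitz constant serves.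
  set R₀ := √(4 * B) with hR₀
  have hR0 : 0 ≤ R₀ := Real.sqrt_nonneg _
  have hR2 : R₀ ^ 2 = 4 * B := Real.sq_sqrt (by positivity)
  obtain ⟨C, hC⟩ := (isCompact_cmBall hμ R₀).isBounded.exists_norm_le
  obtain ⟨K, hK0, hK⟩ := exists_nonneg_lipschitz (C + 3) hL
  have hJB : J ≤ B := by
    have h1 := hJ 0 (cmNorm_lt_top_of_mem_cmBall le_rfl (zero_mem_cmBall μ le_rfl))
    have h3 : (cmNorm μ (0 : Θ)).toReal = 0 :=
      le_antisymm (toReal_cmNorm_le_of_mem_cmBall le_rfl (zero_mem_cmBall μ le_rfl))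
        ENNReal.toReal_nonneg
    rw [h3] at h1
    linarith [(abs_le.1 (hB 0)).2]
  have hJ' : ∀ R, 0 ≤ R → ∀ k ∈ cmBall μ R, J ≤ Φ k + R ^ 2 / 2 := fun R hR k hk => by
    have h1 := hJ k (cmNorm_lt_top_of_mem_cmBall hR hk)
    have h2 := toReal_cmNorm_le_of_mem_cmBall hR hk
    have h3 : (cmNorm μ k).toReal ^ 2 ≤ R ^ 2 := by gcongr
    linarith
  refine ⟨2 * K, fun r hr hr1 θ => ?_⟩
  have combine : ∀ c R : ℝ, (∀ x ∈ Metric.ball θ r, c ≤ Φ x) →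
      μ (Metric.ball θ r) ≤ ENNReal.ofReal (Real.exp (-(R ^ 2 / 2))) * μ (Metric.ball 0 r) →
      J - 2 * K * r ≤ c + R ^ 2 / 2 →
      μ.tilted (fun x => -Φ x) (Metric.ball θ r) ≤
        ENNReal.ofReal (Real.exp (-J + 2 * K * r) / Z) * μ (Metric.ball 0 r) := by
    intro c R h1 h2 h3
    refine (tilted_ball_le h1).trans ?_
    refine (mul_le_mul' le_rfl h2).trans ?_
    exact ofReal_exp_div_mul_ofReal_exp_mul_le hZ (by linarith)
  by_cases hd : Disjoint (Metric.ball θ r) (cmBall μ R₀)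
  · refine combine (-B) R₀ (fun x _ => (abs_le.1 (hB x)).1)
      (measure_ball_le_of_disjoint_cmBall hμ hR0 hd) ?_
    have : 0 ≤ 2 * K * r := by positivity
    linarith
  -- The infimum of `S` is the Cameron–Martin distance from the origin to the ball. It governs the
  -- Gaussian mass of the ball, while nearly optimal points of the ball bound `Φ` from below through
  -- `J`.
  set S : Set ℝ := {R | 0 ≤ R ∧ ¬ Disjoint (Metric.ball θ r) (cmBall μ R)} with hS
  have hSne : S.Nonempty := ⟨R₀, hR0, hd⟩
  have hSb : BddBelow S := ⟨0, fun R hR => hR.1⟩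
  have hS0 : 0 ≤ sInf S := le_csInf hSne fun R hR => hR.1
  refine combine (J - (sInf S) ^ 2 / 2 - 2 * K * r) (sInf S) (fun x hx => ?_) ?_ (by linarith)
  -- The infimum need not be attained on an open ball, hence a slack `η` that tends to zero.
  · have hlim : Tendsto (fun η : ℝ => J - (sInf S + η) ^ 2 / 2 - 2 * K * r) (𝓝[>] 0)
        (𝓝 (J - (sInf S) ^ 2 / 2 - 2 * K * r)) := by
      have : Continuous fun η : ℝ => J - (sInf S + η) ^ 2 / 2 - 2 * K * r := by fun_prop
      simpa using (this.tendsto 0).mono_left nhdsWithin_le_nhds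
    refine le_of_tendsto hlim ?_
    filter_upwards [self_mem_nhdsWithin] with η (hη : 0 < η)
    obtain ⟨k₀, hk₀, hk₀'⟩ := Set.not_disjoint_iff.1 hd
    obtain ⟨R, hRS, hR⟩ := exists_lt_of_csInf_lt hSne (show sInf S < sInf S + η by linarith)
    obtain ⟨k, hk, hkR⟩ := Set.not_disjoint_iff.1 hRS.2
    have hnorm : ∀ y ∈ Metric.ball θ r, ‖y‖ < C + 3 := fun y hy => by
      have h1 := hC k₀ hk₀'
      have h2 : dist y k₀ < r + r := by
        rw [Metric.mem_ball] at hy hk₀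
        linarith [dist_triangle_right y k₀ θ]
      rw [dist_eq_norm] at h2
      have h3 : ‖y‖ ≤ ‖k₀‖ + ‖y - k₀‖ := by simpa using norm_add_le k₀ (y - k₀)
      linarith
    have h1 := hK k x (hnorm k hk) (hnorm x hx)
    have h2 : ‖k - x‖ ≤ 2 * r := by
      rw [Metric.mem_ball] at hk hx
      rw [← dist_eq_norm]
      linarith [dist_triangle_right k x θ]
    have h3 := mul_le_mul_of_nonneg_left h2 hK0
    have h4 := hJ' R hRS.1 k hkR
    have h5 : R ^ 2 ≤ (sInf S + η) ^ 2 := by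
      have := hRS.1
      gcongr
    linarith [(abs_le.1 h1).2]
  -- No radius lies below an infimum of zero, and there Anderson's inequality is the bound;
  -- otherwise radii increase to the infimum.
  · rcases hS0.eq_or_lt with h0 | h0
    · rw [← h0]
      simpa using measure_ball_le_of_isGaussian μ hμ θ r
    · have hlim : Tendsto (fun R : ℝ => ENNReal.ofReal (Real.exp (-(R ^ 2 / 2))) *
          μ (Metric.ball 0 r)) (𝓝[<] (sInf S))
          (𝓝 (ENNReal.ofReal (Real.exp (-((sInf S) ^ 2 / 2))) * μ (Metric.ball 0 r))) := by
        have : Continuous fun R : ℝ => ENNReal.ofReal (Real.exp (-(R ^ 2 / 2))) :=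
          ENNReal.continuous_ofReal.comp (by fun_prop)
        exact ENNReal.Tendsto.mul_const ((this.tendsto _).mono_left nhdsWithin_le_nhds)
          (Or.inr (measure_ne_top _ _))
      refine ge_of_tendsto hlim ?_
      filter_upwards [Ioo_mem_nhdsLT h0] with R hR
      refine measure_ball_le_of_disjoint_cmBall hμ hR.1.le ?_
      by_contra hnd
      exact absurd (csInf_le hSb ⟨hR.1.le, hnd⟩) (not_le.2 hR.2)

theorem le_tilted_ball_of_cmNorm_lt_top (hμ : ∫ x, x ∂μ = 0)
    (hL : ∀ r : ℝ, ∃ K : ℝ, ∀ x y : Θ, ‖x‖ < r → ‖y‖ < r → |Φ x - Φ y| ≤ K * ‖x - y‖)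
    {θ : Θ} (hθ : cmNorm μ θ < ∞) :
    ∃ K : ℝ, ∀ r : ℝ, 0 < r → r ≤ 1 →
      ENNReal.ofReal (Real.exp (-(Φ θ + 1 / 2 * (cmNorm μ θ).toReal ^ 2) - K * r) /
        ∫ x, Real.exp (-Φ x) ∂μ) * μ (Metric.ball 0 r) ≤
          μ.tilted (fun x => -Φ x) (Metric.ball θ r) := by
  obtain ⟨K, hK0, hK⟩ := exists_nonneg_lipschitz (‖θ‖ + 1) hL
  have hZ : 0 ≤ ∫ x, Real.exp (-Φ x) ∂μ := integral_nonneg fun _ => (Real.exp_pos _).le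
  refine ⟨K, fun r hr hr1 => ?_⟩
  have h1 : ∀ x ∈ Metric.ball θ r, Φ x ≤ Φ θ + K * r := fun x hx => by
    rw [mem_ball_iff_norm] at hx
    have h2 : ‖x‖ ≤ ‖θ‖ + ‖x - θ‖ := by simpa using norm_add_le θ (x - θ)
    have h3 := hK x θ (by linarith) (by linarith)
    have h4 := mul_le_mul_of_nonneg_left hx.le hK0
    linarith [(abs_le.1 h3).2]
  refine le_trans ?_ (le_tilted_ball h1)
  refine le_trans ?_ (mul_le_mul' le_rfl (le_measure_ball_of_mem_cmBall hμ (mem_cmBall_toReal hθ) r))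
  exact ofReal_exp_div_mul_le_mul_ofReal_exp hZ (by linarith)

/-- Small balls around `θ` miss the closed set `cmBall μ R` altogether. The alternative `R = 0`,
covered by Anderson's inequality, serves a centre of Cameron–Martin norm zero. -/
theorem tilted_ball_le_of_notMem (hμ : ∫ x, x ∂μ = 0)
    (hL : ∀ r : ℝ, ∃ K : ℝ, ∀ x y : Θ, ‖x‖ < r → ‖y‖ < r → |Φ x - Φ y| ≤ K * ‖x - y‖)
    {θ : Θ} {R : ℝ} (hR : 0 ≤ R) (hθ : R = 0 ∨ θ ∉ cmBall μ R) :
    ∃ K : ℝ, ∀ᶠ r in 𝓝[>] 0, μ.tilted (fun x => -Φ x) (Metric.ball θ r) ≤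
      ENNReal.ofReal (Real.exp (-(Φ θ + R ^ 2 / 2) + K * r) / ∫ x, Real.exp (-Φ x) ∂μ) *
        μ (Metric.ball 0 r) := by
  obtain ⟨K, hK0, hK⟩ := exists_nonneg_lipschitz (‖θ‖ + 1) hL
  have hZ : 0 ≤ ∫ x, Real.exp (-Φ x) ∂μ := integral_nonneg fun _ => (Real.exp_pos _).le
  refine ⟨K, ?_⟩
  have hball : ∀ᶠ r in 𝓝[>] 0, μ (Metric.ball θ r) ≤
      ENNReal.ofReal (Real.exp (-(R ^ 2 / 2))) * μ (Metric.ball 0 r) := by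
    rcases hθ with rfl | hθ
    · exact Eventually.of_forall fun r => by simpa using measure_ball_le_of_isGaussian μ hμ θ r
    · obtain ⟨ε, hε, hsub⟩ := Metric.isOpen_iff.1 (isClosed_cmBall μ R).isOpen_compl θ hθ
      filter_upwards [Ioo_mem_nhdsGT hε] with r hr
      refine measure_ball_le_of_disjoint_cmBall hμ hR ?_
      rw [Set.disjoint_left]
      exact fun x hx => hsub (Metric.ball_subset_ball hr.2.le hx)
  filter_upwards [hball, Ioo_mem_nhdsGT one_pos] with r hr1 hr
  have h1 : ∀ x ∈ Metric.ball θ r, Φ θ - K * r ≤ Φ x := fun x hx => by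
    rw [mem_ball_iff_norm] at hx
    have h2 : ‖x‖ ≤ ‖θ‖ + ‖x - θ‖ := by simpa using norm_add_le θ (x - θ)
    have h3 := hK x θ (by linarith [hr.2]) (by linarith)
    have h4 := mul_le_mul_of_nonneg_left hx.le hK0
    linarith [(abs_le.1 h3).1]
  refine (tilted_ball_le h1).trans ((mul_le_mul' le_rfl hr1).trans ?_)
  exact ofReal_exp_div_mul_ofReal_exp_mul_le hZ (by linarith)

/-- Characterization of the MAP estimators of a measure with a bounded, locally Lipschitz
log-density with respect to a centred Gaussian measure. -/
theorem isMAPEstimator_tilted_iff_of_centered (hμ : ∫ x, x ∂μ = 0) (hB : ∀ x, |Φ x| ≤ B)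
    (hL : ∀ r : ℝ, ∃ K : ℝ, ∀ x y : Θ, ‖x‖ < r → ‖y‖ < r → |Φ x - Φ y| ≤ K * ‖x - y‖)
    (θ : Θ) :
    IsMAPEstimator (μ.tilted fun x => -Φ x) θ ↔ cmNorm μ θ < ∞ ∧ ∀ h, cmNorm μ h < ∞ →
      Φ θ + 1 / 2 * (cmNorm μ θ).toReal ^ 2 ≤ Φ h + 1 / 2 * (cmNorm μ h).toReal ^ 2 := by
  have hΦ : Continuous Φ := continuous_of_lipschitz_on_balls hL
  have hint := integrable_exp_neg_of_bounded (μ := μ) hB hΦ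
  have hZ : 0 < ∫ x, Real.exp (-Φ x) ∂μ := integral_exp_pos hint
  have hprob : IsProbabilityMeasure (μ.tilted fun x => -Φ x) := isProbabilityMeasure_tilted hint
  obtain ⟨θ₀, hθ₀, hmin⟩ := exists_min_onsagerMachlup hμ hB hΦ
  set J := Φ θ₀ + 1 / 2 * (cmNorm μ θ₀).toReal ^ 2 with hJ
  set Z := ∫ x, Real.exp (-Φ x) ∂μ with hZdef
  set Q := μ.tilted fun x => -Φ x with hQ
  -- `K₁` bounds the largest ball mass from above and `K₂` from below, both at the scale `exp(-J)
  -- μ(B(0,r)) / Z`.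
  obtain ⟨K₁, hK₁⟩ := tilted_ball_le_of_min hμ hB hL hmin
  obtain ⟨K₂, hK₂⟩ := le_tilted_ball_of_cmNorm_lt_top hμ hL hθ₀
  rw [← hJ] at hK₂
  have hm0 : ∀ r, 0 < r → 0 < μ (Metric.ball 0 r) := fun r hr => measure_ball_pos_of_isGaussian hμ hr
  have hqpos : ∀ r, 0 < r → r ≤ 1 → (⨆ ϑ : Θ, Q (Metric.ball ϑ r)) ≠ 0 := fun r hr hr1 => by
    have h1 := (hK₂ r hr hr1).trans (le_iSup (fun ϑ => Q (Metric.ball ϑ r)) θ₀)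
    refine (lt_of_lt_of_le ?_ h1).ne'
    exact ENNReal.mul_pos (by simpa using by positivity) (hm0 r hr).ne'
  have hqtop : ∀ r, (⨆ ϑ : Θ, Q (Metric.ball ϑ r)) ≠ ∞ := fun r =>
    ne_top_of_le_ne_top ENNReal.one_ne_top (iSup_le fun ϑ => prob_le_one)
  have hlim : ∀ d K : ℝ, Tendsto (fun r => ENNReal.ofReal (Real.exp (d + K * r))) (𝓝[>] 0)
      (𝓝 (ENNReal.ofReal (Real.exp d))) := fun d K => by
    have : Continuous fun r => ENNReal.ofReal (Real.exp (d + K * r)) :=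
      ENNReal.continuous_ofReal.comp (by fun_prop)
    simpa using (this.tendsto 0).mono_left nhdsWithin_le_nhds
  have hev : ∀ᶠ r : ℝ in 𝓝[>] 0, 0 < r ∧ r ≤ 1 := by
    filter_upwards [Ioo_mem_nhdsGT one_pos] with r hr using ⟨hr.1, hr.2.le⟩
  have hmulexp : ∀ (a b : ℝ) (c : ℝ≥0∞), ENNReal.ofReal (Real.exp a) *
      (ENNReal.ofReal (Real.exp b / Z) * c) = ENNReal.ofReal (Real.exp (a + b) / Z) * c :=
    fun a b c => by
      rw [← mul_assoc, ← ENNReal.ofReal_mul (by positivity), mul_div_assoc', ← Real.exp_add]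
  constructor
  · intro hMAP
    by_contra hcon
    -- If `θ` is not a minimizer, some `R` strictly below its possibly infinite norm (or `R = 0`)
    -- already overshoots `J`. The mass ratio is then at most `exp(d + O(r))` with `d < 0` and
    -- cannot tend to one.
    obtain ⟨R, hR, hθR, hgt⟩ : ∃ R, 0 ≤ R ∧ (R = 0 ∨ θ ∉ cmBall μ R) ∧ J < Φ θ + R ^ 2 / 2 := by
      by_cases hθ : cmNorm μ θ < ∞
      · have hlt : J < Φ θ + 1 / 2 * (cmNorm μ θ).toReal ^ 2 := by
          by_contra! hle
          exact hcon ⟨hθ, fun h hh => hle.trans (hmin h hh)⟩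
        rcases (ENNReal.toReal_nonneg (a := cmNorm μ θ)).eq_or_lt with h0 | h0
        · exact ⟨0, le_rfl, Or.inl rfl, by rw [← h0] at hlt; linarith⟩
        · have hc : Tendsto (fun R : ℝ => Φ θ + R ^ 2 / 2) (𝓝[<] (cmNorm μ θ).toReal)
              (𝓝 (Φ θ + (cmNorm μ θ).toReal ^ 2 / 2)) := by
            have : Continuous fun R : ℝ => Φ θ + R ^ 2 / 2 := by fun_prop
            exact (this.tendsto _).mono_left nhdsWithin_le_nhds
          obtain ⟨R, hR1, hR2⟩ := ((hc.eventually (lt_mem_nhds (show J < _ by linarith))).and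
            (Ioo_mem_nhdsLT h0)).exists
          exact ⟨R, hR2.1.le, Or.inr fun hmem => absurd
            (toReal_cmNorm_le_of_mem_cmBall hR2.1.le hmem) (not_le.2 hR2.2), hR1⟩
      · refine ⟨√(2 * (|J - Φ θ| + 1)), Real.sqrt_nonneg _, Or.inr fun hmem => hθ
          (cmNorm_lt_top_of_mem_cmBall (Real.sqrt_nonneg _) hmem), ?_⟩
        rw [Real.sq_sqrt (by positivity)]
        linarith [le_abs_self (J - Φ θ)]
    obtain ⟨K₃, hK₃⟩ := tilted_ball_le_of_notMem hμ hL hR hθR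
    set d := J - (Φ θ + R ^ 2 / 2) with hd
    have hbound : ∀ᶠ r in 𝓝[>] 0, Q (Metric.ball θ r) / (⨆ ϑ : Θ, Q (Metric.ball ϑ r)) ≤
        ENNReal.ofReal (Real.exp (d + (K₂ + K₃) * r)) := by
      filter_upwards [hK₃, hev] with r hr3 ⟨hr, hr1⟩
      refine ENNReal.div_le_of_le_mul (hr3.trans ?_)
      refine le_trans (le_of_eq ?_) (mul_le_mul' le_rfl ((hK₂ r hr hr1).trans
        (le_iSup (fun ϑ => Q (Metric.ball ϑ r)) θ₀)))
      rw [hmulexp]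
      congr 4
      rw [hd]
      ring
    have := le_of_tendsto_of_tendsto hMAP (hlim d (K₂ + K₃)) hbound
    rw [ENNReal.one_le_ofReal, Real.one_le_exp_iff] at this
    linarith
  · rintro ⟨hθ, hθmin⟩
    obtain ⟨K₃, hK₃⟩ := le_tilted_ball_of_cmNorm_lt_top hμ hL hθ
    have hJθ : Φ θ + 1 / 2 * (cmNorm μ θ).toReal ^ 2 = J :=
      le_antisymm (hθmin θ₀ hθ₀) (hmin θ hθ)
    rw [hJθ] at hK₃
    have hl := hlim 0 (-(K₁ + K₃))
    rw [Real.exp_zero, ENNReal.ofReal_one] at hl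
    refine tendsto_of_tendsto_of_tendsto_of_le_of_le' hl tendsto_const_nhds ?_ ?_
    · filter_upwards [hev] with r ⟨hr, hr1⟩
      rw [ENNReal.le_div_iff_mul_le (Or.inl (hqpos r hr hr1)) (Or.inl (hqtop r))]
      refine le_trans ?_ (hK₃ r hr hr1)
      refine (mul_le_mul' le_rfl (iSup_le (hK₁ r hr hr1))).trans (le_of_eq ?_)
      rw [hmulexp]
      congr 4
      ring
    · exact Eventually.of_forall fun r => ENNReal.div_le_of_le_mul (by
        rw [one_mul]; exact le_iSup (fun ϑ => Q (Metric.ball ϑ r)) θ)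

end CenteredMAP

/-! ### Maximum a posteriori estimators for a general Gaussian prior -/

section MAP

variable {Θ : Type*} [NormedAddCommGroup Θ] [NormedSpace ℝ Θ] [MeasurableSpace Θ] [BorelSpace Θ]

theorem cmNorm_map_sub [SecondCountableTopology Θ] [CompleteSpace Θ] (μ : Measure Θ) [IsGaussian μ]
    (m h : Θ) : cmNorm (μ.map fun x => x - m) h = cmNorm μ h := by
  have hv : ∀ ℓ : StrongDual ℝ Θ, Var[fun θ => ℓ θ; μ.map fun x => x - m] =
      Var[fun θ => ℓ θ; μ] := fun ℓ => by
    rw [variance_map (by fun_prop) (by fun_prop)]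
    have : (fun θ => ℓ θ) ∘ (fun x => x - m) = fun x => ℓ x - ℓ m := by ext; simp
    rw [this, variance_sub_const (by fun_prop)]
  simp only [cmNorm, hv]

theorem tilted_map_sub_ball {Θ : Type*} [SeminormedAddCommGroup Θ] [MeasurableSpace Θ] [BorelSpace Θ]
    (μ : Measure Θ) [SFinite μ] {g : Θ → ℝ} (hg : Measurable g) (m θ : Θ) (r : ℝ) :
    (μ.map fun x => x - m).tilted (fun x => g (x + m)) (Metric.ball (θ - m) r) =
      μ.tilted g (Metric.ball θ r) := by
  have hT : Measurable fun x : Θ => x - m := by fun_prop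
  have hg' : Measurable fun x => g (x + m) := hg.comp (by fun_prop)
  have hexp : Measurable fun x => Real.exp (g (x + m)) := Real.measurable_exp.comp hg'
  rw [tilted_apply, tilted_apply, setLIntegral_map Metric.isOpen_ball.measurableSet
    (by fun_prop) hT, integral_map hT.aemeasurable hexp.aestronglyMeasurable]
  have : (fun x => x - m) ⁻¹' Metric.ball (θ - m) r = Metric.ball θ r := by
    ext x
    simp
  simp [this]

theorem isMAPEstimator_map_sub_iff {Θ : Type*} [NormedAddCommGroup Θ] [MeasurableSpace Θ]
    [BorelSpace Θ] (μ : Measure Θ) [SFinite μ] {g : Θ → ℝ} (hg : Measurable g) (m θ : Θ) :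
    IsMAPEstimator ((μ.map fun x => x - m).tilted fun x => g (x + m)) (θ - m) ↔
      IsMAPEstimator (μ.tilted g) θ := by
  have h1 : ∀ r : ℝ, ⨆ ϑ : Θ, (μ.map fun x => x - m).tilted (fun x => g (x + m))
      (Metric.ball ϑ r) = ⨆ ϑ : Θ, μ.tilted g (Metric.ball ϑ r) := fun r => by
    rw [← (Equiv.subRight m).iSup_comp]
    exact iSup_congr fun ϑ => tilted_map_sub_ball μ hg m ϑ r
  simp only [IsMAPEstimator, h1, tilted_map_sub_ball μ hg]

variable [SecondCountableTopology Θ] [CompleteSpace Θ] {μ : Measure Θ} [IsGaussian μ]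
  {Φ : Θ → ℝ} {B : ℝ}

/-- The MAP estimators of a measure with a bounded, locally Lipschitz log-density with respect to
a Gaussian measure exist, and they are the minimizers of the Onsager–Machlup functional. -/
theorem isMAPEstimator_tilted (hB : ∀ x, |Φ x| ≤ B)
    (hL : ∀ r : ℝ, ∃ K : ℝ, ∀ x y : Θ, ‖x‖ < r → ‖y‖ < r → |Φ x - Φ y| ≤ K * ‖x - y‖) :
    (∃ θ, IsMAPEstimator (μ.tilted fun x => -Φ x) θ) ∧
    ∀ θ, IsMAPEstimator (μ.tilted fun x => -Φ x) θ ↔ θ ∈ cmAffine μ ∧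
      IsMinOn (fun ϑ => Φ ϑ + 1 / 2 * (cmNorm μ (ϑ - ∫ η, η ∂μ)).toReal ^ 2) (cmAffine μ) θ := by
  set m := ∫ η, η ∂μ with hm
  set ν := μ.map fun x => x - m with hν
  set Ψ : Θ → ℝ := fun x => Φ (x + m)
  have hΦ : Continuous Φ := continuous_of_lipschitz_on_balls hL
  have hν0 : ∫ x, x ∂ν = 0 := by
    rw [hν, integral_map (by fun_prop) (by fun_prop),
      integral_sub IsGaussian.integrable_fun_id (integrable_const _)]
    simp [hm]
  have hL' : ∀ r : ℝ, ∃ K : ℝ, ∀ x y : Θ, ‖x‖ < r → ‖y‖ < r → |Ψ x - Ψ y| ≤ K * ‖x - y‖ :=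
    fun r => by
      obtain ⟨K, hK⟩ := hL (r + ‖m‖)
      refine ⟨K, fun x y hx hy => ?_⟩
      have := hK (x + m) (y + m) ((norm_add_le _ _).trans_lt (by linarith))
        ((norm_add_le _ _).trans_lt (by linarith))
      simpa using this
  have hmeas : Measurable fun x => -Φ x := hΦ.measurable.neg
  have hcm : ∀ h, cmNorm ν h = cmNorm μ h := cmNorm_map_sub μ m
  have key := isMAPEstimator_tilted_iff_of_centered hν0 (fun x => hB (x + m)) hL'
  have hiff : ∀ θ, IsMAPEstimator (μ.tilted fun x => -Φ x) θ ↔ cmNorm μ (θ - m) < ∞ ∧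
      ∀ h, cmNorm μ h < ∞ → Φ θ + 1 / 2 * (cmNorm μ (θ - m)).toReal ^ 2 ≤
        Φ (h + m) + 1 / 2 * (cmNorm μ h).toReal ^ 2 := fun θ => by
    rw [← isMAPEstimator_map_sub_iff μ hmeas m θ]
    refine (key (θ - m)).trans ?_
    simp only [hcm, sub_add_cancel]
  constructor
  · obtain ⟨θ, hθ, hmin⟩ := exists_min_onsagerMachlup hν0 (fun x => hB (x + m))
      (continuous_of_lipschitz_on_balls hL')
    refine ⟨θ + m, (hiff _).2 ?_⟩
    simp only [hcm] at hθ hmin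
    rw [add_sub_cancel_right]
    exact ⟨hθ, hmin⟩
  · intro θ
    rw [hiff]
    refine and_congr Iff.rfl ⟨fun H ϑ hϑ => ?_, fun H h hh => ?_⟩
    · simpa using H (ϑ - m) hϑ
    · have hmem : h + m ∈ cmAffine μ := by
        change cmNorm μ (h + m - m) < ∞
        rwa [add_sub_cancel_right]
      have := H hmem
      simpa using this

end MAP

/-! ### Hilbert scales -/

section Scale

variable {ι : Type*} {lam : ι → ℝ} {t : ℝ}

theorem mem_scaleSpace_iff {v : ι → ℝ} :
    v ∈ scaleSpace lam t ↔ Summable fun k => (lam k ^ (-t / 2) * v k) ^ 2 := Iff.rfl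

/-- The isometry of `scaleSpace lam t` into `ℓ²`. -/
noncomputable def scaleSpaceToLp (lam : ι → ℝ) (t : ℝ) :
    scaleSpace lam t →ₗ[ℝ] lp (fun _ : ι => ℝ) 2 where
  toFun v := ⟨fun k => lam k ^ (-t / 2) * v.1 k, memℓp_gen (by
    have := mem_scaleSpace_iff.1 v.2
    refine this.congr fun k => ?_
    simp only [Real.norm_eq_abs, ENNReal.toReal_ofNat, Real.rpow_ofNat, sq_abs])⟩
  map_add' v w := by
    ext k
    exact mul_add _ _ _
  map_smul' c v := by
    ext k
    exact mul_left_comm _ _ _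

theorem scaleSpaceToLp_apply (v : scaleSpace lam t) (k : ι) :
    scaleSpaceToLp lam t v k = lam k ^ (-t / 2) * v.1 k := rfl

theorem norm_scaleSpaceToLp (v : scaleSpace lam t) :
    ‖scaleSpaceToLp lam t v‖ = scaleNorm lam t v := by
  rw [lp.norm_eq_tsum_rpow (by simp), scaleNorm, Real.sqrt_eq_rpow]
  simp only [scaleSpaceToLp_apply, Real.norm_eq_abs, ENNReal.toReal_ofNat, Real.rpow_ofNat, sq_abs]

theorem scaleNorm_nonneg (v : ι → ℝ) : 0 ≤ scaleNorm lam t v := Real.sqrt_nonneg _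

theorem sq_scaleNorm (v : ι → ℝ) :
    scaleNorm lam t v ^ 2 = ∑' k, (lam k ^ (-t / 2) * v k) ^ 2 :=
  Real.sq_sqrt (tsum_nonneg fun _ => sq_nonneg _)

theorem scaleNorm_add_le {v w : ι → ℝ} (hv : v ∈ scaleSpace lam t) (hw : w ∈ scaleSpace lam t) :
    scaleNorm lam t (v + w) ≤ scaleNorm lam t v + scaleNorm lam t w := by
  have := norm_add_le (scaleSpaceToLp lam t ⟨v, hv⟩) (scaleSpaceToLp lam t ⟨w, hw⟩)
  rwa [← map_add, norm_scaleSpaceToLp, norm_scaleSpaceToLp, norm_scaleSpaceToLp] at this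

theorem scaleNorm_smul (c : ℝ) (v : ι → ℝ) :
    scaleNorm lam t (c • v) = |c| * scaleNorm lam t v := by
  rw [scaleNorm, scaleNorm, ← Real.sqrt_sq_eq_abs, ← Real.sqrt_mul (sq_nonneg _), ← tsum_mul_left]
  congr 1
  refine tsum_congr fun k => ?_
  simp only [Pi.smul_apply, smul_eq_mul]
  ring

theorem scaleNorm_neg (v : ι → ℝ) : scaleNorm lam t (-v) = scaleNorm lam t v := by
  simpa using scaleNorm_smul (lam := lam) (t := t) (-1) v

@[simp]
theorem scaleNorm_zero : scaleNorm lam t (0 : ι → ℝ) = 0 := by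
  simp [scaleNorm]

theorem scaleNorm_sub_le {v w : ι → ℝ} (hv : v ∈ scaleSpace lam t) (hw : w ∈ scaleSpace lam t) :
    scaleNorm lam t (v - w) ≤ scaleNorm lam t v + scaleNorm lam t w := by
  rw [sub_eq_add_neg, ← scaleNorm_neg w]
  exact scaleNorm_add_le hv (neg_mem hw)

theorem scaleSpace_mono_and_scaleNorm_le (hlam : ∀ k, 0 < lam k) {Λ : ℝ} (hΛ : ∀ k, lam k ≤ Λ)
    {t' : ℝ} (htt : t ≤ t') {v : ι → ℝ} (hv : v ∈ scaleSpace lam t') :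
    v ∈ scaleSpace lam t ∧ scaleNorm lam t v ≤ |Λ| ^ ((t' - t) / 2) * scaleNorm lam t' v := by
  have key : ∀ k, (lam k ^ (-t / 2) * v k) ^ 2 ≤
      (|Λ| ^ ((t' - t) / 2)) ^ 2 * (lam k ^ (-t' / 2) * v k) ^ 2 := fun k => by
    have : lam k ^ (-t / 2) = lam k ^ ((t' - t) / 2) * lam k ^ (-t' / 2) := by
      rw [← Real.rpow_add (hlam k)]
      ring_nf
    rw [this, mul_assoc, mul_pow]
    gcongr
    · exact Real.rpow_nonneg (hlam k).le _
    · exact (hlam k).le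
    · exact (hΛ k).trans (le_abs_self _)
  have hs := (mem_scaleSpace_iff.1 hv).mul_left ((|Λ| ^ ((t' - t) / 2)) ^ 2)
  have hv' : v ∈ scaleSpace lam t := Summable.of_nonneg_of_le (fun _ => sq_nonneg _) key hs
  refine ⟨hv', abs_le_of_sq_le_sq' ?_ (by positivity [scaleNorm_nonneg (lam := lam) (t := t') v])
    |>.2⟩
  rw [mul_pow, sq_scaleNorm, sq_scaleNorm, ← tsum_mul_left]
  exact Summable.tsum_le_tsum key hv' hs

/-- Splitting `λ⁻¹ = λ^{-(1+σ)/2} λ^{-(1-σ)/2}` reduces this to Cauchy–Schwarz in `ℓ²`: the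
Cameron–Martin pairing puts `U^{1+σ}` and `U^{1-σ}` in duality. -/
theorem summable_mul_of_mem_scaleSpace (hlam : ∀ k, 0 < lam k) {σ : ℝ} {a b : ι → ℝ}
    (ha : a ∈ scaleSpace lam (1 + σ)) (hb : b ∈ scaleSpace lam (1 - σ)) :
    Summable (fun k => (lam k)⁻¹ * a k * b k) ∧
      |∑' k, (lam k)⁻¹ * a k * b k| ≤ scaleNorm lam (1 + σ) a * scaleNorm lam (1 - σ) b := by
  have key : ∀ k, inner ℝ (scaleSpaceToLp lam (1 + σ) ⟨a, ha⟩ k)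
      (scaleSpaceToLp lam (1 - σ) ⟨b, hb⟩ k) = (lam k)⁻¹ * a k * b k := fun k => by
    have : (lam k)⁻¹ = lam k ^ (-(1 + σ) / 2) * lam k ^ (-(1 - σ) / 2) := by
      rw [← Real.rpow_add (hlam k), ← Real.rpow_neg_one]
      ring_nf
    rw [scaleSpaceToLp_apply, scaleSpaceToLp_apply, this]
    simp
    ring
  have h1 := lp.summable_inner (𝕜 := ℝ) (scaleSpaceToLp lam (1 + σ) ⟨a, ha⟩)
    (scaleSpaceToLp lam (1 - σ) ⟨b, hb⟩)
  have h2 := abs_real_inner_le_norm (scaleSpaceToLp lam (1 + σ) ⟨a, ha⟩)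
    (scaleSpaceToLp lam (1 - σ) ⟨b, hb⟩)
  rw [lp.inner_eq_tsum] at h2
  simp only [key, norm_scaleSpaceToLp] at h1 h2
  exact ⟨h1, h2⟩

theorem indicator_mem_scaleSpace (s : Finset ι) (v : ι → ℝ) :
    (s : Set ι).indicator v ∈ scaleSpace lam t := by
  refine summable_of_ne_finset_zero (s := s) fun k hk => ?_
  simp [Set.indicator_of_notMem (by simpa using hk : k ∉ (s : Set ι))]

theorem scaleNorm_indicator_le {v : ι → ℝ} (hv : v ∈ scaleSpace lam t) (s : Finset ι) :
    scaleNorm lam t ((s : Set ι).indicator v) ≤ scaleNorm lam t v := by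
  refine Real.sqrt_le_sqrt (Summable.tsum_le_tsum (fun k => ?_)
    (indicator_mem_scaleSpace s v) hv)
  by_cases hk : k ∈ (s : Set ι)
  · rw [Set.indicator_of_mem hk]
  · rw [Set.indicator_of_notMem hk, mul_zero, zero_pow two_ne_zero]
    exact sq_nonneg _

theorem tendsto_scaleNorm_sub_indicator (v : ι → ℝ) :
    Tendsto (fun s : Finset ι => scaleNorm lam t (v - (s : Set ι).indicator v)) atTop (𝓝 0) := by
  have h := tendsto_tsum_compl_atTop_zero fun k => (lam k ^ (-t / 2) * v k) ^ 2
  have h2 := (Real.continuous_sqrt.tendsto _).comp h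
  rw [Real.sqrt_zero] at h2
  refine h2.congr fun s => ?_
  simp only [Function.comp_apply, scaleNorm]
  congr 1
  rw [← tsum_subtype_eq_of_support_subset (s := {k | k ∉ s})]
  · refine tsum_congr fun k => ?_
    rw [Pi.sub_apply, Set.indicator_of_notMem (by simpa using k.2), sub_zero]
  · intro k hk
    contrapose! hk
    simp only [Set.mem_ofPred_eq, not_not] at hk
    simp [Set.indicator_of_mem (by simpa using hk : k ∈ (s : Set ι))]

variable {V : Type*} [NormedAddCommGroup V] [InnerProductSpace ℝ V] (e : HilbertBasis ι ℝ V)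

theorem coord_apply (v : V) (k : ι) : coord e v k = inner ℝ (e k) v := rfl

theorem coord_add (v w : V) : coord e (v + w) = coord e v + coord e w := by
  ext; simp [coord, inner_add_right]

theorem coord_sub (v w : V) : coord e (v - w) = coord e v - coord e w := by
  ext; simp [coord, inner_sub_right]

theorem coord_smul (c : ℝ) (v : V) : coord e (c • v) = c • coord e v := by
  ext; simp [coord, inner_smul_right]

@[simp]
theorem coord_zero : coord e (0 : V) = 0 := by
  ext; simp [coord]

theorem coord_sum_smul (s : Finset ι) (c : ι → ℝ) :
    coord e (∑ k ∈ s, c k • e k) = (s : Set ι).indicator c := by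
  classical
  ext j
  simp [coord, inner_sum, inner_smul_right, orthonormal_iff_ite.1 e.orthonormal, Set.indicator_apply]

theorem norm_sq_eq_tsum_coord (v : V) : ‖v‖ ^ 2 = ∑' k, coord e v k ^ 2 := by
  have := e.hasSum_inner_mul_inner v v
  rw [← real_inner_self_eq_norm_sq, ← this.tsum_eq]
  refine tsum_congr fun k => ?_
  rw [coord, sq, real_inner_comm]

theorem scaleNorm_zero_index (v : V) : scaleNorm lam 0 (coord e v) = ‖v‖ := by
  rw [scaleNorm, ← Real.sqrt_sq (norm_nonneg v), norm_sq_eq_tsum_coord e]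
  simp

theorem coord_mem_scaleSpace_zero_index (v : V) : coord e v ∈ scaleSpace lam 0 := by
  have := (e.hasSum_inner_mul_inner v v).summable
  rw [mem_scaleSpace_iff]
  refine this.congr fun k => ?_
  simp [coord, sq, real_inner_comm]

theorem eigenvalue_le_opNorm {C : V →L[ℝ] V} (hlam : ∀ k, 0 < lam k)
    (hC : ∀ k, C (e k) = lam k • e k) (k : ι) : lam k ≤ ‖C‖ := by
  have := C.le_opNorm (e k)
  rw [hC, norm_smul, e.orthonormal.1 k, Real.norm_eq_abs, abs_of_pos (hlam k)] at this
  linarith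

end Scale

/-! ### Gaussian measures on a Hilbert space -/

section GaussianHilbert

theorem measurable_scaleNorm_coord_sub {U : Type*} [NormedAddCommGroup U] [InnerProductSpace ℝ U]
    [MeasurableSpace U] [BorelSpace U] {ι : Type*} [Countable ι] {e : HilbertBasis ι ℝ U} {lam : ι → ℝ}
    (t : ℝ) (a : U) :
    Measurable fun u => scaleNorm lam t (coord e (u - a)) := by
  refine Real.continuous_sqrt.measurable.comp (Measurable.tsum fun k => ?_)
  unfold coord
  fun_prop

variable {U : Type*} [NormedAddCommGroup U] [InnerProductSpace ℝ U] [CompleteSpace U]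
  [SecondCountableTopology U] [MeasurableSpace U] [BorelSpace U] {C : U →L[ℝ] U}

theorem IsGaussianWith.unique {P Q : Measure U} {a : U} (hP : IsGaussianWith P a C)
    (hQ : IsGaussianWith Q a C) : P = Q := by
  have := hP.1
  have := hQ.1
  refine IsGaussian.ext (by simp [hP.2.1, hQ.2.1]) ?_
  ext x y
  rw [covarianceBilin_apply_eq_cov IsGaussian.memLp_two_id,
    covarianceBilin_apply_eq_cov IsGaussian.memLp_two_id, hP.2.2, hQ.2.2]

theorem IsGaussianWith.map_add {P : Measure U} {a : U} (hP : IsGaussianWith P a C) (h : U) :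
    IsGaussianWith (P.map fun u => u + h) (a + h) C := by
  have := hP.1
  refine ⟨inferInstance, ?_, fun x y => ?_⟩
  · rw [integral_map (by fun_prop) (by fun_prop),
      integral_add IsGaussian.integrable_fun_id (integrable_const _), hP.2.1]
    simp
  · rw [covariance_map_fun (by fun_prop) (by fun_prop) (by fun_prop)]
    have hi : ∀ z : U, Integrable (fun u => inner ℝ z u) P := fun z =>
      (IsGaussian.integrable_fun_id (μ := P)).const_inner z
    simp only [inner_add_right]
    rw [covariance_add_const_left (hi x), covariance_add_const_right (hi y), hP.2.2]

theorem IsGaussianWith.map_inner_sub {P : Measure U} {a : U} (hP : IsGaussianWith P a C) (x : U) :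
    P.map (fun u => inner ℝ x (u - a)) = gaussianReal 0 (inner ℝ (C x) x).toNNReal := by
  have := hP.1
  have h := IsGaussian.map_eq_gaussianReal (μ := P) (innerSL ℝ x)
  have hmean : ∫ u, innerSL ℝ x u ∂P = inner ℝ x a := by
    rw [IsGaussian.integral_dual, hP.2.1, innerSL_apply_apply]
  have hvar : Var[innerSL ℝ x; P] = inner ℝ (C x) x := by
    rw [← hP.2.2 x x, covariance_self (by fun_prop)]
    rfl
  rw [hmean, hvar] at h
  have h2 := gaussianReal_map_sub_const (μ := inner ℝ x a) (v := (inner ℝ (C x) x).toNNReal)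
    (inner ℝ x a)
  rw [← h, Measure.map_map (by fun_prop) (by fun_prop), sub_self] at h2
  rw [← h2]
  congr 1
  ext u
  simp [inner_sub_right]

variable {ι : Type*} {e : HilbertBasis ι ℝ U} {lam : ι → ℝ}

theorem IsGaussianWith.map_coord_sub (hlam : ∀ k, 0 < lam k) (hC : ∀ k, C (e k) = lam k • e k)
    {P : Measure U} {a : U} (hP : IsGaussianWith P a C) (k : ι) :
    P.map (fun u => coord e (u - a) k / √(lam k)) = gaussianReal 0 1 := by
  have h := hP.map_inner_sub (e k)
  have hv : inner ℝ (C (e k)) (e k) = lam k := by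
    rw [hC, inner_smul_left, real_inner_self_eq_norm_sq, e.orthonormal.1 k]
    simp
  rw [hv] at h
  have h2 := gaussianReal_map_div_const (μ := 0) (v := (lam k).toNNReal) (√(lam k))
  rw [← h, Measure.map_map (by fun_prop) (by fun_prop)] at h2
  have e1 : (lam k).toNNReal / NNReal.mk (√(lam k) ^ 2) (sq_nonneg _) = 1 := by
    ext
    rw [NNReal.coe_div, Real.coe_toNNReal _ (hlam k).le]
    simp [Real.sq_sqrt (hlam k).le, div_self (hlam k).ne']
  rw [e1, zero_div] at h2
  exact h2

/-- A weighted form of Jensen's inequality for the exponential function. -/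
theorem exp_sum_mul_le {s : Finset ι} {w x : ι → ℝ} (hw : ∀ k, 0 ≤ w k) (hs : ∑ k ∈ s, w k ≤ 1) :
    Real.exp (∑ k ∈ s, w k * x k) ≤ 1 + ∑ k ∈ s, w k * Real.exp (x k) := by
  set S := ∑ k ∈ s, w k * x k
  set W := ∑ k ∈ s, w k
  -- Tangent line of `exp` at the weighted sum `S`. The weights may sum to less than one; the
  -- missing mass costs at most the summand `1`, since `exp(S)(1 - S) ≤ 1`.
  have h1 : ∀ k ∈ s, w k * (Real.exp S * (1 + (x k - S))) ≤ w k * Real.exp (x k) := fun k _ => by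
    refine mul_le_mul_of_nonneg_left ?_ (hw k)
    have := Real.add_one_le_exp (x k - S)
    calc Real.exp S * (1 + (x k - S)) ≤ Real.exp S * Real.exp (x k - S) := by
          gcongr
          linarith
      _ = Real.exp (x k) := by rw [← Real.exp_add]; ring_nf
  have h2 := Finset.sum_le_sum h1
  have h3 : ∑ k ∈ s, w k * (Real.exp S * (1 + (x k - S))) =
      Real.exp S * (W + S - W * S) := by
    have : ∀ k, w k * (Real.exp S * (1 + (x k - S))) =
      Real.exp S * w k + Real.exp S * (w k * x k) - Real.exp S * S * w k := fun k => by ring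
    simp only [this, Finset.sum_sub_distrib, Finset.sum_add_distrib, ← Finset.mul_sum]
    ring
  have h4 : Real.exp S * (1 - S) ≤ 1 := by
    have := Real.add_one_le_exp (-S)
    calc Real.exp S * (1 - S) ≤ Real.exp S * Real.exp (-S) := by
          gcongr
          linarith
      _ = 1 := by rw [← Real.exp_add]; simp
  rw [h3] at h2
  have h5 := mul_le_mul_of_nonneg_left h4 (sub_nonneg.2 hs)
  have h6 : 0 ≤ W := Finset.sum_nonneg fun k _ => hw k
  linear_combination h2 + h5 + h6

variable [Countable ι] {σ : ℝ}

/-- A Fernique bound uniform in the mean. The squared norm is `∑ λ_k^σ ξ_k²` with each `ξ_k`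
standard normal, and Jensen with summable weights reduces its exponential to one-dimensional
integrals. Independence of the `ξ_k` is not needed. The same series, being finite almost surely,
gives membership in the scale. -/
theorem exists_lintegral_exp_sq_scaleNorm_le (hlam : ∀ k, 0 < lam k)
    (hC : ∀ k, C (e k) = lam k • e k) (hTr : Summable fun k => lam k ^ σ) :
    ∃ ε > 0, ∃ D : ℝ, ∀ (P : Measure U) (a : U), IsGaussianWith P a C →
      (∀ᵐ u ∂P, coord e (u - a) ∈ scaleSpace lam (1 - σ)) ∧
      ∫⁻ u, ENNReal.ofReal (Real.exp (ε * scaleNorm lam (1 - σ) (coord e (u - a)) ^ 2)) ∂P ≤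
        ENNReal.ofReal D := by
  obtain ⟨c, hc, hint⟩ := IsGaussian.exists_integrable_exp_sq (gaussianReal 0 1)
  set T := ∑' k, lam k ^ σ with hT
  have hT0 : 0 ≤ T := tsum_nonneg fun k => Real.rpow_nonneg (hlam k).le _
  -- `T + 1` instead of `T` avoids division by zero when `ι` is empty.
  set w : ι → ℝ := fun k => lam k ^ σ / (T + 1)
  have hw : ∀ k, 0 < w k := fun k => div_pos (Real.rpow_pos_of_pos (hlam k) _) (by linarith)
  have hws : Summable w := hTr.div_const _
  have hw1 : ∑' k, w k ≤ 1 := by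
    rw [tsum_div_const, div_le_one (by linarith)]
    linarith
  set D := ∫ x, Real.exp (c * ‖x‖ ^ 2) ∂(gaussianReal 0 1)
  have hD : ∫⁻ x, ENNReal.ofReal (Real.exp (c * x ^ 2)) ∂(gaussianReal 0 1) = ENNReal.ofReal D := by
    rw [ofReal_integral_eq_lintegral_ofReal hint (ae_of_all _ fun x => (Real.exp_pos _).le)]
    simp
  have hD0 : 0 ≤ D := integral_nonneg fun x => (Real.exp_pos _).le
  set x : U → ι → ℝ := fun v k => c * (coord e v k / √(lam k)) ^ 2
  have hwx : ∀ v k, w k * x v k = c / (T + 1) * (lam k ^ (-(1 - σ) / 2) * coord e v k) ^ 2 := by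
    intro v k
    have h1 : lam k ^ σ / lam k = (lam k ^ (-(1 - σ) / 2)) ^ 2 := by
      rw [← Real.rpow_natCast, ← Real.rpow_mul (hlam k).le]
      nth_rw 2 [← Real.rpow_one (lam k)]
      rw [← Real.rpow_sub (hlam k)]
      congr 1
      push_cast
      ring
    simp only [w, x]
    rw [div_pow, Real.sq_sqrt (hlam k).le, mul_pow, ← h1]
    have := (hlam k).ne'
    field_simp
  refine ⟨c / (T + 1), by positivity, 1 + D, fun P a hP => ?_⟩
  have := hP.1
  set Y : U → ℝ≥0∞ := fun u => ∑' k, ENNReal.ofReal (w k * Real.exp (x (u - a) k))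
  have hY : ∫⁻ u, Y u ∂P ≤ ENNReal.ofReal D := by
    rw [lintegral_tsum fun k => by simp only [x, coord]; fun_prop]
    have h1 : ∀ k, ∫⁻ u, ENNReal.ofReal (w k * Real.exp (x (u - a) k)) ∂P =
        ENNReal.ofReal (w k) * ENNReal.ofReal D := fun k => by
      simp only [ENNReal.ofReal_mul (hw k).le]
      rw [lintegral_const_mul _ (by simp only [x, coord]; fun_prop), ← hD,
        ← hP.map_coord_sub hlam hC k, lintegral_map (by fun_prop) (by unfold coord; fun_prop)]
    simp only [h1]
    rw [ENNReal.tsum_mul_right, ← ENNReal.ofReal_tsum_of_nonneg (fun k => (hw k).le) hws]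
    calc _ ≤ 1 * ENNReal.ofReal D := by
          gcongr
          exact ENNReal.ofReal_le_one.2 hw1
      _ = _ := one_mul _
  have hYm : AEMeasurable Y P := by
    refine Measurable.aemeasurable (Measurable.tsum fun k => ?_)
    simp only [x, coord]
    fun_prop
  have hmem : ∀ᵐ u ∂P, coord e (u - a) ∈ scaleSpace lam (1 - σ) := by
    filter_upwards [ae_lt_top' hYm (hY.trans_lt ENNReal.ofReal_lt_top).ne] with u hu
    have h1 := ENNReal.summable_toReal hu.ne
    have h2 : Summable fun k => c / (T + 1) * (lam k ^ (-(1 - σ) / 2) * coord e (u - a) k) ^ 2 := by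
      refine Summable.of_nonneg_of_le (fun k => by positivity) (fun k => ?_) h1
      rw [← hwx, ENNReal.toReal_ofReal (mul_nonneg (hw k).le (Real.exp_pos _).le)]
      have := Real.add_one_le_exp (x (u - a) k)
      exact mul_le_mul_of_nonneg_left (by linarith) (hw k).le
    exact (summable_mul_left_iff (by positivity)).1 h2
  refine ⟨hmem, ?_⟩
  calc _ ≤ ∫⁻ u, (1 + Y u) ∂P := by
        refine lintegral_mono_ae ?_
        filter_upwards [hmem] with u hu
        have h1 : Tendsto (fun s : Finset ι => ENNReal.ofReal (Real.exp
            (∑ k ∈ s, w k * x (u - a) k))) atTop (𝓝 (ENNReal.ofReal (Real.exp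
              (c / (T + 1) * scaleNorm lam (1 - σ) (coord e (u - a)) ^ 2)))) := by
          refine ENNReal.tendsto_ofReal ((Real.continuous_exp.tendsto _).comp ?_)
          simp only [hwx]
          rw [sq_scaleNorm]
          exact ((mem_scaleSpace_iff.1 hu).hasSum.mul_left _)
        refine le_of_tendsto' h1 fun s => ?_
        refine (ENNReal.ofReal_le_ofReal (exp_sum_mul_le (fun k => (hw k).le)
          ((hws.sum_le_tsum s fun k _ => (hw k).le).trans hw1))).trans ?_
        rw [ENNReal.ofReal_add zero_le_one (Finset.sum_nonneg fun k _ =>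
          mul_nonneg (hw k).le (Real.exp_pos _).le), ENNReal.ofReal_one,
          ENNReal.ofReal_sum_of_nonneg fun k _ => mul_nonneg (hw k).le (Real.exp_pos _).le]
        gcongr
        exact ENNReal.sum_le_tsum s
    _ ≤ ENNReal.ofReal (1 + D) := by
        rw [lintegral_add_left measurable_const, ENNReal.ofReal_add zero_le_one hD0]
        simp only [lintegral_const, measure_univ, mul_one, ENNReal.ofReal_one]
        gcongr

theorem IsGaussianWith.ae_coord_mem {P : Measure U} {a : U} (hP : IsGaussianWith P a C)
    (hlam : ∀ k, 0 < lam k) (hC : ∀ k, C (e k) = lam k • e k) (hTr : Summable fun k => lam k ^ σ)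
    (ha : coord e a ∈ scaleSpace lam (1 - σ)) :
    ∀ᵐ u ∂P, coord e u ∈ scaleSpace lam (1 - σ) := by
  obtain ⟨ε, -, D, h⟩ := exists_lintegral_exp_sq_scaleNorm_le hlam hC hTr
  filter_upwards [(h P a hP).1] with u hu
  rw [← sub_add_cancel u a, coord_add]
  exact add_mem hu ha

/-- The norm of the scale has exponential moments, uniformly in the mean. -/
theorem exists_integral_exp_scaleNorm_le (hlam : ∀ k, 0 < lam k)
    (hC : ∀ k, C (e k) = lam k • e k) (hTr : Summable fun k => lam k ^ σ) (c : ℝ) :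
    ∃ D : ℝ, ∀ (P : Measure U) (a : U), IsGaussianWith P a C →
      Integrable (fun u => Real.exp (c * scaleNorm lam (1 - σ) (coord e (u - a)))) P ∧
      ∫ u, Real.exp (c * scaleNorm lam (1 - σ) (coord e (u - a))) ∂P ≤ D := by
  obtain ⟨ε, hε, D, h⟩ := exists_lintegral_exp_sq_scaleNorm_le (σ := σ) hlam hC hTr
  -- Completing the square: `c N ≤ ε N² + c²/(4ε)`.
  set K := Real.exp (c ^ 2 / (4 * ε))
  refine ⟨K * max D 0, fun P a hP => ?_⟩
  set N := fun u => scaleNorm lam (1 - σ) (coord e (u - a))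
  have hNm : Measurable N := measurable_scaleNorm_coord_sub _ a
  have hle : ∀ u, Real.exp (c * N u) ≤ K * Real.exp (ε * N u ^ 2) := fun u => by
    rw [← Real.exp_add]
    gcongr
    rw [← sub_nonneg]
    have : c ^ 2 / (4 * ε) + ε * N u ^ 2 - c * N u = (c - 2 * ε * N u) ^ 2 / (4 * ε) := by
      field_simp
      ring
    rw [this]
    positivity
  have hint : Integrable (fun u => Real.exp (ε * N u ^ 2)) P := by
    refine ⟨by fun_prop, ?_⟩
    rw [hasFiniteIntegral_iff_ofReal (ae_of_all _ fun u => (Real.exp_pos _).le)]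
    exact (h P a hP).2.trans_lt ENNReal.ofReal_lt_top
  have hI : ∫ u, Real.exp (ε * N u ^ 2) ∂P ≤ max D 0 := by
    rw [integral_eq_lintegral_of_nonneg_ae (ae_of_all _ fun u => (Real.exp_pos _).le)
      hint.aestronglyMeasurable]
    exact (ENNReal.toReal_mono ENNReal.ofReal_ne_top (h P a hP).2).trans_eq
      ENNReal.toReal_ofReal'
  have hint2 : Integrable (fun u => Real.exp (c * N u)) P := by
    refine (hint.const_mul K).mono' (by fun_prop) (ae_of_all _ fun u => ?_)
    rw [Real.norm_eq_abs, abs_of_pos (Real.exp_pos _)]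
    exact hle u
  refine ⟨hint2, (integral_mono hint2 (hint.const_mul K) hle).trans ?_⟩
  rw [integral_const_mul]
  exact mul_le_mul_of_nonneg_left hI (Real.exp_pos _).le

end GaussianHilbert

/-! ### Integrals of positive locally Lipschitz functions on the Hilbert scale -/

section ScaleRegular

variable {U : Type*} [NormedAddCommGroup U] [InnerProductSpace ℝ U] {ι : Type*}

/-- A positive function which on the space of index `t` of a Hilbert scale grows at most
exponentially, is locally bounded below, and is locally Lipschitz. -/
structure IsScaleRegular (e : HilbertBasis ι ℝ U) (lam : ι → ℝ) (t : ℝ) (F : U → ℝ) : Prop where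
  pos : ∀ u, 0 < F u
  growth : ∃ A A' : ℝ, 0 ≤ A ∧ 0 ≤ A' ∧ ∀ u, coord e u ∈ scaleSpace lam t →
    F u ≤ A * Real.exp (A' * scaleNorm lam t (coord e u))
  lower : ∀ ρ : ℝ, ∃ c > 0, ∀ u, coord e u ∈ scaleSpace lam t →
    scaleNorm lam t (coord e u) ≤ ρ → c ≤ F u
  lipschitz : ∀ ρ : ℝ, ∃ K : ℝ, ∀ u v, coord e u ∈ scaleSpace lam t →
    coord e v ∈ scaleSpace lam t → scaleNorm lam t (coord e u) ≤ ρ →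
    scaleNorm lam t (coord e v) ≤ ρ → |F u - F v| ≤ K * scaleNorm lam t (coord e (u - v))

variable {e : HilbertBasis ι ℝ U} {lam : ι → ℝ} {t : ℝ} {F : U → ℝ}

theorem IsScaleRegular.tendsto (hF : IsScaleRegular e lam t F) {β : Type*} {l : Filter β}
    {g : β → U} {u : U} (hg : ∀ b, coord e (g b) ∈ scaleSpace lam t)
    (hu : coord e u ∈ scaleSpace lam t)
    (h : Tendsto (fun b => scaleNorm lam t (coord e (g b - u))) l (𝓝 0)) :
    Tendsto (fun b => F (g b)) l (𝓝 (F u)) := by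
  obtain ⟨K, hK⟩ := hF.lipschitz (scaleNorm lam t (coord e u) + 1)
  rw [tendsto_iff_dist_tendsto_zero]
  refine squeeze_zero' (Eventually.of_forall fun _ => dist_nonneg) ?_
    (by simpa using h.const_mul K)
  filter_upwards [h.eventually (gt_mem_nhds zero_lt_one)] with b hb
  rw [Real.dist_eq]
  refine hK _ _ (hg b) hu ?_ (by linarith)
  have := scaleNorm_add_le (lam := lam) (t := t) (v := coord e u) (w := coord e (g b - u)) hu
    (by rw [coord_sub]; exact sub_mem (hg b) hu)
  rw [← coord_add, add_sub_cancel] at this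
  linarith

theorem coord_truncation_mem (s : Finset ι) (u : U) :
    coord e (∑ k ∈ s, coord e u k • e k) ∈ scaleSpace lam t := by
  rw [coord_sum_smul]
  exact indicator_mem_scaleSpace s _

theorem tendsto_scaleNorm_truncation_sub (u : U) : Tendsto (fun s : Finset ι =>
    scaleNorm lam t (coord e (∑ k ∈ s, coord e u k • e k - u))) atTop (𝓝 0) := by
  refine (tendsto_scaleNorm_sub_indicator (lam := lam) (t := t) (coord e u)).congr fun s => ?_
  rw [← scaleNorm_neg, coord_sub, coord_sum_smul, neg_sub]

theorem IsScaleRegular.continuous_truncation (hF : IsScaleRegular e lam t F) (s : Finset ι) :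
    Continuous fun u => F (∑ k ∈ s, coord e u k • e k) := by
  refine continuous_iff_continuousAt.2 fun u₀ => ?_
  refine hF.tendsto (fun u => coord_truncation_mem s u) (coord_truncation_mem s u₀) ?_
  have h1 : ∀ u, scaleNorm lam t (coord e (∑ k ∈ s, coord e u k • e k - ∑ k ∈ s, coord e u₀ k • e k))
      = √(∑ k ∈ s, (lam k ^ (-t / 2) * coord e (u - u₀) k) ^ 2) := fun u => by
    rw [coord_sub, coord_sum_smul, coord_sum_smul, scaleNorm,
      tsum_eq_sum (s := s) fun k hk => by
        simp [Set.indicator_of_notMem (by simpa using hk : k ∉ (s : Set ι))]]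
    congr 1
    refine Finset.sum_congr rfl fun k hk => ?_
    simp [Set.indicator_of_mem (by simpa using hk : k ∈ (s : Set ι)), coord_sub]
  simp only [h1]
  have h2 : Continuous fun u => √(∑ k ∈ s, (lam k ^ (-t / 2) * coord e (u - u₀) k) ^ 2) := by
    unfold coord
    fun_prop
  simpa using h2.tendsto u₀

theorem scaleNorm_coord_le_add (a u : U) (hu : coord e u ∈ scaleSpace lam t)
    (ha : coord e a ∈ scaleSpace lam t) : scaleNorm lam t (coord e u) ≤
      scaleNorm lam t (coord e (u - a)) + scaleNorm lam t (coord e a) := by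
  have hs : coord e (u - a) ∈ scaleSpace lam t := by rw [coord_sub]; exact sub_mem hu ha
  have := scaleNorm_add_le hs ha
  rwa [← coord_add, sub_add_cancel] at this

variable [CompleteSpace U] [SecondCountableTopology U] [MeasurableSpace U] [BorelSpace U]
  {C : U →L[ℝ] U}

/-- The Cameron–Martin formula for finite combinations of eigenvectors of the covariance. -/
theorem IsGaussianWith.integral_add_sum (hlam : ∀ k, 0 < lam k) (hC : ∀ k, C (e k) = lam k • e k)
    {P : Measure U} {a : U} (hP : IsGaussianWith P a C) (s : Finset ι) (h : ι → ℝ) {g : U → ℝ}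
    (hg : AEStronglyMeasurable g (P.map fun u => u + ∑ k ∈ s, h k • e k)) :
    ∫ u, g (u + ∑ k ∈ s, h k • e k) ∂P =
      ∫ u, Real.exp (∑ k ∈ s, (lam k)⁻¹ * h k * coord e (u - a) k -
        (∑ k ∈ s, (lam k)⁻¹ * h k * h k) / 2) * g u ∂P := by
  classical
  have := hP.1
  -- `x` is the preimage of the shift under `C`, so the shift is the covariance image of `⟨x, ·⟩`.
  set x : U := ∑ k ∈ s, ((lam k)⁻¹ * h k) • e k
  have hx : C x = ∑ k ∈ s, h k • e k := by
    simp only [x, map_sum, map_smul, hC, smul_smul]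
    refine Finset.sum_congr rfl fun k _ => ?_
    have := (hlam k).ne'
    congr 1
    field_simp
  have hcov : ∀ y, covarianceBilinDual P (innerSL ℝ x) (innerSL ℝ y) = inner ℝ (C x) y := fun y => by
    rw [covarianceBilinDual_eq_covariance IsGaussian.memLp_two_id, ← hP.2.2]
    rfl
  have hvec : covVec P (innerSL ℝ x) = ∑ k ∈ s, h k • e k := by
    rw [← hx]
    refine ext_inner_left ℝ fun y => ?_
    rw [← innerSL_apply_apply ℝ, apply_covVec, hcov, real_inner_comm]
  have hxu : ∀ u, inner ℝ x u = ∑ k ∈ s, (lam k)⁻¹ * h k * coord e u k := fun u => by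
    simp [x, sum_inner, inner_smul_left, coord]
  have hself : covarianceBilinDual P (innerSL ℝ x) (innerSL ℝ x) =
      ∑ k ∈ s, (lam k)⁻¹ * h k * h k := by
    rw [hcov, hx, real_inner_comm, hxu]
    refine Finset.sum_congr rfl fun k hk => ?_
    rw [coord_sum_smul, Set.indicator_of_mem (by simpa using hk)]
  have hm : ∫ v, innerSL ℝ x v ∂P = inner ℝ x a := by
    rw [IsGaussian.integral_dual, hP.2.1, innerSL_apply_apply]
  have key := integral_add_covVec P (innerSL ℝ x) g (by rwa [hvec])
  rw [hvec, hself, hm] at key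
  rw [key]
  simp only [innerSL_apply_apply, hxu, coord_sub, Pi.sub_apply, mul_sub, Finset.sum_sub_distrib]

variable [Countable ι] {σ : ℝ}

/-- `F` is controlled only on the scale, but almost surely it is the limit of its compositions with
finite truncations. These are continuous because only finitely many coordinates enter. -/
theorem IsScaleRegular.aestronglyMeasurable (hF : IsScaleRegular e lam (1 - σ) F)
    (hlam : ∀ k, 0 < lam k) (hC : ∀ k, C (e k) = lam k • e k) (hTr : Summable fun k => lam k ^ σ)
    {P : Measure U} {a : U} (hP : IsGaussianWith P a C)
    (ha : coord e a ∈ scaleSpace lam (1 - σ)) : AEStronglyMeasurable F P := by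
  refine aestronglyMeasurable_of_tendsto_ae (atTop : Filter (Finset ι))
    (f := fun s u => F (∑ k ∈ s, coord e u k • e k))
    (fun s => (hF.continuous_truncation s).aestronglyMeasurable) ?_
  filter_upwards [hP.ae_coord_mem hlam hC hTr ha] with u hu
  exact hF.tendsto (fun s => coord_truncation_mem s u) hu (tendsto_scaleNorm_truncation_sub u)

/-- The upper bound combines exponential growth with exponential moments. For the lower bound,
Markov's inequality confines `u` to a fixed ball of the scale with probability at least one half,
and `F` is bounded below there. -/
theorem IsScaleRegular.exists_integral_bounds (hF : IsScaleRegular e lam (1 - σ) F)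
    (hlam : ∀ k, 0 < lam k) (hC : ∀ k, C (e k) = lam k • e k) (hTr : Summable fun k => lam k ^ σ)
    (R : ℝ) : ∃ c > 0, ∃ D, ∀ (P : Measure U) (a : U), IsGaussianWith P a C →
      coord e a ∈ scaleSpace lam (1 - σ) → scaleNorm lam (1 - σ) (coord e a) ≤ R →
      Integrable F P ∧ c ≤ ∫ u, F u ∂P ∧ ∫ u, F u ∂P ≤ D := by
  obtain ⟨A, A', hA, hA', hgr⟩ := hF.growth
  obtain ⟨D, hD⟩ := exists_integral_exp_scaleNorm_le (σ := σ) hlam hC hTr A'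
  obtain ⟨D₁, hD₁⟩ := exists_integral_exp_scaleNorm_le (σ := σ) hlam hC hTr 1
  -- Twice the exponential moment, so Markov gives probability at most `1/2`; moreover `exp N < B`
  -- implies `N < B`.
  set B := 2 * max D₁ 1
  obtain ⟨c, hc, hlow⟩ := hF.lower (B + R)
  refine ⟨c / 2, by positivity, A * Real.exp (A' * R) * D, fun P a hP ha haR => ?_⟩
  have := hP.1
  have hmem := hP.ae_coord_mem hlam hC hTr ha
  set N := fun u => scaleNorm lam (1 - σ) (coord e (u - a))
  have hNm : Measurable N := measurable_scaleNorm_coord_sub _ a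
  have hbd : ∀ᵐ u ∂P, F u ≤ A * Real.exp (A' * R) * Real.exp (A' * N u) := by
    filter_upwards [hmem] with u hu
    refine (hgr u hu).trans ?_
    rw [mul_assoc, ← Real.exp_add]
    gcongr
    have := scaleNorm_coord_le_add a u hu ha
    nlinarith
  have hint : Integrable F P := by
    refine ((hD P a hP).1.const_mul (A * Real.exp (A' * R))).mono'
      (hF.aestronglyMeasurable hlam hC hTr hP ha) ?_
    filter_upwards [hbd] with u hu
    rwa [Real.norm_eq_abs, abs_of_pos (hF.pos u)]
  refine ⟨hint, ?_, ?_⟩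
  · have h1 := mul_meas_ge_le_integral_of_nonneg
      (ae_of_all P fun u => (Real.exp_pos (1 * N u)).le) (hD₁ P a hP).1 B
    have hB : 0 < B := by positivity
    have h2 : P.real {u | B ≤ Real.exp (1 * N u)} ≤ 1 / 2 := by
      have h3 : B * P.real {u | B ≤ Real.exp (1 * N u)} ≤ B * (1 / 2) := by
        refine (h1.trans (hD₁ P a hP).2).trans ?_
        have := le_max_left D₁ 1
        simp only [B]
        linarith
      exact le_of_mul_le_mul_left h3 hB
    have hms : MeasurableSet {u | B ≤ Real.exp (1 * N u)} :=
      measurableSet_le measurable_const (by fun_prop)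
    have h4 : 1 / 2 ≤ P.real {u | B ≤ Real.exp (1 * N u)}ᶜ := by
      rw [probReal_compl_eq_one_sub hms]
      linarith
    calc c / 2 ≤ c * P.real {u | B ≤ Real.exp (1 * N u)}ᶜ := by nlinarith
      _ = ∫ u in {u | B ≤ Real.exp (1 * N u)}ᶜ, c ∂P := by simp [mul_comm]
      _ ≤ ∫ u in {u | B ≤ Real.exp (1 * N u)}ᶜ, F u ∂P := by
          refine setIntegral_mono_on_ae (integrable_const c).integrableOn hint.integrableOn
            hms.compl ?_
          filter_upwards [hmem] with u hu huB
          refine hlow u hu ((scaleNorm_coord_le_add a u hu ha).trans ?_)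
          have h5 : Real.exp (1 * N u) < B := by simpa using huB
          have h6 := Real.add_one_le_exp (1 * N u)
          simp only [N] at h5 h6
          linarith
      _ ≤ ∫ u, F u ∂P := setIntegral_le_integral hint (ae_of_all _ fun u => (hF.pos u).le)
  · refine (integral_mono_ae hint ((hD P a hP).1.const_mul _) hbd).trans ?_
    rw [integral_const_mul]
    exact mul_le_mul_of_nonneg_left (hD P a hP).2 (by positivity)

theorem abs_exp_sub_one_le_mul_exp (w : ℝ) : |Real.exp w - 1| ≤ |w| * Real.exp |w| := by
  have h1 := Real.add_one_le_exp w
  have h2 := Real.add_one_le_exp (-w)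
  have h3 : Real.exp w * Real.exp (-w) = 1 := by rw [← Real.exp_add]; simp
  have h4 := Real.exp_pos w
  rcases le_total 0 w with h | h
  · rw [abs_of_nonneg h, abs_of_nonneg (by linarith)]
    nlinarith
  · rw [abs_of_nonpos h, abs_of_nonpos (by linarith [Real.exp_le_one_iff.2 h])]
    have := Real.one_le_exp (neg_nonneg.2 h)
    nlinarith

/-- Integrals against Gaussian measures with a fixed covariance depend on the mean in a Lipschitz
way, with respect to a strong norm of the scale. -/
theorem IsScaleRegular.exists_abs_integral_sub_le (hF : IsScaleRegular e lam (1 - σ) F)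
    (hσ : 0 ≤ σ)
    (hlam : ∀ k, 0 < lam k) (hC : ∀ k, C (e k) = lam k • e k) (hTr : Summable fun k => lam k ^ σ)
    {R : ℝ} (hR : 0 ≤ R) : ∃ K, ∀ (P Q : Measure U) (a b : U), IsGaussianWith P a C →
      IsGaussianWith Q b C → coord e a ∈ scaleSpace lam (1 + σ) →
      coord e b ∈ scaleSpace lam (1 + σ) → scaleNorm lam (1 + σ) (coord e a) ≤ R →
      scaleNorm lam (1 + σ) (coord e b) ≤ R →
      |∫ u, F u ∂Q - ∫ u, F u ∂P| ≤ K * scaleNorm lam (1 + σ) (coord e (b - a)) := by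
  set c₀ := |‖C‖| ^ (((1 + σ) - (1 - σ)) / 2)
  have hc₀ : 0 ≤ c₀ := Real.rpow_nonneg (abs_nonneg _) _
  have hemb : ∀ v ∈ scaleSpace lam (1 + σ), v ∈ scaleSpace lam (1 - σ) ∧
      scaleNorm lam (1 - σ) v ≤ c₀ * scaleNorm lam (1 + σ) v := fun v hv =>
    scaleSpace_mono_and_scaleNorm_le hlam (eigenvalue_le_opNorm e hlam hC) (by linarith) hv
  obtain ⟨A, A', hA, hA', hgr⟩ := hF.growth
  set B := 1 + 2 * R + A'
  obtain ⟨D, hD⟩ := exists_integral_exp_scaleNorm_le (σ := σ) hlam hC hTr B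
  obtain ⟨D', hD'⟩ := exists_integral_exp_scaleNorm_le (σ := σ) hlam hC hTr A'
  refine ⟨A * Real.exp (B * (c₀ * R)) * D, fun P Q a b hP hQ ha hb haR hbR => ?_⟩
  have := hP.1
  have ha' := (hemb _ ha).1
  have haN : scaleNorm lam (1 - σ) (coord e a) ≤ c₀ * R :=
    (hemb _ ha).2.trans (mul_le_mul_of_nonneg_left haR hc₀)
  set h := b - a with hh
  set δ := scaleNorm lam (1 + σ) (coord e h) with hδ
  have hδ0 : 0 ≤ δ := scaleNorm_nonneg _
  have hhm : coord e h ∈ scaleSpace lam (1 + σ) := by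
    rw [hh, coord_sub]; exact sub_mem hb ha
  have hhm' := (hemb _ hhm).1
  have hδR : δ ≤ 2 * R := by
    have := scaleNorm_sub_le hb ha
    rw [← coord_sub] at this
    linarith
  have hhN : scaleNorm lam (1 - σ) (coord e h) ≤ c₀ * δ := (hemb _ hhm).2
  set N := fun u => scaleNorm lam (1 - σ) (coord e (u - a)) with hN
  have hN0 : ∀ u, 0 ≤ N u := fun u => scaleNorm_nonneg _
  have hmem := hP.ae_coord_mem hlam hC hTr ha'
  have hQP : Q = P.map fun u => u + h := by
    refine hQ.unique ?_
    have := hP.map_add h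
    rwa [hh, add_sub_cancel] at this
  have hFm : ∀ g : U, coord e g ∈ scaleSpace lam (1 - σ) →
      AEStronglyMeasurable F (P.map fun u => u + g) := fun g hg =>
    hF.aestronglyMeasurable hlam hC hTr (hP.map_add g) (by rw [coord_add]; exact add_mem ha' hg)
  have hFint : Integrable F P := by
    obtain ⟨c, -, D, h⟩ := hF.exists_integral_bounds hlam hC hTr (c₀ * R)
    exact (h P a hP ha' haN).1
  -- The shift formula is available for finite combinations of eigenvectors, so `h` is truncated;
  -- the bound is uniform in `s` and passes to the limit by dominated convergence.
  set T : Finset ι → U := fun s => ∑ k ∈ s, coord e h k • e k with hT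
  have hTm : ∀ s, coord e (T s) ∈ scaleSpace lam (1 - σ) := fun s => coord_truncation_mem s h
  have hTN : ∀ s, scaleNorm lam (1 - σ) (coord e (T s)) ≤ scaleNorm lam (1 - σ) (coord e h) :=
    fun s => by
      rw [hT, coord_sum_smul]
      exact scaleNorm_indicator_le hhm' s
  have hstep : ∀ s, |∫ u, F (u + T s) ∂P - ∫ u, F u ∂P| ≤
      A * Real.exp (B * (c₀ * R)) * D * δ := fun s => by
    set w : U → ℝ := fun u => ∑ k ∈ s, (lam k)⁻¹ * coord e h k * coord e (u - a) k -
        (∑ k ∈ s, (lam k)⁻¹ * coord e h k * coord e h k) / 2 with hw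
    have hind : ∀ v, v ∈ scaleSpace lam (1 - σ) → |∑ k ∈ s, (lam k)⁻¹ * coord e h k * v k| ≤
        δ * scaleNorm lam (1 - σ) v := fun v hv => by
      have h1 := (summable_mul_of_mem_scaleSpace hlam
        (indicator_mem_scaleSpace s (coord e h)) hv).2
      rw [tsum_eq_sum (s := s) fun k hk => by
        simp [Set.indicator_of_notMem (by simpa using hk : k ∉ (s : Set ι))]] at h1
      rw [Finset.sum_congr rfl fun k hk => by
        rw [Set.indicator_of_mem (by simpa using hk : k ∈ (s : Set ι))]] at h1
      exact h1.trans (mul_le_mul_of_nonneg_right (scaleNorm_indicator_le hhm s)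
        (scaleNorm_nonneg _))
    have hwb : ∀ u, coord e u ∈ scaleSpace lam (1 - σ) → |w u| ≤ δ * (N u + c₀ * R) := fun u hu => by
      have h1 := hind _ (by rw [coord_sub]; exact sub_mem hu ha' :
        coord e (u - a) ∈ scaleSpace lam (1 - σ))
      have h2 := hind _ hhm'
      have h3 : δ * scaleNorm lam (1 - σ) (coord e h) ≤ 2 * (δ * (c₀ * R)) := by
        calc _ ≤ δ * (c₀ * (2 * R)) := by
              refine mul_le_mul_of_nonneg_left (hhN.trans ?_) hδ0
              exact mul_le_mul_of_nonneg_left hδR hc₀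
          _ = _ := by ring
      have h4 := abs_sub (∑ k ∈ s, (lam k)⁻¹ * coord e h k * coord e (u - a) k)
        ((∑ k ∈ s, (lam k)⁻¹ * coord e h k * coord e h k) / 2)
      rw [abs_div, abs_two] at h4
      simp only [hw]
      simp only [hN]
      linarith
    have hbound : ∀ᵐ u ∂P, |(Real.exp (w u) - 1) * F u| ≤
        A * Real.exp (B * (c₀ * R)) * δ * Real.exp (B * N u) := by
      filter_upwards [hmem] with u hu
      set n := N u + c₀ * R with hn
      have hn0 : 0 ≤ n := add_nonneg (hN0 u) (mul_nonneg hc₀ hR)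
      -- Extracts one factor `δ` from the exponent; `δ ≤ 2R` absorbs the rest into an exponential
      -- moment.
      have h1 : |Real.exp (w u) - 1| ≤ δ * Real.exp ((1 + 2 * R) * n) := by
        refine (abs_exp_sub_one_le_mul_exp _).trans ?_
        have h2 : |w u| ≤ 2 * R * n := (hwb u hu).trans (mul_le_mul_of_nonneg_right hδR hn0)
        calc |w u| * Real.exp |w u| ≤ (δ * Real.exp n) * Real.exp (2 * R * n) := by
              gcongr
              refine (hwb u hu).trans ?_
              gcongr
              linarith [Real.add_one_le_exp n]
          _ = _ := by
              rw [mul_assoc, ← Real.exp_add]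
              ring_nf
      have h2 : F u ≤ A * Real.exp (A' * n) := by
        refine (hgr u hu).trans ?_
        gcongr
        have := scaleNorm_coord_le_add a u hu ha'
        simp only [hn, hN]
        linarith
      rw [abs_mul, abs_of_pos (hF.pos u)]
      calc _ ≤ (δ * Real.exp ((1 + 2 * R) * n)) * (A * Real.exp (A' * n)) :=
            mul_le_mul h1 h2 (hF.pos u).le (by positivity)
        _ = A * δ * (Real.exp ((1 + 2 * R) * n) * Real.exp (A' * n)) := by ring
        _ = A * δ * (Real.exp (B * (c₀ * R)) * Real.exp (B * N u)) := by
            rw [← Real.exp_add, ← Real.exp_add]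
            simp only [B, hn]
            ring_nf
        _ = _ := by ring
    have hFP := hFint.aestronglyMeasurable
    have hwm : Measurable w := by
      simp only [hw, coord]
      fun_prop
    have hdom := (hD P a hP).1.const_mul (A * Real.exp (B * (c₀ * R)) * δ)
    have hint : Integrable (fun u => (Real.exp (w u) - 1) * F u) P :=
      hdom.mono' ((by fun_prop : Measurable fun u => Real.exp (w u) - 1).aestronglyMeasurable.mul
        hFP) hbound
    have heq : ∫ u, F (u + T s) ∂P - ∫ u, F u ∂P = ∫ u, (Real.exp (w u) - 1) * F u ∂P := by
      rw [hP.integral_add_sum hlam hC s (coord e h) (hFm _ (hTm s)), sub_eq_iff_eq_add,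
        ← integral_add hint hFint]
      refine integral_congr_ae (ae_of_all _ fun u => ?_)
      simp only [hw]
      ring
    rw [heq]
    calc _ ≤ ∫ u, |(Real.exp (w u) - 1) * F u| ∂P := abs_integral_le_integral_abs
      _ ≤ ∫ u, A * Real.exp (B * (c₀ * R)) * δ * Real.exp (B * N u) ∂P :=
          integral_mono_ae hint.abs hdom hbound
      _ = A * Real.exp (B * (c₀ * R)) * δ * ∫ u, Real.exp (B * N u) ∂P := integral_const_mul _ _
      _ ≤ A * Real.exp (B * (c₀ * R)) * δ * D :=
          mul_le_mul_of_nonneg_left (hD P a hP).2 (by positivity)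
      _ = _ := by ring
  have hlim : Tendsto (fun s => ∫ u, F (u + T s) ∂P) atTop (𝓝 (∫ u, F (u + h) ∂P)) := by
    refine tendsto_integral_filter_of_dominated_convergence
      (fun u => A * Real.exp (A' * (c₀ * R + scaleNorm lam (1 - σ) (coord e h))) *
        Real.exp (A' * N u)) (Eventually.of_forall fun s => ?_) (Eventually.of_forall fun s => ?_)
      ((hD' P a hP).1.const_mul _) ?_
    · exact (hFm _ (hTm s)).comp_measurable (by fun_prop)
    · filter_upwards [hmem] with u hu
      rw [Real.norm_eq_abs, abs_of_pos (hF.pos _)]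
      have hus : coord e (u + T s) ∈ scaleSpace lam (1 - σ) := by
        rw [coord_add]; exact add_mem hu (hTm s)
      refine (hgr _ hus).trans ?_
      rw [mul_assoc, ← Real.exp_add, ← mul_add]
      gcongr
      have h1 := scaleNorm_add_le hu (hTm s)
      rw [← coord_add] at h1
      have h2 := scaleNorm_coord_le_add a u hu ha'
      have h3 := hTN s
      simp only [hN]
      linarith
    · filter_upwards [hmem] with u hu
      refine hF.tendsto (fun s => by rw [coord_add]; exact add_mem hu (hTm s))
        (by rw [coord_add]; exact add_mem hu hhm') ?_
      simp only [add_sub_add_left_eq_sub]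
      exact tendsto_scaleNorm_truncation_sub h
  rw [hQP, integral_map (by fun_prop) (hFm h hhm')]
  exact le_of_tendsto ((hlim.sub_const _).abs) (Eventually.of_forall hstep)

end ScaleRegular

/-! ### Potentials on the Hilbert scale and their likelihoods -/

section ScalePotential

variable {U : Type*} [NormedAddCommGroup U] [InnerProductSpace ℝ U] {ι : Type*}

/-- A function which on the space of index `t` of a Hilbert scale is bounded below by a multiple of
`-(1 + ‖u‖)` and is locally Lipschitz. -/
structure IsScalePotential (e : HilbertBasis ι ℝ U) (lam : ι → ℝ) (t : ℝ) (p : U → ℝ) : Prop where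
  lower : ∃ c : ℝ, 0 ≤ c ∧ ∀ u, coord e u ∈ scaleSpace lam t →
    -(c * (1 + scaleNorm lam t (coord e u))) ≤ p u
  lipschitz : ∀ ρ : ℝ, ∃ K : ℝ, ∀ u v, coord e u ∈ scaleSpace lam t →
    coord e v ∈ scaleSpace lam t → scaleNorm lam t (coord e u) ≤ ρ →
    scaleNorm lam t (coord e v) ≤ ρ → |p u - p v| ≤ K * scaleNorm lam t (coord e (u - v))

variable {e : HilbertBasis ι ℝ U} {lam : ι → ℝ} {t : ℝ}

theorem IsScalePotential.sum {β : Type*} (s : Finset β) {p : β → U → ℝ}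
    (hp : ∀ j, IsScalePotential e lam t (p j)) :
    IsScalePotential e lam t fun u => ∑ j ∈ s, p j u := by
  choose c hc hlow using fun j => (hp j).lower
  refine ⟨⟨∑ j ∈ s, c j, Finset.sum_nonneg fun j _ => hc j, fun u hu => ?_⟩, fun ρ => ?_⟩
  · rw [Finset.sum_mul, ← Finset.sum_neg_distrib]
    exact Finset.sum_le_sum fun j _ => hlow j u hu
  · choose K hK using fun j => (hp j).lipschitz ρ
    refine ⟨∑ j ∈ s, K j, fun u v hu hv hu' hv' => ?_⟩
    rw [← Finset.sum_sub_distrib, Finset.sum_mul]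
    exact (Finset.abs_sum_le_sum_abs _ _).trans
      (Finset.sum_le_sum fun j _ => hK j u v hu hv hu' hv')

theorem abs_exp_neg_sub_exp_neg_le {B x y : ℝ} (hx : |x| ≤ B) (hy : |y| ≤ B) :
    |Real.exp (-x) - Real.exp (-y)| ≤ Real.exp B * |x - y| := by
  wlog h : x ≤ y generalizing x y
  · rw [abs_sub_comm, abs_sub_comm x]
    exact this hy hx (le_of_not_ge h)
  have h1 := Real.add_one_le_exp (-(y - x))
  have h2 : Real.exp (-y) = Real.exp (-x) * Real.exp (-(y - x)) := by
    rw [← Real.exp_add]; ring_nf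
  have h3 : Real.exp (-x) ≤ Real.exp B := Real.exp_le_exp.2 (by linarith [abs_le.1 hx])
  have h4 : Real.exp (-(y - x)) ≤ 1 := Real.exp_le_one_iff.2 (by linarith)
  have h5 := Real.exp_pos (-x)
  rw [abs_of_nonneg (by rw [h2]; nlinarith), abs_of_nonpos (by linarith), h2]
  calc _ = Real.exp (-x) * (1 - Real.exp (-(y - x))) := by ring
    _ ≤ Real.exp B * (-(x - y)) := by
        refine mul_le_mul h3 (by linarith) (by linarith) (Real.exp_pos _).le

/-- The linear lower bound on `p` gives exponential growth; comparison with `p 0` bounds `p` on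
balls, where `exp` is Lipschitz. -/
theorem IsScalePotential.isScaleRegular_exp_neg {p : U → ℝ} (hp : IsScalePotential e lam t p) :
    IsScaleRegular e lam t fun u => Real.exp (-p u) := by
  have hb : ∀ ρ : ℝ, ∃ B : ℝ, ∀ u, coord e u ∈ scaleSpace lam t →
      scaleNorm lam t (coord e u) ≤ ρ → |p u| ≤ B := fun ρ => by
    obtain ⟨K, hK⟩ := hp.lipschitz ρ
    refine ⟨|p 0| + |K| * ρ, fun u hu hρ => ?_⟩
    have h0 := scaleNorm_nonneg (lam := lam) (t := t) (coord e u)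
    have h1 := hK u 0 hu (by rw [coord_zero]; exact zero_mem _) hρ (by simp; linarith)
    rw [sub_zero] at h1
    have h2 : K * scaleNorm lam t (coord e u) ≤ |K| * ρ :=
      mul_le_mul (le_abs_self K) hρ h0 (abs_nonneg K)
    have h3 := abs_sub_abs_le_abs_sub (p u) (p 0)
    linarith
  refine ⟨fun u => Real.exp_pos _, ?_, fun ρ => ?_, fun ρ => ?_⟩
  · obtain ⟨c, hc, h⟩ := hp.lower
    refine ⟨Real.exp c, c, (Real.exp_pos _).le, hc, fun u hu => ?_⟩
    rw [← Real.exp_add]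
    exact Real.exp_le_exp.2 (by linarith [h u hu])
  · obtain ⟨B, hB⟩ := hb ρ
    exact ⟨Real.exp (-B), Real.exp_pos _, fun u hu hρ =>
      Real.exp_le_exp.2 (by linarith [abs_le.1 (hB u hu hρ)])⟩
  · obtain ⟨B, hB⟩ := hb ρ
    obtain ⟨K, hK⟩ := hp.lipschitz ρ
    refine ⟨Real.exp B * K, fun u v hu hv hu' hv' => ?_⟩
    rw [mul_assoc]
    exact (abs_exp_neg_sub_exp_neg_le (hB u hu hu') (hB v hv hv')).trans
      (mul_le_mul_of_nonneg_left (hK u v hu hv hu' hv') (Real.exp_pos _).le)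

end ScalePotential

/-! ### Data misfits as potentials on the Hilbert scale -/

section Misfit

variable {H κ : Type*} [NormedAddCommGroup H] [InnerProductSpace ℝ H]
  {φ : HilbertBasis κ ℝ H} {ζ : κ → ℝ} {s : ℝ}

theorem norm_le_mul_scaleNorm {C : H →L[ℝ] H} (hζ : ∀ k, 0 < ζ k) (hC : ∀ k, C (φ k) = ζ k • φ k)
    (hs : 0 ≤ s) {v : H} (hv : coord φ v ∈ scaleSpace ζ s) :
    ‖v‖ ≤ |‖C‖| ^ ((s - 0) / 2) * scaleNorm ζ s (coord φ v) := by
  rw [← scaleNorm_zero_index (lam := ζ) φ v]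
  exact (scaleSpace_mono_and_scaleNorm_le hζ (eigenvalue_le_opNorm φ hζ hC) hs hv).2

theorem summable_coord_mul (b : H) {v : κ → ℝ} (hv : v ∈ scaleSpace ζ s) :
    Summable (fun k => coord φ b k * (ζ k ^ (-s / 2) * v k)) ∧
      |∑' k, coord φ b k * (ζ k ^ (-s / 2) * v k)| ≤ ‖b‖ * scaleNorm ζ s v := by
  have key : ∀ k, inner ℝ (scaleSpaceToLp ζ 0 ⟨coord φ b, coord_mem_scaleSpace_zero_index φ b⟩ k)
      (scaleSpaceToLp ζ s ⟨v, hv⟩ k) = coord φ b k * (ζ k ^ (-s / 2) * v k) := fun k => by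
    rw [scaleSpaceToLp_apply, scaleSpaceToLp_apply]
    simp
    ring
  have h1 := lp.summable_inner (𝕜 := ℝ)
    (scaleSpaceToLp ζ 0 ⟨coord φ b, coord_mem_scaleSpace_zero_index φ b⟩)
    (scaleSpaceToLp ζ s ⟨v, hv⟩)
  have h2 := abs_real_inner_le_norm
    (scaleSpaceToLp ζ 0 ⟨coord φ b, coord_mem_scaleSpace_zero_index φ b⟩)
    (scaleSpaceToLp ζ s ⟨v, hv⟩)
  rw [lp.inner_eq_tsum] at h2
  simp only [key, norm_scaleSpaceToLp, scaleNorm_zero_index] at h1 h2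
  exact ⟨h1, h2⟩

theorem exists_abs_pairing_le_of_finiteDimensional [FiniteDimensional ℝ H] (b : H) :
    ∃ c : ℝ, ∀ v : H, |∑' k, coord φ b k * (ζ k ^ (-s / 2) * coord φ v k)| ≤ c * ‖v‖ := by
  have : Finite κ := φ.orthonormal.linearIndependent.finite
  have := Fintype.ofFinite κ
  refine ⟨‖∑ k, (coord φ b k * ζ k ^ (-s / 2)) • φ k‖, fun v => ?_⟩
  refine le_trans (le_of_eq ?_) (abs_real_inner_le_norm _ v)
  rw [tsum_fintype, sum_inner]
  congr 1
  refine Finset.sum_congr rfl fun k _ => ?_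
  rw [inner_smul_left, coord_apply φ v]
  simp
  ring

variable {U ι : Type*} [NormedAddCommGroup U] [InnerProductSpace ℝ U] {e : HilbertBasis ι ℝ U}
  {lam : ι → ℝ} {t : ℝ}

/-- With linear growth of `M₁` the pairing alone is bounded below linearly and the square is
dropped. In finite dimensions the pairing is at most `c ‖q u‖`, and the square absorbs it: `½x² - c
x ≥ -c²/2`. The local Lipschitz bound factors the difference of squares and uses linearity of the
pairing. -/
theorem isScalePotential_half_norm_sq_sub {C : H →L[ℝ] H} (hζ : ∀ k, 0 < ζ k)
    (hC : ∀ k, C (φ k) = ζ k • φ k) (hs : 0 ≤ s) (b : H) {q : U → H} {M₁ : ℝ → ℝ} {M₂ : ℝ → ℝ → ℝ}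
    (hM₁ : MonotoneOn M₁ (Set.Ici 0))
    (hgrowth : FiniteDimensional ℝ H ∨ ∃ a b : ℝ, ∀ r, 0 ≤ r → M₁ r ≤ a + b * r)
    (hM₂ : ∀ a a' b b' : ℝ, 0 ≤ a → a ≤ a' → 0 ≤ b → b ≤ b' → M₂ a b ≤ M₂ a' b')
    (hq : ∀ u, coord e u ∈ scaleSpace lam t → coord φ (q u) ∈ scaleSpace ζ s ∧
      scaleNorm ζ s (coord φ (q u)) ≤ M₁ (scaleNorm lam t (coord e u)))
    (hlip : ∀ u v, coord e u ∈ scaleSpace lam t → coord e v ∈ scaleSpace lam t →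
      scaleNorm ζ s (coord φ (q u - q v)) ≤
        M₂ (scaleNorm lam t (coord e u)) (scaleNorm lam t (coord e v)) *
          scaleNorm lam t (coord e (u - v))) :
    IsScalePotential e lam t fun u => 1 / 2 * ‖q u‖ ^ 2 -
      ∑' k, coord φ b k * (ζ k ^ (-s / 2) * coord φ (q u) k) := by
  constructor
  · rcases hgrowth with hfin | ⟨a₀, b₀, hab⟩
    · obtain ⟨c, hc⟩ := exists_abs_pairing_le_of_finiteDimensional (φ := φ) (ζ := ζ) (s := s) b
      refine ⟨c ^ 2 / 2, by positivity, fun u _ => ?_⟩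
      have h1 := (abs_le.1 (hc (q u))).2
      have h2 : 0 ≤ c ^ 2 / 2 * scaleNorm lam t (coord e u) :=
        mul_nonneg (by positivity) (scaleNorm_nonneg _)
      nlinarith [sq_nonneg (‖q u‖ - c)]
    · refine ⟨‖b‖ * (|a₀| + |b₀|), by positivity, fun u hu => ?_⟩
      have h1 := (abs_le.1 (summable_coord_mul (φ := φ) b (hq u hu).1).2).2
      have hN := scaleNorm_nonneg (lam := lam) (t := t) (coord e u)
      have h2 : scaleNorm ζ s (coord φ (q u)) ≤
          (|a₀| + |b₀|) * (1 + scaleNorm lam t (coord e u)) := by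
        have h3 := (hq u hu).2.trans (hab _ hN)
        have h4 := mul_le_mul_of_nonneg_right (le_abs_self b₀) hN
        have h5 := mul_nonneg (abs_nonneg a₀) hN
        have h6 := le_abs_self a₀
        have h7 := abs_nonneg b₀
        linarith
      have h3 := mul_le_mul_of_nonneg_left h2 (norm_nonneg b)
      have h4 : 0 ≤ 1 / 2 * ‖q u‖ ^ 2 := by positivity
      linarith
  · intro ρ
    set c := |‖C‖| ^ ((s - 0) / 2)
    have hc : 0 ≤ c := Real.rpow_nonneg (abs_nonneg _) _
    refine ⟨(c * M₁ ρ * c + ‖b‖) * M₂ ρ ρ, fun u v hu hv hu' hv' => ?_⟩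
    have hNu := scaleNorm_nonneg (lam := lam) (t := t) (coord e u)
    have hNv := scaleNorm_nonneg (lam := lam) (t := t) (coord e v)
    have hqu := (hq u hu).1
    have hqv := (hq v hv).1
    have hqd : coord φ (q u - q v) ∈ scaleSpace ζ s := by
      rw [coord_sub]; exact sub_mem hqu hqv
    have hnorm : ∀ w, coord e w ∈ scaleSpace lam t → scaleNorm lam t (coord e w) ≤ ρ →
        ‖q w‖ ≤ c * M₁ ρ := fun w hw hw' => by
      refine (norm_le_mul_scaleNorm hζ hC hs (hq w hw).1).trans ?_
      refine mul_le_mul_of_nonneg_left ((hq w hw).2.trans ?_) hc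
      exact hM₁ (scaleNorm_nonneg _) (hNu.trans hu') hw'
    set d := scaleNorm ζ s (coord φ (q u - q v)) with hd
    have hd0 : 0 ≤ d := scaleNorm_nonneg _
    have hdiff : ‖q u - q v‖ ≤ c * d := norm_le_mul_scaleNorm hζ hC hs hqd
    have hdle : d ≤ M₂ ρ ρ * scaleNorm lam t (coord e (u - v)) :=
      (hlip u v hu hv).trans (mul_le_mul_of_nonneg_right (hM₂ _ _ _ _ hNu hu' hNv hv')
        (scaleNorm_nonneg _))
    have hpair : |∑' k, coord φ b k * (ζ k ^ (-s / 2) * coord φ (q u) k) -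
        ∑' k, coord φ b k * (ζ k ^ (-s / 2) * coord φ (q v) k)| ≤ ‖b‖ * d := by
      have h1 := (summable_coord_mul (φ := φ) b hqd).2
      rw [← (summable_coord_mul (φ := φ) b hqu).1.tsum_sub (summable_coord_mul (φ := φ) b hqv).1]
      refine le_trans (le_of_eq ?_) h1
      congr 1
      refine tsum_congr fun k => ?_
      rw [coord_sub, Pi.sub_apply]
      ring
    have hsq : |1 / 2 * ‖q u‖ ^ 2 - 1 / 2 * ‖q v‖ ^ 2| ≤ c * M₁ ρ * c * d := by
      have h1 : 1 / 2 * ‖q u‖ ^ 2 - 1 / 2 * ‖q v‖ ^ 2 =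
        (‖q u‖ + ‖q v‖) / 2 * (‖q u‖ - ‖q v‖) := by ring
      rw [h1, abs_mul, abs_of_nonneg (by positivity), mul_assoc]
      have h2 := hnorm u hu hu'
      have h3 := hnorm v hv hv'
      refine mul_le_mul (by linarith) ((abs_norm_sub_norm_le _ _).trans hdiff) (abs_nonneg _)
        ((norm_nonneg _).trans h2)
    have hM0 : 0 ≤ c * M₁ ρ := (norm_nonneg _).trans (hnorm u hu hu')
    calc _ = |(1 / 2 * ‖q u‖ ^ 2 - 1 / 2 * ‖q v‖ ^ 2) -
          (∑' k, coord φ b k * (ζ k ^ (-s / 2) * coord φ (q u) k) -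
            ∑' k, coord φ b k * (ζ k ^ (-s / 2) * coord φ (q v) k))| := by ring_nf
      _ ≤ c * M₁ ρ * c * d + ‖b‖ * d := (abs_sub _ _).trans (add_le_add hsq hpair)
      _ = (c * M₁ ρ * c + ‖b‖) * d := by ring
      _ ≤ (c * M₁ ρ * c + ‖b‖) * (M₂ ρ ρ * scaleNorm lam t (coord e (u - v))) :=
          mul_le_mul_of_nonneg_left hdle (by positivity)
      _ = _ := by ring

end Misfit

/-! ### Dependence of the prior mean on the hyper-parameter -/

section PriorMean

variable {U ι : Type*} [NormedAddCommGroup U] [InnerProductSpace ℝ U] {e : HilbertBasis ι ℝ U}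
  {lam : ι → ℝ} {σ : ℝ}

/-- A dual description of the norm of the scale. -/
theorem scaleNorm_le_of_abs_pairing_le (hlam : ∀ k, 0 < lam k) {d : ι → ℝ} {A B : ℝ} (hA : 0 ≤ A)
    (h : ∀ u : U, coord e u ∈ scaleSpace lam (1 - σ) →
      |∑' k, (lam k)⁻¹ * d k * coord e u k| ≤ A * (B + scaleNorm lam (1 - σ) (coord e u))) :
    scaleNorm lam (1 + σ) d ≤ A := by
  refine Real.sqrt_le_left hA |>.2 ?_
  refine Real.tsum_le_of_sum_le (fun k => sq_nonneg _) fun s => ?_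
  set X := ∑ k ∈ s, (lam k ^ (-(1 + σ) / 2) * d k) ^ 2 with hX
  have hX0 : 0 ≤ X := Finset.sum_nonneg fun _ _ => sq_nonneg _
  -- The extremal test vector: both its squared norm in `U^{1-σ}` and its pairing with `d` equal the
  -- partial sum `X`.
  set u : U := ∑ k ∈ s, (lam k ^ (-σ) * d k) • e k
  have hcu : coord e u = (s : Set ι).indicator fun k => lam k ^ (-σ) * d k := coord_sum_smul e s _
  have hum : coord e u ∈ scaleSpace lam (1 - σ) := by
    rw [hcu]; exact indicator_mem_scaleSpace s _
  have hN : scaleNorm lam (1 - σ) (coord e u) = √X := by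
    rw [scaleNorm, hcu, tsum_eq_sum (s := s) fun k hk => by
      simp [Set.indicator_of_notMem (by simpa using hk : k ∉ (s : Set ι))]]
    congr 1
    refine Finset.sum_congr rfl fun k hk => ?_
    rw [Set.indicator_of_mem (by simpa using hk : k ∈ (s : Set ι)), ← mul_assoc,
      ← Real.rpow_add (hlam k)]
    ring_nf
  have hp : ∑' k, (lam k)⁻¹ * d k * coord e u k = X := by
    rw [hcu, tsum_eq_sum (s := s) fun k hk => by
      simp [Set.indicator_of_notMem (by simpa using hk : k ∉ (s : Set ι))]]
    refine Finset.sum_congr rfl fun k hk => ?_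
    rw [Set.indicator_of_mem (by simpa using hk : k ∈ (s : Set ι)), mul_pow,
      ← Real.rpow_natCast (lam k ^ (-(1 + σ) / 2)), ← Real.rpow_mul (hlam k).le,
      show -(1 + σ) / 2 * ((2 : ℕ) : ℝ) = -1 + -σ by push_cast; ring,
      Real.rpow_add (hlam k), Real.rpow_neg_one]
    ring
  -- Testing with `τ u` and letting `τ → ∞` removes the additive constant `B`.
  have key : ∀ τ : ℝ, 0 < τ → X ≤ A * √X + A * B * τ⁻¹ := fun τ hτ => by
    have h1 := h (τ • u) (by rw [coord_smul]; exact Submodule.smul_mem _ _ hum)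
    rw [coord_smul, scaleNorm_smul, abs_of_pos hτ, hN] at h1
    simp only [Pi.smul_apply, smul_eq_mul, mul_left_comm _ τ] at h1
    rw [tsum_mul_left, hp, abs_of_nonneg (by positivity)] at h1
    have h2 := mul_le_mul_of_nonneg_left h1 (inv_pos.2 hτ).le
    rw [inv_mul_cancel_left₀ hτ.ne'] at h2
    refine h2.trans (le_of_eq ?_)
    field_simp
    ring
  have hlim : X ≤ A * √X := by
    have h1 : Tendsto (fun τ : ℝ => A * √X + A * B * τ⁻¹) atTop (𝓝 (A * √X + A * B * 0)) :=
      tendsto_const_nhds.add (tendsto_inv_atTop_zero.const_mul _)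
    rw [mul_zero, add_zero] at h1
    exact ge_of_tendsto h1 ((eventually_gt_atTop 0).mono key)
  have hsq := Real.sq_sqrt hX0
  have : √X ≤ A := by
    rcases (Real.sqrt_nonneg X).eq_or_lt with h0 | h0
    · rwa [← h0]
    · nlinarith
  calc X = √X ^ 2 := hsq.symm
    _ ≤ A ^ 2 := pow_le_pow_left₀ (Real.sqrt_nonneg _) this 2

/-- A bound on the derivative of the log-density of Gaussian measures with respect to a parameter of
the mean controls the variation of the mean. -/
theorem scaleNorm_sub_le_of_fderiv_shiftPotential_le {Θ : Type*} [NormedAddCommGroup Θ]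
    [NormedSpace ℝ Θ] (hlam : ∀ k, 0 < lam k) {f : Θ → U} {r M : ℝ}
    (hf : ∀ θ, coord e (f θ) ∈ scaleSpace lam (1 + σ))
    (hD : ∀ θ u, ‖θ‖ < r → coord e u ∈ scaleSpace lam (1 - σ) →
      DifferentiableAt ℝ (fun ϑ => shiftPotential e lam (f ϑ) u) θ ∧
      ‖fderiv ℝ (fun ϑ => shiftPotential e lam (f ϑ) u) θ‖ ≤
        M * (1 + scaleNorm lam (1 - σ) (coord e u)))
    {θ₁ θ₂ : Θ} (h₁ : ‖θ₁‖ < r) (h₂ : ‖θ₂‖ < r) :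
    scaleNorm lam (1 + σ) (coord e (f θ₁ - f θ₂)) ≤ M * ‖θ₁ - θ₂‖ := by
  have hzero : coord e (0 : U) ∈ scaleSpace lam (1 - σ) := by rw [coord_zero]; exact zero_mem _
  have hM : 0 ≤ M := by
    have := (norm_nonneg _).trans (hD θ₁ 0 h₁ hzero).2
    simpa using this
  have hmv : ∀ u, coord e u ∈ scaleSpace lam (1 - σ) →
      |shiftPotential e lam (f θ₁) u - shiftPotential e lam (f θ₂) u| ≤
        M * (1 + scaleNorm lam (1 - σ) (coord e u)) * ‖θ₁ - θ₂‖ := fun u hu =>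
    (convex_ball (0 : Θ) r).norm_image_sub_le_of_norm_fderiv_le
      (fun θ hθ => (hD θ u (by simpa using hθ) hu).1)
      (fun θ hθ => (hD θ u (by simpa using hθ) hu).2) (by simpa using h₂) (by simpa using h₁)
  -- Subtracting the estimate at `u = 0` cancels the part of `Φ̃` quadratic in the mean; the two
  -- bounds add up to `2 + ‖u‖`.
  refine scaleNorm_le_of_abs_pairing_le (e := e) (B := 2) hlam (by positivity) fun u hu => ?_
  have hsum : ∑' k, (lam k)⁻¹ * coord e (f θ₁ - f θ₂) k * coord e u k =
      ∑' k, (lam k)⁻¹ * coord e (f θ₁) k * coord e u k -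
        ∑' k, (lam k)⁻¹ * coord e (f θ₂) k * coord e u k := by
    rw [← (summable_mul_of_mem_scaleSpace hlam (hf θ₁) hu).1.tsum_sub
      (summable_mul_of_mem_scaleSpace hlam (hf θ₂) hu).1]
    refine tsum_congr fun k => ?_
    rw [coord_sub, Pi.sub_apply]
    ring
  have h1 := hmv u hu
  have h2 := hmv 0 hzero
  simp only [shiftPotential, coord_zero, Pi.zero_apply, mul_zero, tsum_zero, sub_zero,
    scaleNorm_zero, add_zero, mul_one] at h1 h2
  rw [hsum]
  rw [abs_le] at h1 h2 ⊢
  constructor <;> linarith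

end PriorMean

/-! ### The hyper-potential -/

section LogIntegral

theorem abs_log_sub_log_le {c x y : ℝ} (hc : 0 < c) (hx : c ≤ x) (hy : c ≤ y) :
    |Real.log x - Real.log y| ≤ c⁻¹ * |x - y| := by
  wlog h : y ≤ x generalizing x y
  · rw [abs_sub_comm, abs_sub_comm x]
    exact this hy hx (le_of_not_ge h)
  have hy0 := hc.trans_le hy
  have hx0 := hc.trans_le hx
  rw [abs_of_nonneg (sub_nonneg.2 (Real.log_le_log hy0 h)), abs_of_nonneg (sub_nonneg.2 h),
    ← Real.log_div hx0.ne' hy0.ne']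
  calc Real.log (x / y) ≤ x / y - 1 := Real.log_le_sub_one_of_pos (div_pos hx0 hy0)
    _ = y⁻¹ * (x - y) := by field_simp
    _ ≤ c⁻¹ * (x - y) :=
        mul_le_mul_of_nonneg_right (inv_anti₀ hc hy) (sub_nonneg.2 h)

variable {U : Type*} [NormedAddCommGroup U] [InnerProductSpace ℝ U] [CompleteSpace U]
  [SecondCountableTopology U] [MeasurableSpace U] [BorelSpace U] {C : U →L[ℝ] U} {ι : Type*}
  {e : HilbertBasis ι ℝ U} {lam : ι → ℝ} {σ : ℝ} {F : U → ℝ}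

/-- The integrals stay above a constant `c > 0`, where `log` has Lipschitz constant `c⁻¹`, so their
bounds transfer to the logarithms. -/
theorem IsScaleRegular.exists_log_integral_bounds (hF : IsScaleRegular e lam (1 - σ) F)
    (hσ : 0 ≤ σ) (hlam : ∀ k, 0 < lam k) (hC : ∀ k, C (e k) = lam k • e k)
    (hTr : Summable fun k => lam k ^ σ) (R : ℝ) : ∃ B K : ℝ, 0 ≤ K ∧ ∀ (P Q : Measure U) (a b : U),
      IsGaussianWith P a C → IsGaussianWith Q b C → coord e a ∈ scaleSpace lam (1 + σ) →
      coord e b ∈ scaleSpace lam (1 + σ) → scaleNorm lam (1 + σ) (coord e a) ≤ R →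
      scaleNorm lam (1 + σ) (coord e b) ≤ R →
      Integrable F P ∧ 0 < ∫ u, F u ∂P ∧ |Real.log (∫ u, F u ∂P)| ≤ B ∧
      |Real.log (∫ u, F u ∂P) - Real.log (∫ u, F u ∂Q)| ≤
        K * scaleNorm lam (1 + σ) (coord e (a - b)) := by
  -- A summable family of strictly positive terms has a countable index set.
  have : Countable ι := by
    have h := hTr.countable_support
    rw [show (Function.support fun k => lam k ^ σ) = Set.univ from
      Set.eq_univ_of_forall fun k => (Real.rpow_pos_of_pos (hlam k) σ).ne'] at h
    exact Set.countable_univ_iff.1 h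
  set R' := max R 0
  set c₀ := |‖C‖| ^ (((1 + σ) - (1 - σ)) / 2)
  have hc₀ : 0 ≤ c₀ := Real.rpow_nonneg (abs_nonneg _) _
  have hemb : ∀ v ∈ scaleSpace lam (1 + σ), scaleNorm lam (1 + σ) v ≤ R →
      v ∈ scaleSpace lam (1 - σ) ∧ scaleNorm lam (1 - σ) v ≤ c₀ * R' := fun v hv hR => by
    obtain ⟨h1, h2⟩ :=
      scaleSpace_mono_and_scaleNorm_le hlam (eigenvalue_le_opNorm e hlam hC)
        (by linarith : 1 - σ ≤ 1 + σ) hv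
    exact ⟨h1, h2.trans (mul_le_mul_of_nonneg_left (hR.trans (le_max_left _ _)) hc₀)⟩
  obtain ⟨c, hc, D, hD⟩ := hF.exists_integral_bounds hlam hC hTr (c₀ * R')
  obtain ⟨K, hK⟩ := hF.exists_abs_integral_sub_le hσ hlam hC hTr (le_max_right R 0)
  refine ⟨max (-Real.log c) (Real.log D), c⁻¹ * |K|, by positivity,
    fun P Q a b hP hQ ha hb haR hbR => ?_⟩
  obtain ⟨hPi, hPc, hPD⟩ := hD P a hP (hemb _ ha haR).1 (hemb _ ha haR).2
  obtain ⟨hQi, hQc, hQD⟩ := hD Q b hQ (hemb _ hb hbR).1 (hemb _ hb hbR).2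
  refine ⟨hPi, hc.trans_le hPc, abs_le'.2 ⟨?_, ?_⟩, ?_⟩
  · exact (Real.log_le_log (hc.trans_le hPc) hPD).trans (le_max_right _ _)
  · exact (neg_le_neg (Real.log_le_log hc hPc)).trans (le_max_left _ _)
  · refine (abs_log_sub_log_le hc hPc hQc).trans ?_
    rw [mul_assoc]
    refine mul_le_mul_of_nonneg_left ?_ (inv_pos.2 hc).le
    exact (hK Q P b a hQ hP hb ha (hbR.trans (le_max_left _ _)) (haR.trans (le_max_left _ _))).trans
      (mul_le_mul_of_nonneg_right (le_abs_self K) (scaleNorm_nonneg _))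

end LogIntegral

end HyperPosterior

/-! ### Proof of the theorem -/

open HyperPosterior in
theorem theorem4p2
    -- parameter space `U`; the operator `C₀` with its eigen-system; the smoothness index `σ = s̃`
    {U ι : Type*} [NormedAddCommGroup U] [InnerProductSpace ℝ U] [CompleteSpace U]
    [SecondCountableTopology U] [MeasurableSpace U] [BorelSpace U]
    (C₀ : U →L[ℝ] U) (e : HilbertBasis ι ℝ U) (lam : ι → ℝ)
    (hlam : ∀ k, 0 < lam k) (hC₀ : ∀ k, C₀ (e k) = lam k • e k)
    (σ : ℝ) (hσ : 0 < σ) (hσ1 : σ ≤ 1) (hTr : Summable fun k => lam k ^ σ)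
    -- data space `H`; the operator `C₁` with its eigen-system; the noise covariance `Γ = R ∘ R`
    {H κ : Type*} [NormedAddCommGroup H] [InnerProductSpace ℝ H] [CompleteSpace H]
    [SecondCountableTopology H]
    (C₁ : H →L[ℝ] H) (φ : HilbertBasis κ ℝ H) (ζ : κ → ℝ)
    (hζ : ∀ k, 0 < ζ k) (hC₁ : ∀ k, C₁ (φ k) = ζ k • φ k)
    (Γ R : H →L[ℝ] H) (hΓ : Function.Injective Γ) (hR : R.IsPositive) (hRR : R ∘L R = Γ)
    (α s : ℝ) (hs : 0 ≤ s)
    (hwhite : ∃ K : ℝ, ∀ w : H, coord φ (R w) ∈ scaleSpace ζ (α - s) →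
      scaleNorm ζ (-s) (coord φ w) ≤ K * scaleNorm ζ (α - s) (coord φ (R w)))
    -- forward operator `G` and measurement operators `L x`
    {X W : Type*} (G : U → W) (L : X → W → H) (M₁ : ℝ → ℝ) (M₂ : ℝ → ℝ → ℝ)
    (hM₁ : MonotoneOn M₁ (Set.Ici 0))
    (hM₁growth : FiniteDimensional ℝ H ∨ ∃ a b : ℝ, ∀ r, 0 ≤ r → M₁ r ≤ a + b * r)
    (hM₂ : ∀ a a' b b' : ℝ, 0 ≤ a → a ≤ a' → 0 ≤ b → b ≤ b' → M₂ a b ≤ M₂ a' b')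
    (hG : ∀ (x : X) (u : U), coord e u ∈ scaleSpace lam (1 - σ) →
      L x (G u) ∈ Set.range R ∧ coord φ (negHalf R (L x (G u))) ∈ scaleSpace ζ s ∧
      scaleNorm ζ s (coord φ (negHalf R (L x (G u)))) ≤ M₁ (scaleNorm lam (1 - σ) (coord e u)))
    (hGlip : ∀ (x : X) (u₁ u₂ : U), coord e u₁ ∈ scaleSpace lam (1 - σ) →
      coord e u₂ ∈ scaleSpace lam (1 - σ) →
      scaleNorm ζ s (coord φ (negHalf R (L x (G u₁)) - negHalf R (L x (G u₂)))) ≤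
        M₂ (scaleNorm lam (1 - σ) (coord e u₁)) (scaleNorm lam (1 - σ) (coord e u₂)) *
          scaleNorm lam (1 - σ) (coord e (u₁ - u₂)))
    -- the data sets `S 1, …, S n`, each consisting of `m` pairs `(x, y)`
    {n m : ℕ} (S : Fin n → Fin m → X × scaleSpace ζ (α - s))
    -- hyper-parameters, the prediction function `f`, and the base priors `P S θ = 𝒩(f(S;θ), C₀)`
    {Θ : Type*} [NormedAddCommGroup Θ] [NormedSpace ℝ Θ] [CompleteSpace Θ]
    [SecondCountableTopology Θ] [MeasurableSpace Θ] [BorelSpace Θ]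
    (f : (Fin m → X × scaleSpace ζ (α - s)) → Θ → U) (Rᵤ : ℝ)
    (hf : ∀ i θ, coord e (f (S i) θ) ∈ scaleSpace lam (1 + σ) ∧
      scaleNorm lam (1 + σ) (coord e (f (S i) θ)) ≤ Rᵤ)
    (P : (Fin m → X × scaleSpace ζ (α - s)) → Θ → Measure U)
    (hP : ∀ i θ, IsGaussianWith (P (S i) θ) (f (S i) θ) C₀)
    -- local bound on `D_θ Φ̃`
    (M₅ : ℝ → ℝ)
    (hDΦ : ∀ (i : Fin n) (r : ℝ) (θ : Θ) (u : U), ‖θ‖ < r →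
      coord e u ∈ scaleSpace lam (1 - σ) →
      DifferentiableAt ℝ (fun ϑ => shiftPotential e lam (f (S i) ϑ) u) θ ∧
      ‖fderiv ℝ (fun ϑ => shiftPotential e lam (f (S i) ϑ) u) θ‖ ≤
        M₅ r * (1 + scaleNorm lam (1 - σ) (coord e u)))
    -- the potential `Φ(u; (x, y))`
    (pot : U → X × scaleSpace ζ (α - s) → ℝ)
    (hpot : pot = potential φ ζ R α s G L)
    -- Gaussian hyper-prior
    (hyperPrior : Measure Θ) (hprior : IsGaussian hyperPrior) :
    -- `Φ^h` is well defined
    (∀ i θ, Integrable (likelihood pot (S i)) (P (S i) θ) ∧ 0 < Zm pot (S i) (P (S i) θ)) ∧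
    -- locally bounded
    (∀ r : ℝ, ∃ K : ℝ, ∀ θ : Θ, ‖θ‖ < r → |hyperPotential pot P S θ| ≤ K) ∧
    -- locally Lipschitz
    (∀ r : ℝ, ∃ K : ℝ, ∀ θ₁ θ₂ : Θ, ‖θ₁‖ < r → ‖θ₂‖ < r →
      |hyperPotential pot P S θ₁ - hyperPotential pot P S θ₂| ≤ K * ‖θ₁ - θ₂‖) ∧
    -- the hyper-posterior is a probability measure and has a MAP estimator
    IsProbabilityMeasure (hyperPosterior pot P S hyperPrior) ∧
    (∃ θ : Θ, IsMAPEstimator (hyperPosterior pot P S hyperPrior) θ) ∧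
    -- the MAP estimators are the solutions of the optimization problem
    (∀ θ : Θ, IsMAPEstimator (hyperPosterior pot P S hyperPrior) θ ↔
      θ ∈ cmAffine hyperPrior ∧
      IsMinOn (fun ϑ => hyperPotential pot P S ϑ +
        1 / 2 * (cmNorm hyperPrior (ϑ - ∫ η, η ∂hyperPrior)).toReal ^ 2) (cmAffine hyperPrior) θ)
    := by
  have hreg : ∀ i, IsScaleRegular e lam (1 - σ) (likelihood pot (S i)) := fun i => by
    refine (IsScalePotential.sum Finset.univ fun j => ?_).isScaleRegular_exp_neg
    rw [hpot]
    exact isScalePotential_half_norm_sq_sub hζ hC₁ hs _ hM₁ hM₁growth hM₂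
      (fun u hu => (hG (S i j).1 u hu).2) (fun u v hu hv => hGlip (S i j).1 u v hu hv)
  choose B K hK hBK using fun i => (hreg i).exists_log_integral_bounds hσ.le hlam hC₀ hTr Rᵤ
  have hZ := fun i θ₁ θ₂ => hBK i (P (S i) θ₁) (P (S i) θ₂) (f (S i) θ₁) (f (S i) θ₂) (hP i θ₁)
    (hP i θ₂) (hf i θ₁).1 (hf i θ₂).1 (hf i θ₁).2 (hf i θ₂).2
  -- The bound holds for all `θ`, not only on balls, because the prior means stay in one ball of
  -- `U^{1+σ}`. The characterization of MAP estimators relies on this.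
  have hbound : ∀ θ, |hyperPotential pot P S θ| ≤ 1 / ((m : ℝ) + 1) * ∑ i, B i := fun θ => by
    rw [hyperPotential, abs_mul, abs_neg, abs_of_nonneg (by positivity)]
    exact mul_le_mul_of_nonneg_left ((Finset.abs_sum_le_sum_abs _ _).trans
      (Finset.sum_le_sum fun i _ => (hZ i θ θ).2.2.1)) (by positivity)
  have hlip : ∀ r : ℝ, ∃ K : ℝ, ∀ θ₁ θ₂ : Θ, ‖θ₁‖ < r → ‖θ₂‖ < r →
      |hyperPotential pot P S θ₁ - hyperPotential pot P S θ₂| ≤ K * ‖θ₁ - θ₂‖ := fun r => by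
    refine ⟨1 / ((m : ℝ) + 1) * ∑ i, K i * M₅ r, fun θ₁ θ₂ h₁ h₂ => ?_⟩
    rw [hyperPotential, hyperPotential, ← mul_sub, abs_mul, abs_neg, abs_of_nonneg (by positivity),
      mul_assoc, ← Finset.sum_sub_distrib, Finset.sum_mul]
    refine mul_le_mul_of_nonneg_left ((Finset.abs_sum_le_sum_abs _ _).trans
      (Finset.sum_le_sum fun i _ => (hZ i θ₁ θ₂).2.2.2.trans ?_)) (by positivity)
    rw [mul_assoc]
    exact mul_le_mul_of_nonneg_left (scaleNorm_sub_le_of_fderiv_shiftPotential_le hlam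
      (fun θ => (hf i θ).1) (fun θ u hθ hu => hDΦ i r θ u hθ hu) h₁ h₂) (hK i)
  obtain ⟨hex, hiff⟩ := isMAPEstimator_tilted (μ := hyperPrior) hbound hlip
  refine ⟨fun i θ => ⟨(hZ i θ θ).1, (hZ i θ θ).2.1⟩, fun r => ⟨_, fun θ _ => hbound θ⟩, hlip, ?_,
    hex, hiff⟩
  exact isProbabilityMeasure_tilted (integrable_exp_neg_of_bounded hbound
    (continuous_of_lipschitz_on_balls hlip))
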